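/- Let $d(k)$ be the number of positive divisors of $k$ and put $$f(t,k)=2t\,\mathrm{arsinh}\sqrt{\frac{\pi k}{2t}}+\sqrt{2\pi kt+\pi^2k^2}-\frac{\pi}{4}.$$ (i) Let $\varepsilon,\eta,\theta>0$ with $\eta\le\varepsilon$, and let $B$ be a real number. There is a constant $C=C(\varepsilon,\eta,\theta,B)$ with the following property. Let $T\ge 8$, $T^{\theta}\le G\le T^{1/3}$, let $R\ge 0$ be an integer, and let $t_1<\dots<t_R$ be points of $[T,2T]$ with $t_{r+1}-t_r\ge 5G$ for $1\le r<R$. For each $r\le R$ let $\varphi_r\in C^\infty(\mathbb R)$ satisfy $0\le\varphi_r\le B$, be supported in $[t_r-2G,\,t_r+2G]$, and equal $1$ on $[t_r-G,\,t_r+G]$. Then $$\Bigl|\sum_{r\le R}\int_{t_r-2G}^{t_r+2G}\varphi_r(t)\,t^{-1/4}\sum_{1\le k\le T^{1+\eta}G^{-2}}(-1)^kd(k)k^{-1/4}\sin f(t,k)\,dt\Bigr|\le C\,R^{1/2}\,T^{1/2+\varepsilon}.$$ (ii) For every $\varepsilon>0$ there is a constant $C=C(\varepsilon)$ such that, whenever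 $T\ge1$, $V>0$, and $t_1<\dots<t_R$ are points of $[T,2T]$ with $t_{r+1}-t_r\ge1$ for $1\le r<R$ and $|\zeta(\tfrac12+it_r)|\ge V$ for all $r\le R$, one has $$R\le C\,T^{1+\varepsilon}V^{-4}.$$ (iii) For every $\varepsilon>0$ there is a constant $C=C(\varepsilon)$ such that for all $T\ge1$ $$\int_0^T|\zeta(\tfrac12+it)|^4\,dt\le C\,T^{1+\varepsilon}.$$ -/

import Mathlib

/-- The phase `f(t,k) = 2t arsinh √(πk/(2t)) + √(2πkt + π²k²) - π/4`. -/
noncomputable def atkinsonPhase (t : ℝ) (k : ℕ) : ℝ :=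
  2 * t * Real.arsinh (Real.sqrt (Real.pi * k / (2 * t)))
    + Real.sqrt (2 * Real.pi * k * t + Real.pi ^ 2 * (k : ℝ) ^ 2) - Real.pi / 4

/-- The divisor sum `∑_{1 ≤ k ≤ X} (-1)^k d(k) k^{-1/4} sin f(t,k)`. -/
noncomputable def atkinsonSum (X t : ℝ) : ℝ :=
  ∑ k ∈ Finset.Icc 1 ⌊X⌋₊,
    (-1 : ℝ) ^ k * (k.divisors.card : ℝ) * (k : ℝ) ^ (-(1 / 4) : ℝ) * Real.sin (atkinsonPhase t k)

/-- The points `τ 1 < ⋯ < τ R` lie in `[T, 2T]`, and consecutive ones are at least `δ` apart. -/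
def WellSpacedPoints (T δ : ℝ) (R : ℕ) (τ : ℕ → ℝ) : Prop :=
  (∀ r ∈ Finset.Icc 1 R, T ≤ τ r ∧ τ r ≤ 2 * T) ∧
    ∀ r ∈ Finset.Ico 1 R, δ ≤ τ (r + 1) - τ r

/-- A smooth weight `φ` with `0 ≤ φ ≤ B`, supported in `[c - 2G, c + 2G]` and equal to `1` on
`[c - G, c + G]`. -/
structure IsSmoothWeight (B c G : ℝ) (φ : ℝ → ℝ) : Prop where
  smooth : ContDiff ℝ (⊤ : ℕ∞) φ
  nonneg : ∀ t, 0 ≤ φ t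
  le_bound : ∀ t, φ t ≤ B
  support_subset : Function.support φ ⊆ Set.Icc (c - 2 * G) (c + 2 * G)
  eq_one : ∀ t ∈ Set.Icc (c - G) (c + G), φ t = 1

/-- The weighted sum
`∑_{r ≤ R} ∫_{τ_r - 2G}^{τ_r + 2G} φ_r(t) t^{-1/4} ∑_{k ≤ X} (-1)^k d(k) k^{-1/4} sin f(t,k) dt`. -/
noncomputable def weightedAtkinsonSum (X G : ℝ) (R : ℕ) (τ : ℕ → ℝ) (φ : ℕ → ℝ → ℝ) : ℝ :=
  ∑ r ∈ Finset.Icc 1 R,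
    ∫ t in (τ r - 2 * G)..(τ r + 2 * G), φ r t * t ^ (-(1 / 4) : ℝ) * atkinsonSum X t

/-!
# Atkinson's divisor sum and the fourth moment of the zeta function

**The weighted divisor sum.** By `hasDerivAt_atkinsonPhase` the phase `f(t, k)` has derivative
`2 arsinh √(πk / 2t)`, and for `l < k` the frequencies of `f(·, k)` and `f(·, l)` differ by at least
`(k - l) / (2 √(k (T + k)))` on `[T/2, 3T]` (`atkinsonFreq_sub_ge`). The first derivative test
`abs_integral_cos_le` bounds the correlation of two terms, so the mean square of the divisor sum of
length `N` is `O(T^κ (T √N + N √(T + N)))` (`integral_atkinsonSum_sq_le`). The windows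
`[τ_r - 2G, τ_r + 2G]` do not overlap, and Cauchy's inequality gives the bound with the factor
`R^{1/2}` (`exists_weightedAtkinsonSum_bound`).

**Values of the zeta function.** Both bounds on `ζ(1/2 + it)` follow from the discrete inequality
`∑ |ζ(1/2 + i t_r)|⁴ ≤ C X^{1 + ε}` for `1`-spaced points of `[1, X]`, which is
`exists_sum_norm_riemannZeta_pow_four_le`; averaging it over the translates `t_r = r + x` with
`0 ≤ x ≤ 1` gives the integral. Its proof uses neither an approximate functional equation nor
Voronoi summation:

* The function `Θ(z) = ∑ c_n exp(-π n² z / 4)` (`twistTheta`) has coefficients `c_n` chosen such that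
  `c_0 = 0` and `Θ(1/z) = z^{1/2} Θ(z)`; it decays rapidly at `0` and at `∞` along every ray
  `z = x w` with `Re w > 0`. Its Mellin transform along the ray is
  `w^{-s/2} (3 - 2^s - 2·2^{-s}) Λ(s)`, where `Λ` is the completed zeta function
  (`mellin_twistTheta_ray`). For `w = exp(i (π/2 - 1/X))` the factor `w^{-s/2}` compensates, up to a
  constant and for `1 ≤ Im s ≤ X`, the exponential decay of the gamma factor, while the Dirichlet
  polynomial in `2^s` stays away from `0` on the critical line. Thus `|ζ(1/2 + it)| t^{-1/4}` is
  bounded by the Mellin transform (`exists_norm_riemannZeta_le_mellin`); the lower bound for the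
  gamma factor comes from the reflection formula and the three lines theorem.
* In logarithmic coordinates the Mellin transform is a Fourier transform, so its square is the
  Fourier transform of a self-convolution `rayConv`. The inversion `Θ(1/z) = z^{1/2} Θ(z)` makes the
  two half lines contribute equally, hence only `x > 0` matters (`norm_mellin_sq_le`).
* On `x > 0` the self-convolution is, with `y = e^{x/2}`, the series
  `e^{x/4} ∑ a_k K(π k y / 2)`, where `a_k = ∑_{mn = k} c_m c_n` is at most `4 d(k)` in size and
  `K(ρ) = ∫ exp(-ρ w cosh v) dv` is a Bessel function (`tendsto_sum_besselKer`). Writing `K(ρ)` as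
  `e^{-ρ w}` times a Laplace transform (`besselKer_eq_laplace`) turns the series into an average over
  `b > 0` of exponential sums `∑ a_k exp(-π k y (w + b) / 2)`.
* The mean square of such a sum in `x` is a double sum over `k, l` whose terms carry the denominator
  `max((k + l) Re(w + b), |k - l|)`. The divisor bound makes it
  `O(X^ε b^{ε - 1})`, and a weighted Cauchy inequality in `b` bounds the mean square of `rayConv`,
  against the weight `e^{εx/2}`, by a small power of `X` (`exists_lintegral_rayConv_sq_le`).
* A large sieve inequality, proved by duality, passes from this mean square to the values of the
  Fourier transform at `1`-spaced points (`sum_norm_sq_integral_mul_cexp_le`).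
-/

section

open Real Set Filter Topology MeasureTheory

/-! ### The divisor bound -/

/-- The local factor of the divisor function at a small prime `p`: the constant absorbs the `a + 1`
divisors of `p ^ a`. -/
theorem add_one_le_const_mul_rpow {ε : ℝ} (hε : 0 < ε) (p a : ℕ) (hp : 2 ≤ p) :
    (a + 1 : ℝ) ≤ (1 + 1 / (ε * log 2)) * ((p : ℝ) ^ ε) ^ a := by
  have hl : 0 < log 2 := Real.log_pos (by norm_num)
  have h2 : (2:ℝ) ^ ε ≤ (p:ℝ) ^ ε := by
    apply rpow_le_rpow (by norm_num) (by exact_mod_cast hp) hε.le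
  have h3 : ((2:ℝ) ^ ε) ^ a ≤ ((p:ℝ) ^ ε) ^ a := by gcongr
  have h4 : 1 + a * (ε * log 2) ≤ ((2:ℝ)^ε)^a := by
    rw [Real.rpow_def_of_pos (by norm_num), ← Real.exp_nat_mul]
    have := Real.add_one_le_exp ((a:ℝ) * (log 2 * ε))
    nlinarith
  have h5 : (a + 1 : ℝ) ≤ (1 + 1 / (ε * log 2)) * (1 + a * (ε * log 2)) := by
    have hm : 0 < ε * log 2 := by positivity
    have : (1 + 1 / (ε * log 2)) * (1 + a * (ε * log 2)) =
      1 + a + a * (ε * log 2) + 1 / (ε * log 2) := by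
      field_simp; ring
    rw [this]
    have : 0 ≤ a * (ε * log 2) := by positivity
    have : 0 ≤ 1 / (ε * log 2) := by positivity
    linarith
  refine h5.trans ?_
  gcongr
  exact h4.trans h3

/-- The local factor of the divisor function at a prime so large that `p ^ ε ≥ 2`: no constant is
needed, so only finitely many primes contribute one. -/
theorem add_one_le_rpow_of_large {ε : ℝ} (hε : 0 < ε) (p a : ℕ) (hp : (2:ℝ) ^ (1 / ε) ≤ p) :
    (a + 1 : ℝ) ≤ ((p : ℝ) ^ ε) ^ a := by
  have h2 : (2:ℝ) ≤ (p:ℝ) ^ ε := by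
    have := rpow_le_rpow (by positivity) hp hε.le
    rwa [← rpow_mul (by norm_num), one_div, inv_mul_cancel₀ hε.ne', rpow_one] at this
  calc (a + 1 : ℝ) ≤ (2:ℝ) ^ a := by exact_mod_cast Nat.lt_two_pow_self (n := a)
    _ ≤ _ := by gcongr

/-- The divisor bound `d(n) = O_ε(n ^ ε)`. -/
theorem exists_card_divisors_le_rpow {ε : ℝ} (hε : 0 < ε) :
    ∃ D : ℝ, 1 ≤ D ∧ ∀ n : ℕ, (n.divisors.card : ℝ) ≤ D * (n : ℝ) ^ ε := by
  set K : ℝ := 1 + 1 / (ε * log 2) with hK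
  have hK1 : 1 ≤ K := by
    have hl : 0 < log 2 := Real.log_pos (by norm_num)
    have : 0 ≤ 1 / (ε * log 2) := by positivity
    linarith
  set M : ℕ := ⌈(2:ℝ) ^ (1 / ε)⌉₊ with hM
  refine ⟨K ^ M, one_le_pow₀ hK1, fun n => ?_⟩
  rcases eq_or_ne n 0 with rfl | hn
  · simp; positivity
  have hn' : (n : ℝ) ^ ε = ∏ p ∈ n.primeFactors, ((p : ℝ) ^ ε) ^ (n.factorization p) := by
    conv_lhs => rw [← Nat.prod_factorization_pow_eq_self hn]
    rw [Finsupp.prod, Nat.support_factorization]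
    push_cast
    rw [← Real.finsetProd_rpow _ _ (fun i _ => by positivity)]
    refine Finset.prod_congr rfl fun p _ => ?_
    rw [← rpow_natCast, ← rpow_natCast, ← rpow_mul (by positivity), ← rpow_mul (by positivity),
      mul_comm]
  rw [Nat.card_divisors hn, hn']
  push_cast
  have key : ∀ p ∈ n.primeFactors, ((n.factorization p : ℝ) + 1) ≤
      (if p < M then K else 1) * ((p : ℝ) ^ ε) ^ (n.factorization p) := by
    intro p hp
    have hp2 := (Nat.prime_of_mem_primeFactors hp).two_le
    split_ifs with h
    · exact add_one_le_const_mul_rpow hε p _ hp2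
    · rw [one_mul]
      exact add_one_le_rpow_of_large hε p _ ((Nat.le_ceil _).trans (by exact_mod_cast not_lt.1 h))
  refine (Finset.prod_le_prod (fun i _ => by positivity) key).trans ?_
  rw [Finset.prod_mul_distrib]
  refine mul_le_mul_of_nonneg_right ?_ (Finset.prod_nonneg fun i _ => by positivity)
  rw [Finset.prod_ite, Finset.prod_const_one, mul_one, Finset.prod_const]
  refine pow_le_pow_right₀ hK1 ?_
  calc _ ≤ (Finset.range M).card := Finset.card_le_card (fun p hp => by
        simp only [Finset.mem_filter] at hp; exact Finset.mem_range.2 hp.2)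
    _ = M := Finset.card_range M

/-! ### Mean square of the divisor sum -/

/-- The instantaneous frequency of the phase: the two square roots produced by the chain rule cancel. -/
theorem hasDerivAt_atkinsonPhase {t : ℝ} (ht : 0 < t) {k : ℕ} (hk : 0 < k) :
    HasDerivAt (fun t => atkinsonPhase t k) (2 * arsinh (√(π * k / (2 * t)))) t := by
  have hk' : (0:ℝ) < k := by exact_mod_cast hk
  have hA : 0 < π * k / (2 * t) := by positivity
  have hB : 0 < 2 * π * k * t + π ^ 2 * (k:ℝ) ^ 2 := by positivity
  have h1 : HasDerivAt (fun t : ℝ => π * k / (2 * t)) (-(π * k / (2 * t)) / t) t := by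
    refine (((hasDerivAt_inv ht.ne').const_mul (π * k / 2)).congr_of_eventuallyEq
      (Eventually.of_forall fun x => ?_)).congr_deriv ?_
    · simp only
      ring
    · field_simp
  have h2 := h1.sqrt hA.ne'
  have h3 := h2.arsinh
  have h4 : HasDerivAt (fun t : ℝ => 2 * π * k * t + π ^ 2 * (k:ℝ) ^ 2) (2 * π * k) t := by
    simpa using ((hasDerivAt_id t).const_mul (2 * π * k)).add_const (π ^ 2 * (k:ℝ) ^ 2)
  have h5 := h4.sqrt hB.ne'
  have h6 := ((((hasDerivAt_id t).const_mul 2).mul h3).add h5).sub_const (π / 4)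
  refine HasDerivAt.congr_deriv (f := fun t => atkinsonPhase t k) h6 ?_
  simp only [id, mul_one, smul_eq_mul]
  rw [sq_sqrt hA.le]
  have e1 : √(2 * π * k * t + π ^ 2 * (k:ℝ) ^ 2) =
    2 * t * √(π * k / (2 * t)) * √(1 + π * k / (2 * t)) := by
    rw [sqrt_eq_iff_mul_self_eq hB.le (by positivity)]
    symm
    have a1 := mul_self_sqrt hA.le
    have a2 := mul_self_sqrt (show 0 ≤ 1 + π * k / (2 * t) by positivity)
    calc _ = (2 * t) ^ 2 * (√(π * k / (2 * t)) * √(π * k / (2 * t))) *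
      (√(1 + π * k / (2 * t)) * √(1 + π * k / (2 * t))) := by ring
      _ = _ := by rw [a1, a2]; field_simp
  rw [e1]
  have p1 : 0 < √(π * k / (2 * t)) := sqrt_pos.2 hA
  have p2 : 0 < √(1 + π * k / (2 * t)) := sqrt_pos.2 (by positivity)
  have a1 := sq_sqrt hA.le
  set u := √(π * k / (2 * t)) with hu
  set v := √(1 + π * k / (2 * t)) with hv
  have hx : π * k / (2 * t) = u ^ 2 := a1.symm
  have hy : π * k = u ^ 2 * (2 * t) := by rw [← hx]; field_simp
  rw [show 2 * π * (k:ℝ) = 2 * (π * k) by ring, hy]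
  field_simp
  ring

theorem hasDerivAt_arsinh_sqrt {t : ℝ} (ht : 0 < t) {k : ℕ} (hk : 0 < k) :
    HasDerivAt (fun t =>
      2 * arsinh (√(π * k / (2 * t)))) (-(1 / t * √(π * k / (2 * t + π * k)))) t := by
  have hk' : (0:ℝ) < k := by exact_mod_cast hk
  have hA : 0 < π * k / (2 * t) := by positivity
  have h1 : HasDerivAt (fun t : ℝ => π * k / (2 * t)) (-(π * k / (2 * t)) / t) t := by
    refine (((hasDerivAt_inv ht.ne').const_mul (π * k / 2)).congr_of_eventuallyEq
      (Eventually.of_forall fun x => ?_)).congr_deriv ?_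
    · simp only
      ring
    · field_simp
  have h3 := (h1.sqrt hA.ne').arsinh.const_mul 2
  refine h3.congr_deriv ?_
  simp only [smul_eq_mul]
  rw [sq_sqrt hA.le]
  have e1 : √(π * k / (2 * t + π * k)) = √(π * k / (2 * t)) / √(1 + π * k / (2 * t)) := by
    rw [← sqrt_div hA.le]
    congr 1
    field_simp
  rw [e1]
  have p1 : 0 < √(π * k / (2 * t)) := sqrt_pos.2 hA
  have p2 : 0 < √(1 + π * k / (2 * t)) := sqrt_pos.2 (by positivity)
  have a1 := sq_sqrt hA.le
  set u := √(π * k / (2 * t)) with hu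
  set v := √(1 + π * k / (2 * t)) with hv
  rw [← a1]
  field_simp

/-- The first derivative test for an oscillatory integral with a decreasing derivative `F'`: integration
by parts against `1 / F'`, whose total variation telescopes. -/
theorem abs_integral_cos_le {F F' F'' : ℝ → ℝ} {a b lam : ℝ} (hab : a ≤ b) (hlam : 0 < lam)
    (hF : ∀ t ∈ Icc a b, HasDerivAt F (F' t) t) (hF' : ∀ t ∈ Icc a b, HasDerivAt F' (F'' t) t)
    (hc : ContinuousOn F'' (Icc a b)) (hneg : ∀ t ∈ Icc a b, F'' t ≤ 0)
    (hl : ∀ t ∈ Icc a b, lam ≤ F' t) : |∫ t in a..b, cos (F t)| ≤ 3 / lam := by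
  have hu : uIcc a b = Icc a b := uIcc_of_le hab
  have hpos : ∀ t ∈ Icc a b, 0 < F' t := fun t ht => hlam.trans_le (hl t ht)
  have hcF : ContinuousOn F (Icc a b) := fun t ht => (hF t ht).continuousAt.continuousWithinAt
  have hcF' : ContinuousOn F' (Icc a b) := fun t ht => (hF' t ht).continuousAt.continuousWithinAt
  have hd : ∀ t ∈ Icc a b, HasDerivAt (fun t => sin (F t) / F' t)
      (cos (F t) - sin (F t) * F'' t / F' t ^ 2) t := by
    intro t ht
    refine ((hF t ht).sin.div (hF' t ht) (hpos t ht).ne').congr_deriv ?_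
    have := (hpos t ht).ne'
    field_simp
  have hd2 : ∀ t ∈ Icc a b, HasDerivAt (fun t => (F' t)⁻¹) (-F'' t / F' t ^ 2) t :=
    fun t ht => (hF' t ht).inv (hpos t ht).ne'
  have hcont2 : ContinuousOn (fun t => -F'' t / F' t ^ 2) (Icc a b) :=
    hc.neg.div (hcF'.pow 2) fun t ht => (pow_pos (hpos t ht) 2).ne'
  have hcont3 : ContinuousOn (fun t => sin (F t) * F'' t / F' t ^ 2) (Icc a b) :=
    ((continuous_sin.comp_continuousOn hcF).mul hc).div (hcF'.pow 2) fun t ht =>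
      (pow_pos (hpos t ht) 2).ne'
  have hcos : ContinuousOn (fun t => cos (F t)) (Icc a b) := continuous_cos.comp_continuousOn hcF
  have i1 : ∫ t in a..b, (cos (F t) - sin (F t) * F'' t / F' t ^ 2) =
    sin (F b) / F' b - sin (F a) / F' a :=
    intervalIntegral.integral_eq_sub_of_hasDerivAt (by rw [hu]; exact hd)
      ((hcos.sub hcont3).intervalIntegrable_of_Icc hab)
  have i2 : ∫ t in a..b, -F'' t / F' t ^ 2 = (F' b)⁻¹ - (F' a)⁻¹ :=
    intervalIntegral.integral_eq_sub_of_hasDerivAt (by rw [hu]; exact hd2)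
      (hcont2.intervalIntegrable_of_Icc hab)
  rw [intervalIntegral.integral_sub (hcos.intervalIntegrable_of_Icc hab)
    (hcont3.intervalIntegrable_of_Icc hab)] at i1
  have i3 : |∫ t in a..b, sin (F t) * F'' t / F' t ^ 2| ≤ ∫ t in a..b, -F'' t / F' t ^ 2 := by
    rw [← Real.norm_eq_abs]
    refine intervalIntegral.norm_integral_le_of_norm_le hab (ae_of_all _ fun t ht => ?_)
      (hcont2.intervalIntegrable_of_Icc hab)
    have ht' := Ioc_subset_Icc_self ht
    rw [Real.norm_eq_abs, abs_div, abs_mul, abs_of_nonneg (sq_nonneg (F' t)),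
      abs_of_nonpos (hneg t ht')]
    gcongr
    have := abs_sin_le_one (F t)
    nlinarith [hneg t ht']
  have ha : a ∈ Icc a b := left_mem_Icc.2 hab
  have hb : b ∈ Icc a b := right_mem_Icc.2 hab
  have q : ∀ t ∈ Icc a b, |sin (F t) / F' t| ≤ 1 / lam := by
    intro t ht
    rw [abs_div, abs_of_pos (hpos t ht)]
    exact div_le_div₀ zero_le_one (abs_sin_le_one _) hlam (hl t ht)
  have r1 : (F' b)⁻¹ ≤ 1 / lam := by rw [one_div]; exact inv_anti₀ hlam (hl b hb)
  have r2 : 0 < (F' a)⁻¹ := inv_pos.2 (hpos a ha)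
  have := q a ha
  have := q b hb
  rw [i2] at i3
  rw [show (3:ℝ) / lam = 1 / lam + 1 / lam + 1 / lam by ring]
  rw [abs_le] at *
  constructor <;> linarith

/-- A mean value bound for `arsinh`, whose derivative decreases on `[0, ∞)`. -/
theorem arsinh_sub_ge {x y : ℝ} (hy : 0 ≤ y) (hxy : y ≤ x) :
    (x - y) / √(1 + x ^ 2) ≤ arsinh x - arsinh y := by
  rcases hxy.eq_or_lt with rfl | h
  · simp
  obtain ⟨c, hc, hce⟩ := exists_hasDerivAt_eq_slope arsinh (fun x => (√(1 + x ^ 2))⁻¹) h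
    continuous_arsinh.continuousOn (fun z _ => hasDerivAt_arsinh z)
  have : (√(1 + x ^ 2))⁻¹ ≤ (√(1 + c ^ 2))⁻¹ := by
    apply inv_anti₀ (by positivity)
    apply sqrt_le_sqrt
    have := hc.1; have := hc.2
    nlinarith
  rw [hce] at this
  rw [div_eq_mul_inv]
  have hp : 0 < x - y := sub_pos.2 h
  rw [le_div_iff₀ hp] at this
  linarith

/-- The gap between the frequencies of `f(·, k)` and `f(·, l)` for `l < k`. -/
theorem atkinsonFreq_sub_ge {T t : ℝ} (ht : 0 < t) (htT : t ≤ 3 * T) {k l : ℕ}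
    (hl : 0 < l) (hlk : l < k) :
    ((k:ℝ) - l) / (2 * √(k * (T + k))) ≤ 2 * arsinh (√(π * k / (2 * t))) - 2 *
      arsinh (√(π * l / (2 * t))) := by
  have hl' : (0:ℝ) < l := by exact_mod_cast hl
  have hlk' : (l:ℝ) < k := by exact_mod_cast hlk
  have hk' : (0:ℝ) < k := hl'.trans hlk'
  have h := arsinh_sub_ge (sqrt_nonneg (π * l / (2 * t)))
    (sqrt_le_sqrt (show π * l / (2 * t) ≤ π * k / (2 * t) by gcongr))
  rw [sq_sqrt (by positivity)] at h
  refine le_trans ?_ (show 2 * ((√(π * k / (2 * t)) - √(π * l / (2 * t))) /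
    √(1 + π * k / (2 * t))) ≤ _ by linarith)
  have e1 : √(π * k / (2 * t)) =
    √π * √k / √(2 * t) := by rw [sqrt_div (by positivity), sqrt_mul (by positivity)]
  have e2 : √(π * l / (2 * t)) =
    √π * √l / √(2 * t) := by rw [sqrt_div (by positivity), sqrt_mul (by positivity)]
  have e3 : √(1 + π * k / (2 * t)) = √(2 * t + π * k) / √(2 * t) := by
    rw [← sqrt_div (by positivity)]; congr 1; field_simp
  rw [e1, e2, e3]
  have p : 0 < √(2 * t) := sqrt_pos.2 (by positivity)
  have e4 : 2 * ((√π * √k / √(2 * t) - √π * √l / √(2 * t)) / (√(2 * t + π * k) / √(2 * t)))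
      = 2 * √π * (√k - √l) / √(2 * t + π * k) := by
    have : 0 < √(2 * t + π * k) := sqrt_pos.2 (by positivity)
    field_simp
  rw [e4]
  have hkl : (k:ℝ) - l ≤ 2 * √k * (√k - √l) := by
    have a := mul_self_sqrt hk'.le
    have b := mul_self_sqrt hl'.le
    have := sqrt_le_sqrt hlk'.le
    nlinarith [sqrt_nonneg (l:ℝ), sqrt_nonneg (k:ℝ)]
  have hT : 0 < T := by linarith
  have e5 : √(2 * t + π * k) ≤ 2 * √π * √(T + k) := by
    rw [show (2:ℝ) =
      √4 by rw [show (4:ℝ) = 2 ^ 2 by norm_num]; simp, ← sqrt_mul (by norm_num), ← sqrt_mul (by positivity)]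
    apply sqrt_le_sqrt
    rw [show √(4:ℝ) = 2 by rw [show (4:ℝ) = 2 ^ 2 by norm_num]; simp]
    have := pi_gt_three
    nlinarith [mul_pos hT (show 0 < π - 3 by linarith), mul_pos pi_pos hk']
  rw [sqrt_mul hk'.le]
  have pk : 0 < √(k:ℝ) := sqrt_pos.2 hk'
  have pT : 0 < √(T + k) := sqrt_pos.2 (by positivity)
  have pt : 0 < √(2 * t + π * k) := sqrt_pos.2 (by positivity)
  have hs : 0 ≤ √(k:ℝ) - √l := sub_nonneg.2 (sqrt_le_sqrt hlk'.le)
  rw [div_le_div_iff₀ (by positivity) pt]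
  calc ((k:ℝ) - l) * √(2 * t + π * k) ≤ (2 * √k * (√k - √l)) * (2 * √π * √(T + k)) := by gcongr
    _ = _ := by ring

theorem continuousOn_atkinsonPhase {k : ℕ} (hk : 0 < k) : ContinuousOn (fun t =>
    atkinsonPhase t k) (Ioi 0) :=
  fun _ ht => (hasDerivAt_atkinsonPhase ht hk).continuousAt.continuousWithinAt

/-- Near orthogonality of two distinct terms: the product of sines is a difference of cosines of
`f(t, k) ± f(t, l)`, and the derivatives of both of these are at least the frequency gap. -/
theorem abs_integral_sin_mul_sin_atkinsonPhase_le {T : ℝ} (hT : 0 < T) {k l : ℕ}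
    (hl : 0 < l) (hlk : l < k) :
    |∫ t in (T / 2)..(3 * T), sin (atkinsonPhase t k) * sin (atkinsonPhase t l)|
      ≤ 6 * √(k * (T + k)) / (k - l) := by
  have hk : 0 < k := hl.trans hlk
  have hlk' : (l:ℝ) < k := by exact_mod_cast hlk
  have hk' : (0:ℝ) < k := by exact_mod_cast hk
  have hl' : (0:ℝ) < l := by exact_mod_cast hl
  have hpos : ∀ t ∈ Icc (T / 2) (3 * T), 0 < t := fun t ht => by linarith [ht.1]
  have hab : T / 2 ≤ 3 * T := by linarith
  set lam : ℝ := ((k:ℝ) - l) / (2 * √(k * (T + k))) with hlam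
  have hlam0 : 0 < lam := div_pos (sub_pos.2 hlk') (by positivity)
  have hcs : ∀ m : ℕ, 0 < m →
    ContinuousOn (fun t => -(1 / t * √(π * m / (2 * t + π * m)))) (Icc (T / 2) (3 * T)) := by
    intro m hm t ht
    have := hpos t ht
    have hm' : (0:ℝ) < m := by exact_mod_cast hm
    refine ContinuousAt.continuousWithinAt ?_
    refine ((continuousAt_const.div continuousAt_id this.ne').mul
      (ContinuousAt.sqrt (continuousAt_const.div ?_ (by positivity)))).neg
    fun_prop
  have hmono : ∀ t, 0 < t → √(π * l / (2 * t + π * l)) ≤ √(π * k / (2 * t + π * k)) := by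
    intro t ht
    apply sqrt_le_sqrt
    rw [div_le_div_iff₀ (by positivity) (by positivity)]
    nlinarith [mul_pos ht pi_pos, mul_pos (mul_pos ht pi_pos) (sub_pos.2 hlk')]
  have hgap : ∀ t ∈ Icc (T / 2) (3 * T), lam ≤ 2 * arsinh (√(π * k / (2 * t))) - 2 *
    arsinh (√(π * l / (2 * t))) :=
    fun t ht => atkinsonFreq_sub_ge (hpos t ht) ht.2 hl hlk
  have h1 := abs_integral_cos_le (F := fun t => atkinsonPhase t k - atkinsonPhase t l) hab hlam0
    (fun t ht =>
      (hasDerivAt_atkinsonPhase (hpos t ht) hk).sub (hasDerivAt_atkinsonPhase (hpos t ht) hl))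
    (fun t ht =>
      (hasDerivAt_arsinh_sqrt (hpos t ht) hk).sub (hasDerivAt_arsinh_sqrt (hpos t ht) hl))
    ((hcs k hk).sub (hcs l hl))
    (fun t ht => by
      have h0 := hpos t ht
      have := mul_le_mul_of_nonneg_left (hmono t h0) (show 0 ≤ 1 / t by positivity)
      linarith) hgap
  have h2 := abs_integral_cos_le (F := fun t => atkinsonPhase t k + atkinsonPhase t l) hab hlam0
    (fun t ht =>
      (hasDerivAt_atkinsonPhase (hpos t ht) hk).add (hasDerivAt_atkinsonPhase (hpos t ht) hl))
    (fun t ht =>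
      (hasDerivAt_arsinh_sqrt (hpos t ht) hk).add (hasDerivAt_arsinh_sqrt (hpos t ht) hl))
    ((hcs k hk).add (hcs l hl))
    (fun t ht => by
      have h0 := hpos t ht
      have : ∀ m : ℕ, 0 ≤ 1 / t * √(π * m / (2 * t + π * m)) := fun m => by positivity
      linarith [this k, this l])
    (fun t ht => by
      have := hgap t ht
      have : 0 ≤ arsinh (√(π * l / (2 * t))) := arsinh_nonneg_iff.2 (sqrt_nonneg _)
      linarith)
  have hcp : ∀ m : ℕ, 0 < m → ContinuousOn (fun t => atkinsonPhase t m) (Icc (T / 2) (3 * T)) :=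
    fun m hm => (continuousOn_atkinsonPhase hm).mono fun t ht => hpos t ht
  have e : ∫ t in (T / 2)..(3 * T), sin (atkinsonPhase t k) * sin (atkinsonPhase t l) =
      1 / 2 * ((∫ t in (T / 2)..(3 * T), cos (atkinsonPhase t k - atkinsonPhase t l)) -
        ∫ t in (T / 2)..(3 * T), cos (atkinsonPhase t k + atkinsonPhase t l)) := by
    have i1 : ContinuousOn (fun t =>
      cos (atkinsonPhase t k - atkinsonPhase t l)) (Icc (T / 2) (3 * T)) :=
      continuous_cos.comp_continuousOn ((hcp k hk).sub (hcp l hl))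
    have i2 : ContinuousOn (fun t =>
      cos (atkinsonPhase t k + atkinsonPhase t l)) (Icc (T / 2) (3 * T)) :=
      continuous_cos.comp_continuousOn ((hcp k hk).add (hcp l hl))
    rw [← intervalIntegral.integral_sub (i1.intervalIntegrable_of_Icc hab)
      (i2.intervalIntegrable_of_Icc hab), ← intervalIntegral.integral_const_mul]
    congr 1
    ext t
    rw [cos_sub, cos_add]; ring
  have e2 : 6 * √(k * (T + k)) / (k - l) = 3 / lam := by
    have := sub_pos.2 hlk'
    rw [hlam]; field_simp; norm_num
  rw [e, e2, abs_mul, abs_of_pos (by norm_num : (0:ℝ) < 1 / 2)]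
  have := abs_sub (∫ t in (T / 2)..(3 * T), cos (atkinsonPhase t k - atkinsonPhase t l))
    (∫ t in (T / 2)..(3 * T), cos (atkinsonPhase t k + atkinsonPhase t l))
  linarith

theorem Finset.sum_comp_le_sum_of_injOn {ι κ : Type*} [DecidableEq κ] {s : Finset ι} {t :
    Finset κ} (g : ι → κ) {f : κ → ℝ}
    (hf : ∀ j ∈ t, 0 ≤ f j) (hg : Set.InjOn g s) (hst : ∀ i ∈ s, g i ∈ t) :
      ∑ i ∈ s, f (g i) ≤ ∑ j ∈ t, f j := by
  rw [← Finset.sum_image (s := s) (g := g) (f := f) hg]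
  exact Finset.sum_le_sum_of_subset_of_nonneg (Finset.image_subset_iff.2 hst) fun j hj _ => hf j hj

theorem sum_one_div_le (N : ℕ) : ∑ j ∈ Finset.Icc 1 N, (1 / j : ℝ) ≤ 1 + log N := by
  have := harmonic_le_one_add_log N
  rw [harmonic_eq_sum_Icc] at this
  push_cast at this
  simpa [one_div] using this

theorem sum_one_div_abs_sub_le (N k : ℕ) (hk : k ∈ Finset.Icc 1 N) :
    ∑ l ∈ (Finset.Icc 1 N).erase k, (1 / |(k:ℝ) - l|) ≤ 2 * (1 + log N) := by
  rw [Finset.mem_Icc] at hk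
  rw [← Finset.sum_filter_add_sum_filter_not _ (fun l => l < k)]
  have h1 : ∑ l ∈ ((Finset.Icc 1 N).erase k).filter (fun l => l < k), (1 / |(k:ℝ) - l|) ≤
    1 + log N := by
    refine le_trans (le_of_eq ?_) ((Finset.sum_comp_le_sum_of_injOn (fun l => k - l)
      (f := fun j : ℕ => (1 / j : ℝ))
      (t := Finset.Icc 1 N) (s := ((Finset.Icc 1 N).erase k).filter (fun l => l < k))
      (fun j _ => by positivity) ?_ ?_).trans (sum_one_div_le N))
    · refine Finset.sum_congr rfl fun l hl => ?_
      simp only [Finset.mem_filter, Finset.mem_erase, Finset.mem_Icc] at hl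
      rw [Nat.cast_sub hl.2.le, abs_of_pos (sub_pos.2 (by exact_mod_cast hl.2))]
    · intro a ha b hb hab
      simp only [Finset.coe_filter, Set.mem_ofPred_eq, Finset.mem_erase,
        Finset.mem_Icc] at ha hb hab
      omega
    · intro a ha
      simp only [Finset.mem_filter, Finset.mem_erase, Finset.mem_Icc] at ha ⊢
      omega
  have h2 : ∑ l ∈ ((Finset.Icc 1 N).erase k).filter (fun l => ¬ l < k), (1 / |(k:ℝ) - l|) ≤
    1 + log N := by
    refine le_trans (le_of_eq ?_) ((Finset.sum_comp_le_sum_of_injOn (fun l => l - k)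
      (f := fun j : ℕ => (1 / j : ℝ))
      (t := Finset.Icc 1 N) (s := ((Finset.Icc 1 N).erase k).filter (fun l => ¬ l < k))
      (fun j _ => by positivity) ?_ ?_).trans (sum_one_div_le N))
    · refine Finset.sum_congr rfl fun l hl => ?_
      simp only [Finset.mem_filter, Finset.mem_erase, Finset.mem_Icc] at hl
      have hlt : k < l := by omega
      rw [Nat.cast_sub hlt.le, abs_sub_comm, abs_of_pos (sub_pos.2 (by exact_mod_cast hlt))]
    · intro a ha b hb hab
      simp only [Finset.coe_filter, Set.mem_ofPred_eq, Finset.mem_erase,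
        Finset.mem_Icc] at ha hb hab
      omega
    · intro a ha
      simp only [Finset.mem_filter, Finset.mem_erase, Finset.mem_Icc] at ha ⊢
      omega
  linarith

theorem sum_rpow_neg_half_le (N : ℕ) : ∑ k ∈ Finset.Icc 1 N, (k:ℝ) ^ (-(1 / 2) : ℝ) ≤ 2 * √N := by
  induction N with
  | zero => simp
  | succ n ih =>
    rw [Finset.sum_Icc_succ_top (by omega)]
    have h : ((n + 1 : ℕ):ℝ) ^ (-(1 / 2) : ℝ) = 1 / √(n + 1 : ℕ) := by
      rw [rpow_neg (by positivity), sqrt_eq_rpow, one_div, one_div]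
    rw [h]
    have h1 : 0 < √((n + 1 : ℕ):ℝ) := sqrt_pos.2 (by positivity)
    have h2 := mul_self_sqrt (show 0 ≤ ((n + 1 : ℕ):ℝ) by positivity)
    have h3 := mul_self_sqrt (show 0 ≤ (n:ℝ) by positivity)
    have h4 : 1 / √((n + 1 : ℕ):ℝ) ≤ 2 * √((n + 1 : ℕ):ℝ) - 2 * √(n:ℝ) := by
      rw [div_le_iff₀ h1]
      push_cast at *
      nlinarith [sq_nonneg (√((n:ℝ) + 1) - √(n:ℝ))]
    linarith

/-- The off-diagonal weight is split into pieces that sum to `O(log N)` in each variable. -/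
theorem rpow_mul_sqrt_div_le {T : ℝ} (hT : 0 < T) {k l N : ℕ} (hl : 0 < l) (hlk : l < k)
    (hk : k ≤ N) :
    (k:ℝ) ^ (-(1 / 4) : ℝ) * (l:ℝ) ^ (-(1 / 4) : ℝ) * (6 * √(k * (T + k)) / (k - l)) ≤
      6 * √(T + N) * (1 / |(k:ℝ) - l| + 1 / k + 1 / l) := by
  have hlk' : (l:ℝ) < k := by exact_mod_cast hlk
  have hk' : (0:ℝ) < k := by exact_mod_cast hl.trans hlk
  have hl' : (0:ℝ) < l := by exact_mod_cast hl
  have hs := sub_pos.2 hlk'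
  have hkN : (k:ℝ) ≤ N := by exact_mod_cast hk
  rw [abs_of_pos hs, sqrt_mul hk'.le]
  have h1 : (k:ℝ) ^ (-(1 / 4) : ℝ) * (l:ℝ) ^ (-(1 / 4) : ℝ) * √k = ((k:ℝ) / l) ^ (1 / 4 : ℝ) := by
    rw [div_rpow hk'.le hl'.le, rpow_neg hl'.le, sqrt_eq_rpow, mul_right_comm, ← rpow_add hk',
      div_eq_mul_inv]
    norm_num [div_eq_mul_inv]
  have h2 : ((k:ℝ) / l) ^ (1 / 4 : ℝ) ≤ k / l := by
    conv_rhs => rw [← rpow_one ((k:ℝ) / l)]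
    exact rpow_le_rpow_of_exponent_le ((one_le_div hl').2 hlk'.le) (by norm_num)
  have h3 : (k:ℝ) / l / (k - l) = 1 / (k - l) + 1 / l := by field_simp; ring
  calc _ = 6 * √(T + k) *
    (((k:ℝ) ^ (-(1 / 4) : ℝ) * (l:ℝ) ^ (-(1 / 4) : ℝ) * √k) / (k - l)) := by ring
    _ ≤ 6 * √(T + N) * ((k:ℝ) / l / (k - l)) := by rw [h1]; gcongr
    _ ≤ _ := by
      rw [h3]
      gcongr
      have : (0:ℝ) ≤ 1 / k := by positivity
      linarith

/-- The mean square of the divisor sum: the diagonal contributes `T √N` and the off-diagonal terms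
`N √(T + N)`, up to `N ^ (2κ) log N`. -/
theorem integral_atkinsonSum_sq_le {κ D : ℝ} (hκ : 0 < κ) (hD : 1 ≤ D)
    (hdiv : ∀ n : ℕ, (n.divisors.card : ℝ) ≤ D * (n : ℝ) ^ κ) {T : ℝ} (hT : 0 < T) (X : ℝ) :
    ∫ t in (T / 2)..(3 * T), atkinsonSum X t ^ 2 ≤
      24 * D ^ 2 * ((⌊X⌋₊ : ℝ) ^ κ) ^ 2 * (1 + log ⌊X⌋₊) * (T * √⌊X⌋₊ + ⌊X⌋₊ * √(T + ⌊X⌋₊)) := by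
  set N := ⌊X⌋₊ with hN
  have hab : T / 2 ≤ 3 * T := by linarith
  have hpos : ∀ t ∈ Icc (T / 2) (3 * T), 0 < t := fun t ht => by linarith [ht.1]
  set c : ℕ → ℝ := fun k => (-1 : ℝ) ^ k * (k.divisors.card : ℝ) * (k : ℝ) ^ (-(1 / 4) : ℝ) with hc
  set I : ℕ → ℕ → ℝ := fun k l => ∫ t in (T / 2)..(3 * T), sin (atkinsonPhase t k) *
    sin (atkinsonPhase t l) with hI
  have hcp : ∀ m ∈ Finset.Icc 1 N, ContinuousOn (fun t =>
    sin (atkinsonPhase t m)) (Icc (T / 2) (3 * T)) :=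
    fun m hm => continuous_sin.comp_continuousOn
      ((continuousOn_atkinsonPhase (Finset.mem_Icc.1 hm).1).mono fun t ht => hpos t ht)
  have e1 : ∫ t in (T / 2)..(3 * T), atkinsonSum X t ^ 2 =
      ∑ k ∈ Finset.Icc 1 N, ∑ l ∈ Finset.Icc 1 N, c k * c l * I k l := by
    have : ∀ t, atkinsonSum X t ^ 2 = ∑ k ∈ Finset.Icc 1 N, ∑ l ∈ Finset.Icc 1 N,
        c k * c l * (sin (atkinsonPhase t k) * sin (atkinsonPhase t l)) := by
      intro t
      rw [atkinsonSum, sq, Finset.sum_mul_sum]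
      refine Finset.sum_congr rfl fun k _ => Finset.sum_congr rfl fun l _ => ?_
      simp only [hc]; ring
    simp_rw [this]
    have hint : ∀ k ∈ Finset.Icc 1 N, ∀ l ∈ Finset.Icc 1 N, IntervalIntegrable
        (fun t => c k * c l * (sin (atkinsonPhase t k) * sin (atkinsonPhase t l))) volume (T / 2)
          (3 * T) :=
      fun k hk l hl =>
        (continuousOn_const.mul ((hcp k hk).mul (hcp l hl))).intervalIntegrable_of_Icc hab
    have hint' : ∀ k ∈ Finset.Icc 1 N, IntervalIntegrable (fun t => ∑ l ∈ Finset.Icc 1 N,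
        c k * c l * (sin (atkinsonPhase t k) * sin (atkinsonPhase t l))) volume (T / 2) (3 * T) :=
      fun k hk => (continuousOn_finsetSum _ fun l hl =>
        continuousOn_const.mul ((hcp k hk).mul (hcp l hl))).intervalIntegrable_of_Icc hab
    rw [intervalIntegral.integral_finsetSum hint']
    refine Finset.sum_congr rfl fun k hk => ?_
    rw [intervalIntegral.integral_finsetSum fun l hl => hint k hk l hl]
    refine Finset.sum_congr rfl fun l hl => ?_
    rw [intervalIntegral.integral_const_mul]
  rw [e1]
  have hsymm : ∀ k l, I k l = I l k := fun k l => by simp only [hI, mul_comm]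
  have hcb : ∀ k ∈ Finset.Icc 1 N, |c k| ≤ D * (N:ℝ) ^ κ * (k:ℝ) ^ (-(1 / 4) : ℝ) := by
    intro k hk
    have hkN : (k:ℝ) ≤ N := by exact_mod_cast (Finset.mem_Icc.1 hk).2
    simp only [hc]
    rw [abs_mul, abs_mul, abs_pow, abs_neg, abs_one, one_pow, one_mul,
      abs_of_nonneg (by positivity), abs_of_nonneg (by positivity)]
    gcongr
    exact (hdiv k).trans (by gcongr)
  have hterm : ∀ k ∈ Finset.Icc 1 N, ∀ l ∈ Finset.Icc 1 N, k ≠ l →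
      (k:ℝ) ^ (-(1 / 4) : ℝ) * (l:ℝ) ^ (-(1 / 4) : ℝ) * |I k l| ≤
        6 * √(T + N) * (1 / |(k:ℝ) - l| + 1 / k + 1 / l) := by
    intro k hk l hl hkl
    rw [Finset.mem_Icc] at hk hl
    rcases lt_or_gt_of_ne hkl with h | h
    · rw [hsymm]
      have := (mul_le_mul_of_nonneg_left (abs_integral_sin_mul_sin_atkinsonPhase_le hT
        (show 0 < k by omega) h)
        (by positivity)).trans (rpow_mul_sqrt_div_le hT (show 0 < k by omega) h hl.2)
      rw [abs_sub_comm (k:ℝ)]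
      calc _ = (l:ℝ) ^ (-(1 / 4) : ℝ) * (k:ℝ) ^ (-(1 / 4) : ℝ) * |I l k| := by ring
        _ ≤ _ := this
        _ = _ := by ring
    · exact (mul_le_mul_of_nonneg_left (abs_integral_sin_mul_sin_atkinsonPhase_le hT
      (show 0 < l by omega) h)
        (by positivity)).trans (rpow_mul_sqrt_div_le hT (show 0 < l by omega) h hk.2)
  have hdiag : ∀ k ∈ Finset.Icc 1 N, (k:ℝ) ^ (-(1 / 4) : ℝ) * (k:ℝ) ^ (-(1 / 4) : ℝ) *
    |I k k| ≤ 3 * T * (k:ℝ) ^ (-(1 / 2) : ℝ) := by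
    intro k hk
    have hk' : (0:ℝ) < k := by exact_mod_cast (Finset.mem_Icc.1 hk).1
    have : |I k k| ≤ 3 * T := by
      have := intervalIntegral.norm_integral_le_of_norm_le_const (a := T / 2) (b := 3 * T) (C := 1)
        (f := fun t => sin (atkinsonPhase t k) * sin (atkinsonPhase t k)) (fun t _ => by
          rw [norm_mul]
          exact mul_le_one₀ (abs_sin_le_one _) (norm_nonneg _) (abs_sin_le_one _))
      rw [Real.norm_eq_abs, one_mul, abs_of_nonneg (show 0 ≤ 3 * T - T / 2 by linarith)] at this
      refine this.trans ?_
      linarith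
    rw [← rpow_add hk', mul_comm, show (-(1 / 4) + -(1 / 4) : ℝ) = -(1 / 2) by norm_num]
    gcongr
  have hlog : 0 ≤ log N := log_natCast_nonneg N
  have hrow : ∀ k ∈ Finset.Icc 1 N, ∑ l ∈ Finset.Icc 1 N, |c k * c l * I k l| ≤
      (D * (N:ℝ) ^ κ) ^ 2 *
        (3 * T * (k:ℝ) ^ (-(1 / 2) : ℝ) + 6 * √(T + N) * (3 * (1 + log N) + N * (1 / k))) := by
    intro k hk
    have h1 : ∀ l ∈ Finset.Icc 1 N, |c k * c l * I k l| ≤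
        (D * (N:ℝ) ^ κ) ^ 2 * ((k:ℝ) ^ (-(1 / 4) : ℝ) * (l:ℝ) ^ (-(1 / 4) : ℝ) * |I k l|) := by
      intro l hl
      rw [abs_mul, abs_mul]
      calc _ ≤ (D * (N:ℝ) ^ κ * (k:ℝ) ^ (-(1 / 4) : ℝ)) *
        (D * (N:ℝ) ^ κ * (l:ℝ) ^ (-(1 / 4) : ℝ)) * |I k l| := by
            gcongr
            exacts [hcb k hk, hcb l hl]
        _ = _ := by ring
    refine (Finset.sum_le_sum h1).trans ?_
    rw [← Finset.mul_sum]
    gcongr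
    rw [← Finset.add_sum_erase _ _ hk]
    refine add_le_add (hdiag k hk) ?_
    refine (Finset.sum_le_sum fun l hl =>
      hterm k hk l (Finset.mem_erase.1 hl).2 (Finset.mem_erase.1 hl).1.symm).trans ?_
    rw [← Finset.mul_sum, Finset.sum_add_distrib, Finset.sum_add_distrib]
    refine mul_le_mul_of_nonneg_left ?_ (by positivity)
    have a1 := sum_one_div_abs_sub_le N k hk
    have a2 : ∑ l ∈ (Finset.Icc 1 N).erase k, (1 / (k:ℝ)) ≤ N * (1 / k) := by
      rw [Finset.sum_const, nsmul_eq_mul]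
      gcongr
      exact (Finset.card_le_card (Finset.erase_subset _ _)).trans (by simp)
    have a3 : ∑ l ∈ (Finset.Icc 1 N).erase k, (1 / (l:ℝ)) ≤ 1 + log N :=
      (Finset.sum_le_sum_of_subset_of_nonneg
        (Finset.erase_subset _ _) fun _ _ _ => by positivity).trans (sum_one_div_le N)
    linarith
  have habs : ∑ k ∈ Finset.Icc 1 N, ∑ l ∈ Finset.Icc 1 N, c k * c l * I k l ≤
      ∑ k ∈ Finset.Icc 1 N, ∑ l ∈ Finset.Icc 1 N, |c k * c l * I k l| :=
    Finset.sum_le_sum fun k _ => Finset.sum_le_sum fun l _ => le_abs_self _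
  refine habs.trans ((Finset.sum_le_sum hrow).trans ?_)
  rw [← Finset.mul_sum, Finset.sum_add_distrib, ← Finset.mul_sum, ← Finset.mul_sum,
    Finset.sum_add_distrib,
    ← Finset.mul_sum, Finset.sum_const, Nat.card_Icc, nsmul_eq_mul]
  have b1 := sum_rpow_neg_half_le N
  have b2 := sum_one_div_le N
  simp only [Nat.add_sub_cancel]
  rw [← Finset.mul_sum]
  have hT0 : 0 ≤ T * √N := by positivity
  calc _ ≤ (D * (N:ℝ) ^ κ) ^ 2 *
    (3 * T * (2 * √N) + 6 * √(T + N) * (N * (3 * (1 + log N)) + N * (1 + log N))) := by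
        refine mul_le_mul_of_nonneg_left
          (add_le_add (mul_le_mul_of_nonneg_left b1 (by positivity)) ?_) (by positivity)
        exact mul_le_mul_of_nonneg_left (add_le_add (le_of_eq (by ring))
          (mul_le_mul_of_nonneg_left b2 (by positivity))) (by positivity)
    _ ≤ (D * (N:ℝ) ^ κ) ^ 2 *
      (24 * (1 + log N) * (T * √N) + 24 * (1 + log N) * (N * √(T + N))) := by
        refine mul_le_mul_of_nonneg_left (add_le_add ?_ (le_of_eq (by ring))) (by positivity)
        nlinarith [mul_nonneg hlog hT0]
    _ = _ := by ring

/-! ### The weighted divisor sum -/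

/-- Integrals of a nonnegative function over non-overlapping windows add up to at most the full integral.
The statement carries a free right end point `c` past the last window, as the induction on the
number of windows requires. -/
theorem sum_integral_windows_le {f : ℝ → ℝ} {a b G : ℝ} {R : ℕ} {τ : ℕ → ℝ} (hG : 0 ≤ G)
    (hf : ∀ t ∈ Icc a b, 0 ≤ f t) (hfc : ContinuousOn f (Icc a b))
    (hτ : ∀ r ∈ Finset.Icc 1 R, a ≤ τ r - 2 * G ∧ τ r + 2 * G ≤ b)
    (hsep : ∀ r ∈ Finset.Ico 1 R, 4 * G ≤ τ (r + 1) - τ r) (n : ℕ) (hn : n ≤ R) :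
    ∀ c, a ≤ c → c ≤ b → (1 ≤ n → τ n + 2 * G ≤ c) →
    ∑ r ∈ Finset.Icc 1 n, ∫ t in (τ r - 2 * G)..(τ r + 2 * G), f t ≤ ∫ t in a..c, f t := by
  have hint : ∀ x y, a ≤ x → x ≤ y → y ≤ b → IntervalIntegrable f volume x y := fun x y h1 h2 h3 =>
    (hfc.mono (Icc_subset_Icc h1 h3)).intervalIntegrable_of_Icc h2
  induction n with
  | zero =>
    intro c hac hcb _
    simpa using intervalIntegral.integral_nonneg hac fun t ht => hf t ⟨ht.1, ht.2.trans hcb⟩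
  | succ n ih =>
    intro c hac hcb hc
    have hc := hc (by omega)
    have hτn := hτ (n + 1) (Finset.mem_Icc.2 ⟨by omega, hn⟩)
    rw [Finset.sum_Icc_succ_top (by omega)]
    have h1 := ih (by omega) (τ (n + 1) - 2 * G) hτn.1 (by linarith) (fun h => by
      linarith [hsep n (Finset.mem_Ico.2 ⟨h, by omega⟩)])
    have h2 := intervalIntegral.integral_add_adjacent_intervals
      (hint a (τ (n + 1) - 2 * G) le_rfl hτn.1 (by linarith)) (hint (τ (n + 1) - 2 * G)
        (τ (n + 1) + 2 * G) hτn.1 (by linarith) (by linarith))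
    have h3 := intervalIntegral.integral_add_adjacent_intervals
      (hint a (τ (n + 1) + 2 * G) le_rfl (by linarith) (by linarith)) (hint (τ (n + 1) + 2 * G) c
        (by linarith) hc hcb)
    have h4 : 0 ≤ ∫ t in (τ (n + 1) + 2 * G)..c, f t :=
      intervalIntegral.integral_nonneg hc fun t ht => hf t ⟨by linarith [ht.1], by linarith [ht.2]⟩
    linarith

theorem continuousOn_atkinsonSum (X : ℝ) : ContinuousOn (atkinsonSum X) (Ioi 0) := by
  unfold atkinsonSum
  refine continuousOn_finsetSum _ fun k hk => continuousOn_const.mul ?_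
  exact continuous_sin.comp_continuousOn (continuousOn_atkinsonPhase (Finset.mem_Icc.1 hk).1)

/-- The mean square bound controls the weighted sum. Cauchy's inequality over all windows at once is
used in the form `|S| ≤ λ / 2 + S² / (2λ)` with the optimal `λ`. -/
theorem abs_weightedAtkinsonSum_le {B T G X J : ℝ} {R : ℕ} {τ : ℕ → ℝ} {φ : ℕ → ℝ → ℝ}
    (hT : 0 < T) (hG : 0 < G)
    (hGT : 4 * G ≤ T) (hτ : WellSpacedPoints T (5 * G) R τ)
    (hφ : ∀ r ∈ Finset.Icc 1 R, IsSmoothWeight B (τ r) G (φ r)) (hJ : 0 < J)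
    (hSJ : ∫ t in (T / 2)..(3 * T), atkinsonSum X t ^ 2 ≤ J) :
    |weightedAtkinsonSum X G R τ φ| ≤ |B| * (2 * T ^ (-(1 / 4) : ℝ)) * √(4 * G * R * J) := by
  rcases Nat.eq_zero_or_pos R with rfl | hR
  · simp [weightedAtkinsonSum]
  have hR' : (0:ℝ) < R := by exact_mod_cast hR
  set S := atkinsonSum X with hS
  have hwin : ∀ r ∈ Finset.Icc 1 R, T / 2 ≤ τ r - 2 * G ∧ τ r + 2 * G ≤ 3 * T := fun r hr => by
    have := hτ.1 r hr
    constructor <;> linarith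
  have hScont : ContinuousOn S (Icc (T / 2) (3 * T)) :=
    (continuousOn_atkinsonSum X).mono fun t ht => by
      have := ht.1
      show 0 < t
      linarith
  set lam : ℝ := √(J / (4 * G * R)) with hlam
  have hlam0 : 0 < lam := sqrt_pos.2 (by positivity)
  have hlam2 : lam ^ 2 = J / (4 * G * R) := sq_sqrt (by positivity)
  set K : ℝ := |B| * (2 * T ^ (-(1 / 4) : ℝ)) with hK
  have hK0 : 0 ≤ K := by positivity
  have hterm : ∀ r ∈ Finset.Icc 1 R, |∫ t in (τ r - 2 * G)..(τ r + 2 * G), φ r t * t ^ (-(1 / 4) :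
    ℝ) * S t| ≤
      K * (2 * G * lam + (∫ t in (τ r - 2 * G)..(τ r + 2 * G), S t ^ 2) / (2 * lam)) := by
    intro r hr
    have hw := hwin r hr
    have hle : τ r - 2 * G ≤ τ r + 2 * G := by linarith
    have hSi : IntervalIntegrable (fun t => S t ^ 2) volume (τ r - 2 * G) (τ r + 2 * G) :=
      ((hScont.mono (Icc_subset_Icc hw.1 hw.2)).pow 2).intervalIntegrable_of_Icc hle
    have e : K * (2 * G * lam + (∫ t in (τ r - 2 * G)..(τ r + 2 * G), S t ^ 2) / (2 * lam)) =
        ∫ t in (τ r - 2 * G)..(τ r + 2 * G), K * (lam / 2 + S t ^ 2 / (2 * lam)) := by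
      rw [intervalIntegral.integral_const_mul,
        intervalIntegral.integral_add intervalIntegrable_const (hSi.div_const _),
        intervalIntegral.integral_div (2 * lam) (fun t =>
          S t ^ 2), intervalIntegral.integral_const, smul_eq_mul]
      generalize (∫ t in (τ r - 2 * G)..(τ r + 2 * G), S t ^ 2) = Q
      ring
    rw [e, ← Real.norm_eq_abs]
    refine intervalIntegral.norm_integral_le_of_norm_le hle (ae_of_all _ fun t ht => ?_)
      ((intervalIntegrable_const.add (hSi.div_const _)).const_mul _)
    have htT : T / 2 < t := hw.1.trans_lt ht.1
    have ht0 : 0 < t := by linarith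
    rw [norm_mul, norm_mul]
    have h1 : ‖φ r t‖ ≤ |B| := by
      rw [Real.norm_eq_abs, abs_of_nonneg ((hφ r hr).nonneg t)]
      exact ((hφ r hr).le_bound t).trans (le_abs_self _)
    have h2 : ‖t ^ (-(1 / 4) : ℝ)‖ ≤ 2 * T ^ (-(1 / 4) : ℝ) := by
      rw [Real.norm_of_nonneg (by positivity)]
      calc t ^ (-(1 / 4) : ℝ) ≤ (T / 2) ^ (-(1 / 4) : ℝ) :=
            rpow_le_rpow_of_nonpos (by positivity) htT.le (by norm_num)
        _ = 2 ^ (1 / 4 : ℝ) * T ^ (-(1 / 4) : ℝ) := by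
            rw [div_rpow hT.le (by norm_num), rpow_neg (by norm_num : (0:ℝ) ≤ 2)]
            field_simp
        _ ≤ 2 * T ^ (-(1 / 4) : ℝ) := by
            gcongr
            conv_rhs => rw [← rpow_one (2:ℝ)]
            exact rpow_le_rpow_of_exponent_le (by norm_num) (by norm_num)
    have h3 : ‖S t‖ ≤ lam / 2 + S t ^ 2 / (2 * lam) := by
      rw [Real.norm_eq_abs, ← sq_abs (S t)]
      rw [show lam / 2 + |S t| ^ 2 / (2 * lam) =
        |S t| + (lam - |S t|) ^ 2 / (2 * lam) by field_simp; ring]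
      have : 0 ≤ (lam - |S t|) ^ 2 / (2 * lam) := by positivity
      linarith
    rw [hK]
    gcongr
  have hwsum := sum_integral_windows_le (f := fun t => S t ^ 2) hG.le (fun t _ =>
    sq_nonneg _) (hScont.pow 2) hwin
    (fun r hr => by linarith [hτ.2 r hr]) R le_rfl (3 * T) (by linarith) le_rfl
    (fun h => (hwin R (Finset.mem_Icc.2 ⟨h, le_rfl⟩)).2)
  rw [weightedAtkinsonSum]
  refine (Finset.abs_sum_le_sum_abs _ _).trans ((Finset.sum_le_sum hterm).trans ?_)
  rw [← Finset.mul_sum, Finset.sum_add_distrib, ← Finset.sum_div, Finset.sum_const, Nat.card_Icc,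
    nsmul_eq_mul]
  refine mul_le_mul_of_nonneg_left ?_ hK0
  have hJ2 : (∑ r ∈ Finset.Icc 1 R, ∫ t in (τ r - 2 * G)..(τ r + 2 * G), S t ^ 2) / (2 * lam) ≤
    J / (2 * lam) := by
    gcongr
    exact hwsum.trans hSJ
  have hlamJ : lam * √(4 * G * R * J) = J := by
    rw [hlam, ← sqrt_mul (by positivity), show J / (4 * G * R) * (4 * G * R * J) =
      J ^ 2 by field_simp, sqrt_sq hJ.le]
  have hlamG : 4 * G * R * lam = √(4 * G * R * J) := by
    have : lam * (4 * G * R * lam) = lam * √(4 * G * R * J) := by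
      rw [hlamJ, show lam * (4 * G * R * lam) = 4 * G * R * lam ^ 2 by ring, hlam2]; field_simp
    exact mul_left_cancel₀ hlam0.ne' this
  have hJl : J / (2 * lam) = √(4 * G * R * J) / 2 := by
    rw [div_eq_div_iff (by positivity) two_ne_zero]
    linarith
  simp only [Nat.add_sub_cancel]
  linarith

/-- The bound for the weighted divisor sum at `N = T^{1+η} / G²`. -/
theorem exists_weightedAtkinsonSum_bound (ε η θ B : ℝ) (hη : 0 < η) (hηε : η ≤ ε) (hθ : 0 < θ) :
    ∃ C : ℝ, ∀ (T G : ℝ) (R : ℕ) (τ : ℕ → ℝ) (φ : ℕ → ℝ → ℝ),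
      8 ≤ T → T ^ θ ≤ G → G ≤ T ^ (1 / 3 : ℝ) →
      WellSpacedPoints T (5 * G) R τ →
      (∀ r ∈ Finset.Icc 1 R, IsSmoothWeight B (τ r) G (φ r)) →
      |weightedAtkinsonSum (T ^ (1 + η) / G ^ 2) G R τ φ|
        ≤ C * (R : ℝ) ^ (1 / 2 : ℝ) * T ^ (1 / 2 + ε) := by
  have hε : 0 < ε := hη.trans_le hηε
  -- `N ^ (3κ) ≤ T ^ (3κ(1 + η)) = T ^ (ε / 2)` for this `κ`; two factors `N ^ κ` come from the divisor
  -- bound and one from the logarithm.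
  set κ : ℝ := ε / (6 * (1 + η)) with hκd
  have hκ : 0 < κ := by positivity
  obtain ⟨D, hD, hdiv⟩ := exists_card_divisors_le_rpow hκ
  set A : ℝ := 72 * D ^ 2 * (1 + 1 / κ) with hA
  have hA0 : 0 < A := by positivity
  refine ⟨|B| * (2 * √(4 * A)), fun T G R τ φ hT hG1 hG2 hτ hφ => ?_⟩
  have hT0 : 0 < T := by linarith
  have hT1 : 1 ≤ T := by linarith
  have hG0 : 1 ≤ G := (one_le_rpow hT1 hθ.le).trans hG1
  have hGp : 0 < G := by linarith
  have hGT : 4 * G ≤ T := by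
    -- `8 ^ (2/3) = 4`; this keeps the windows inside `[T/2, 3T]`.
    have h4 : (4:ℝ) ≤ T ^ (2 / 3 : ℝ) := by
      calc (4:ℝ) = (8:ℝ) ^ (2 / 3 : ℝ) := by
            rw [show (8:ℝ) = 2 ^ (3:ℝ) by norm_num, ← rpow_mul (by norm_num)]; norm_num
        _ ≤ _ := by gcongr
    calc 4 * G ≤ T ^ (2 / 3 : ℝ) * T ^ (1 / 3 : ℝ) := by gcongr
      _ = T := by rw [← rpow_add hT0]; norm_num
  set X := T ^ (1 + η) / G ^ 2 with hX
  have hX0 : 0 ≤ X := by positivity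
  set N := ⌊X⌋₊ with hN
  have hNX : (N:ℝ) ≤ X := Nat.floor_le hX0
  have hXT : X ≤ T ^ (1 + η) := div_le_self (by positivity) (one_le_pow₀ hG0)
  have hms := integral_atkinsonSum_sq_le hκ hD hdiv hT0 X
  rw [← hN] at hms
  have hfac : ((N : ℝ) ^ κ) ^ 2 * (1 + log N) ≤ (1 + 1 / κ) * T ^ (ε / 2) := by
    rcases Nat.eq_zero_or_pos N with h0 | h0
    · rw [h0, Nat.cast_zero, zero_rpow hκ.ne']; simp; positivity
    have hN1 : (1:ℝ) ≤ N := by exact_mod_cast h0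
    have h1 : 1 + log N ≤ (1 + 1 / κ) * (N:ℝ) ^ κ := by
      have a := log_le_rpow_div (x := (N:ℝ)) (by positivity) hκ
      have b := one_le_rpow hN1 hκ.le
      rw [add_mul, one_mul, one_div_mul_eq_div]
      linarith
    calc _ ≤ ((N : ℝ) ^ κ) ^ 2 * ((1 + 1 / κ) * (N:ℝ) ^ κ) := by gcongr
      _ = (1 + 1 / κ) * ((N : ℝ) ^ κ) ^ 3 := by ring
      _ ≤ (1 + 1 / κ) * ((T ^ (1 + η)) ^ κ) ^ 3 := by
          gcongr
          exact hNX.trans hXT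
      _ = (1 + 1 / κ) * T ^ (ε / 2) := by
          rw [← rpow_mul hT0.le, ← rpow_natCast, ← rpow_mul hT0.le]
          congr 2
          rw [hκd]; push_cast; field_simp; norm_num
  have hmain : T * √N + N * √(T + N) ≤ 3 * T ^ (3 / 2 + 3 / 2 * η) / G := by
    have h1 : √(T ^ (1 + η)) = T ^ (1 / 2 + 1 / 2 * η) := by
      rw [sqrt_eq_rpow, ← rpow_mul hT0.le]; ring_nf
    have h2 : √N ≤ T ^ (1 / 2 + 1 / 2 * η) / G := by
      calc √(N:ℝ) ≤ √(T ^ (1 + η) / G ^ 2) := sqrt_le_sqrt hNX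
        _ = _ := by rw [sqrt_div (by positivity), sqrt_sq hGp.le, h1]
    have h3 : √(T + N) ≤ 2 * T ^ (1 / 2 + 1 / 2 * η) := by
      rw [← h1, show (2:ℝ) =
        √4 by rw [show (4:ℝ) = 2 ^ 2 by norm_num]; simp, ← sqrt_mul (by norm_num)]
      apply sqrt_le_sqrt
      have : T ≤ T ^ (1 + η) := by
        conv_lhs => rw [← rpow_one T]
        exact rpow_le_rpow_of_exponent_le hT1 (by linarith)
      have : (0:ℝ) ≤ T ^ (1 + η) := by positivity
      linarith
    have e1 : T * T ^ (1 / 2 + 1 / 2 * η) = T ^ (3 / 2 + 1 / 2 * η) := by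
      rw [← rpow_one_add' hT0.le (by positivity)]; ring_nf
    have e2 : T ^ (1 + η) * T ^ (1 / 2 + 1 / 2 * η) = T ^ (3 / 2 + 3 / 2 * η) := by
      rw [← rpow_add hT0]; ring_nf
    have e3 : T ^ (3 / 2 + 1 / 2 * η) ≤ T ^ (3 / 2 + 3 / 2 * η) :=
      rpow_le_rpow_of_exponent_le hT1 (by linarith)
    have h4 : (N:ℝ) ≤ T ^ (1 + η) / G := hNX.trans (by
      rw [hX]; gcongr; nlinarith)
    calc _ ≤ T * (T ^ (1 / 2 + 1 / 2 * η) / G) + T ^ (1 + η) / G *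
      (2 * T ^ (1 / 2 + 1 / 2 * η)) := by gcongr
      _ = (T ^ (3 / 2 + 1 / 2 * η) + 2 * T ^ (3 / 2 + 3 / 2 * η)) / G := by rw [← e1, ← e2]; ring
      _ ≤ _ := by gcongr; linarith
  have hJ : ∫ t in (T / 2)..(3 * T), atkinsonSum X t ^ 2 ≤ A * T ^ (3 / 2 + 2 * ε) / G := by
    refine hms.trans ?_
    have hlog : 0 ≤ log N := log_natCast_nonneg N
    calc _ = 24 * D ^ 2 * (((N : ℝ) ^ κ) ^ 2 * (1 + log N)) * (T * √N + N * √(T + N)) := by ring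
      _ ≤ 24 * D ^ 2 * ((1 + 1 / κ) * T ^ (ε / 2)) * (3 * T ^ (3 / 2 + 3 / 2 * η) / G) := by gcongr
      _ = A * (T ^ (ε / 2) * T ^ (3 / 2 + 3 / 2 * η)) / G := by rw [hA]; ring
      _ ≤ A * T ^ (3 / 2 + 2 * ε) / G := by
        rw [← rpow_add hT0]
        gcongr A * ?_ / G
        exact rpow_le_rpow_of_exponent_le hT1 (by linarith)
  refine (abs_weightedAtkinsonSum_le hT0 hGp hGT hτ hφ (by positivity) hJ).trans (le_of_eq ?_)
  have e5 : 4 * G * R * (A * T ^ (3 / 2 + 2 * ε) / G) =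
    4 * A * R * T ^ (3 / 2 + 2 * ε) := by field_simp
  have e6 : √(T ^ (3 / 2 + 2 * ε)) = T ^ (3 / 4 + ε) := by
    rw [sqrt_eq_rpow, ← rpow_mul hT0.le]; ring_nf
  have e7 : T ^ (1 / 2 + ε) = T ^ (-(1 / 4) : ℝ) * T ^ (3 / 4 + ε) := by
    rw [← rpow_add hT0]; ring_nf
  rw [e5, sqrt_mul (by positivity), sqrt_mul (by positivity), e6, e7, sqrt_eq_rpow (R:ℝ)]
  ring

/-! ### A lower bound for the gamma function on `Re s = 1/4` -/

theorem norm_Gamma_le_Gamma_re {s : ℂ} (hs : 0 < s.re) : ‖Complex.Gamma s‖ ≤ Real.Gamma s.re := by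
  rw [Complex.Gamma_eq_integral hs, Real.Gamma_eq_integral hs, Complex.GammaIntegral]
  refine (norm_integral_le_integral_norm _).trans (le_of_eq ?_)
  refine setIntegral_congr_fun measurableSet_Ioi fun x hx => ?_
  simp only [mem_Ioi] at hx
  rw [norm_mul, Complex.norm_cpow_eq_rpow_re_of_pos hx]
  simp [Complex.norm_exp]

/-- On the line `Re s = 1/2` the reflection formula gives the modulus of `Γ` exactly. -/
theorem norm_Gamma_half_sq (y : ℝ) : ‖Complex.Gamma (1 / 2 + y * Complex.I)‖ ^ 2 =
    π / cosh (π * y) := by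
  have h := Complex.Gamma_mul_Gamma_one_sub (1 / 2 + y * Complex.I)
  have e1 : (1 - (1 / 2 + y * Complex.I) : ℂ) = (starRingEnd ℂ) (1 / 2 + y * Complex.I) := by
    apply Complex.ext <;> simp; norm_num
  have e2 : Complex.sin (π * (1 / 2 + y * Complex.I)) = (cosh (π * y) : ℝ) := by
    rw [show (π * (1 / 2 + y * Complex.I) : ℂ) = (π * y : ℝ) * Complex.I + π / 2 by push_cast; ring,
      Complex.sin_add_pi_div_two, Complex.cos_mul_I, Complex.ofReal_cosh]
  rw [e1, e2, Complex.Gamma_conj, Complex.mul_conj, Complex.normSq_eq_norm_sq] at h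
  exact_mod_cast h

theorem norm_Gamma_half_le (y : ℝ) : ‖Complex.Gamma (1 / 2 + y * Complex.I)‖ ≤
    3 * exp (-(π * |y| / 2)) := by
  refine le_of_sq_le_sq ?_ (by positivity)
  rw [norm_Gamma_half_sq, mul_pow, ← Real.exp_nat_mul, div_le_iff₀ (cosh_pos _), ← cosh_abs,
    Real.cosh_eq]
  have e : |π * y| = π * |y| := by rw [abs_mul, abs_of_pos pi_pos]
  rw [e, show ((2:ℕ):ℝ) * -(π * |y| / 2) = -(π * |y|) by push_cast; ring]
  have h1 : exp (-(π * |y|)) * exp (π * |y|) = 1 := by rw [← Real.exp_add]; simp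
  have h2 : 0 < exp (-(π * |y|)) := Real.exp_pos _
  nlinarith [pi_lt_four]

open Complex.HadamardThreeLines in
/-- Interpolation by the three lines theorem between `Re s = 1/2` and `Re s = 3/2`, where the modulus of
`Γ` is known. The factor `exp(-iπz/2)` removes the exponential decay, and `exp((z - iY)²)` localizes
near height `Y` at the cost of a constant. -/
theorem norm_Gamma_three_quarters_le {Y : ℝ} (hY : 0 ≤ Y) :
    ‖Complex.Gamma (3 / 4 + Y * Complex.I)‖ ≤
      3 * exp 9 * (Y + 2) ^ (1 / 4 : ℝ) * exp (-(π * Y / 2)) := by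
  set f : ℂ → ℂ := fun z => Complex.Gamma z * Complex.exp (-(Complex.I * π * z / 2)) *
    Complex.exp ((z - Y * Complex.I) ^ 2) with hf
  have hn : ∀ z, ‖f z‖ = ‖Complex.Gamma z‖ * exp (π * z.im / 2) *
    exp (z.re ^ 2 - (z.im - Y) ^ 2) := by
    intro z
    simp only [hf]
    rw [norm_mul, norm_mul, Complex.norm_exp, Complex.norm_exp]
    congr 2
    · simp
      ring
    · simp [sq]
  have hz : (3 / 4 + Y * Complex.I : ℂ) ∈ verticalClosedStrip (1 / 2) (3 / 2) := by
    simp [verticalClosedStrip]; norm_num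
  have hdiff : ∀ z : ℂ, 0 < z.re → DifferentiableAt ℂ f z := by
    intro z hz
    have : DifferentiableAt ℂ Complex.Gamma z := Complex.differentiableAt_Gamma z fun m h => by
      rw [h] at hz
      simp at hz
      have : (0:ℝ) ≤ m := by positivity
      linarith
    refine (this.mul ?_).mul ?_ <;> fun_prop
  have hd : DiffContOnCl ℂ f (verticalStrip (1 / 2) (3 / 2)) := by
    apply DifferentiableOn.diffContOnCl
    intro z hz
    refine (hdiff z ?_).differentiableWithinAt
    have : closure (verticalStrip (1 / 2) (3 / 2)) ⊆ verticalClosedStrip (1 / 2) (3 / 2) :=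
      closure_minimal (preimage_mono Ioo_subset_Icc_self)
        (isClosed_Icc.preimage Complex.continuous_re)
    have := (this hz).1
    simp at this
    linarith
  have hB : BddAbove ((norm ∘ f) '' verticalClosedStrip (1 / 2) (3 / 2)) := by
    have hcont : ContinuousOn Real.Gamma (Icc (1 / 2) (3 / 2)) := fun x hx =>
      (Real.differentiableAt_Gamma fun m h => by
        have := hx.1
        have : (0:ℝ) ≤ m := by positivity
        linarith).continuousAt.continuousWithinAt
    obtain ⟨M, hM⟩ := (isCompact_Icc.image_of_continuousOn hcont).bddAbove
    refine ⟨M * exp (π * Y / 2 + 1) * exp 3, ?_⟩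
    rintro _ ⟨z, hz, rfl⟩
    have h1 : ‖Complex.Gamma z‖ ≤ M :=
      (norm_Gamma_le_Gamma_re (by have := hz.1; linarith)).trans (hM ⟨z.re, hz, rfl⟩)
    simp only [Function.comp, hn, mul_assoc, ← Real.exp_add]
    refine mul_le_mul h1 (Real.exp_le_exp.2 ?_) (Real.exp_pos _).le ((norm_nonneg _).trans h1)
    have h2 : z.re ^ 2 ≤ 3 := by nlinarith [hz.1, hz.2]
    have h3 : π ^ 2 ≤ 16 := by nlinarith [pi_pos, pi_lt_four]
    nlinarith [sq_nonneg (z.im - Y - π / 4)]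
  have ha : ∀ z ∈ Complex.re ⁻¹' {(1 / 2 : ℝ)}, ‖f z‖ ≤ 3 * exp 9 := by
    intro z hz
    have hz' : z = 1 / 2 + z.im * Complex.I := by
      apply Complex.ext
      · simpa using hz
      · simp
    have hz'' : z.re = 1 / 2 := hz
    rw [hn, hz'']
    have h1 := norm_Gamma_half_le z.im
    rw [← hz'] at h1
    calc _ ≤ 3 * exp (-(π * |z.im| / 2)) * exp (π * z.im / 2) *
      exp ((1 / 2) ^ 2 - (z.im - Y) ^ 2) := by gcongr
      _ = 3 * exp (-(π * |z.im| / 2) + π * z.im / 2 + ((1 / 2) ^ 2 - (z.im - Y) ^ 2)) := by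
          rw [Real.exp_add, Real.exp_add]; ring
      _ ≤ _ := by
          gcongr
          nlinarith [le_abs_self z.im, pi_pos, sq_nonneg (z.im - Y)]
  have hb : ∀ z ∈ Complex.re ⁻¹' {(3 / 2 : ℝ)}, ‖f z‖ ≤ 3 * exp 9 * (Y + 2) := by
    intro z hz
    have hz'' : z.re = 3 / 2 := hz
    set w : ℂ := 1 / 2 + z.im * Complex.I with hw
    have hz' : z = w + 1 := by
      apply Complex.ext
      · rw [hz'']; simp [hw]; norm_num
      · simp [hw]
    have hw0 : w ≠ 0 := fun h => by
      have := congrArg Complex.re h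
      simp [hw] at this
    have h1 := norm_Gamma_half_le z.im
    rw [← hw] at h1
    have h2 : ‖Complex.Gamma z‖ ≤ (1 / 2 + |z.im|) * (3 * exp (-(π * |z.im| / 2))) := by
      rw [hz', Complex.Gamma_add_one w hw0, norm_mul, ← hz']
      gcongr
      refine (norm_add_le _ _).trans ?_
      simp
    rw [hn, hz'']
    have h3 : (1 / 2 + |z.im|) ≤ (Y + 2) * exp ((z.im - Y) ^ 2) := by
      have a := Real.add_one_le_exp ((z.im - Y) ^ 2)
      have b : |z.im| ≤ |z.im - Y| + Y := by
        have := abs_add_le (z.im - Y) Y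
        rwa [sub_add_cancel, abs_of_nonneg hY] at this
      have c : |z.im - Y| ≤ 1 + (z.im - Y) ^ 2 := by
        rw [← sq_abs (z.im - Y)]
        nlinarith [sq_nonneg (|z.im - Y| - 1), abs_nonneg (z.im - Y)]
      nlinarith [sq_nonneg (z.im - Y)]
    calc _ ≤ ((Y + 2) * exp ((z.im - Y) ^ 2)) * (3 * exp (-(π * |z.im| / 2))) *
      exp (π * z.im / 2) * exp ((3 / 2) ^ 2 - (z.im - Y) ^ 2) := by
            gcongr
            exact h2.trans (by gcongr)
      _ = 3 * exp ((z.im - Y) ^ 2 + -(π * |z.im| / 2) + π * z.im / 2 +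
        ((3 / 2) ^ 2 - (z.im - Y) ^ 2)) * (Y + 2) := by
          rw [Real.exp_add, Real.exp_add, Real.exp_add]; ring
      _ ≤ _ := by
          gcongr
          nlinarith [le_abs_self z.im, pi_pos]
  have key := norm_le_interp_of_mem_verticalClosedStrip' (by norm_num) hz hd hB ha hb
  rw [hn] at key
  have er : (3 / 4 + Y * Complex.I : ℂ).re = 3 / 4 := by simp
  have ei : (3 / 4 + Y * Complex.I : ℂ).im = Y := by simp
  rw [er, ei] at key
  have hQ : (0:ℝ) < 3 * exp 9 := by positivity
  rw [mul_rpow hQ.le (by positivity), ← mul_assoc, ← rpow_add hQ] at key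
  norm_num at key
  have h4 : 1 ≤ exp (9 / 16 : ℝ) := Real.one_le_exp (by norm_num)
  rw [Real.exp_neg, ← div_eq_mul_inv, le_div_iff₀ (Real.exp_pos _)]
  refine le_trans ?_ key
  have : 0 ≤ ‖Complex.Gamma (3 / 4 + Y * Complex.I)‖ * exp (π * Y / 2) := by positivity
  nlinarith

/-- The lower bound of Stirling type on `Re s = 1/4`, from the upper bound on `Re s = 3/4` by the
reflection formula. -/
theorem exists_le_norm_Gamma_quarter : ∃ c : ℝ, 0 < c ∧ ∀ y : ℝ, 1 / 2 ≤ y →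
    c * y ^ (-(1 / 4) : ℝ) * exp (-(π * y / 2)) ≤ ‖Complex.Gamma (1 / 4 + y * Complex.I)‖ := by
  refine ⟨π / (15 * exp 9), by positivity, fun y hy => ?_⟩
  have hy0 : 0 < y := by linarith
  have h := Complex.Gamma_mul_Gamma_one_sub (1 / 4 + y * Complex.I)
  have e1 : (1 - (1 / 4 + y * Complex.I) : ℂ) = (starRingEnd ℂ) (3 / 4 + y * Complex.I) := by
    simp only [map_add, map_mul, map_div₀, map_ofNat, Complex.conj_I, Complex.conj_ofReal]
    ring
  rw [e1, Complex.Gamma_conj] at h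
  have hs : ‖Complex.sin (π * (1 / 4 + y * Complex.I))‖ ≤ exp (π * y) := by
    rw [Complex.sin, norm_div, norm_mul, Complex.norm_I, mul_one]
    simp only [Complex.norm_ofNat]
    rw [div_le_iff₀ two_pos]
    refine (norm_sub_le _ _).trans ?_
    rw [Complex.norm_exp, Complex.norm_exp]
    have a1 : (-(π * (1 / 4 + y * Complex.I)) * Complex.I : ℂ).re = π * y := by simp
    have a2 : (π * (1 / 4 + y * Complex.I) * Complex.I : ℂ).re = -(π * y) := by simp
    rw [a1, a2]
    have hπy : 0 < π * y := by positivity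
    have : exp (-(π * y)) ≤ exp (π * y) := Real.exp_le_exp.2 (by linarith)
    linarith
  have hs0 : Complex.sin (π * (1 / 4 + y * Complex.I)) ≠ 0 := by
    intro h0
    rw [h0, div_zero, mul_eq_zero, map_eq_zero] at h
    rcases h with h | h
    · exact Complex.Gamma_ne_zero_of_re_pos (by simp) h
    · exact Complex.Gamma_ne_zero_of_re_pos (by simp) h
  have hn := congrArg norm h
  rw [norm_mul, norm_div, Complex.norm_conj, Complex.norm_real, Real.norm_of_nonneg pi_pos.le] at hn
  have h3 := norm_Gamma_three_quarters_le hy0.le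
  have h5 : (y + 2) ^ (1 / 4 : ℝ) ≤ 5 * y ^ (1 / 4 : ℝ) := by
    calc (y + 2) ^ (1 / 4 : ℝ) ≤ (5 * y) ^ (1 / 4 : ℝ) := by gcongr; linarith
      _ = 5 ^ (1 / 4 : ℝ) * y ^ (1 / 4 : ℝ) := mul_rpow (by norm_num) hy0.le
      _ ≤ 5 * y ^ (1 / 4 : ℝ) := by
        gcongr
        conv_rhs => rw [← rpow_one (5:ℝ)]
        exact rpow_le_rpow_of_exponent_le (by norm_num) (by norm_num)
  set g := ‖Complex.Gamma (1 / 4 + y * Complex.I)‖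
  have hp : π * exp (-(π * y)) ≤ g * (15 * exp 9 * y ^ (1 / 4 : ℝ) * exp (-(π * y / 2))) := by
    calc π * exp (-(π * y)) = π / exp (π * y) := by rw [Real.exp_neg, div_eq_mul_inv]
      _ ≤ π / ‖Complex.sin (π * (1 / 4 + y * Complex.I))‖ := by
          gcongr
      _ = g * ‖Complex.Gamma (3 / 4 + y * Complex.I)‖ := hn.symm
      _ ≤ g * (3 * exp 9 * (5 * y ^ (1 / 4 : ℝ)) * exp (-(π * y / 2))) := by
          gcongr
          exact h3.trans (by gcongr)
      _ = _ := by ring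
  rw [show -(π * y) = -(π * y / 2) + -(π * y / 2) by ring, Real.exp_add] at hp
  have hx := Real.exp_pos (-(π * y / 2))
  have hp2 : π * exp (-(π * y / 2)) ≤ g * (15 * exp 9 * y ^ (1 / 4 : ℝ)) := by
    refine le_of_mul_le_mul_right ?_ hx
    calc _ = _ := by ring
      _ ≤ _ := hp
      _ = _ := by ring
  have hy4 : 0 < y ^ (1 / 4 : ℝ) := by positivity
  rw [rpow_neg hy0.le, show π / (15 * exp 9) * (y ^ (1 / 4 : ℝ))⁻¹ * exp (-(π * y / 2)) =
    π * exp (-(π * y / 2)) / (15 * exp 9 * y ^ (1 / 4 : ℝ)) by field_simp]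
  rw [div_le_iff₀ (by positivity)]
  exact hp2

/-! ### A theta function and its Mellin transform along a ray -/

/-- The gamma integral with a complex rate `r` in the right half plane, by analytic continuation in `r`
from `r > 0`. -/
theorem integral_cpow_mul_cexp_neg_mul_Ioi_of_re_pos {a r : ℂ} (ha : 0 < a.re) (hr : 0 < r.re) :
    ∫ t : ℝ in Ioi 0, (t : ℂ) ^ (a - 1) * Complex.exp (-(r * t)) = (1 / r) ^ a * Complex.Gamma a := by
  set F : ℂ → ℂ := fun r => ∫ t : ℝ in Ioi 0, (t : ℂ) ^ (a - 1) * Complex.exp (-(r * t)) with hF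
  set H : Set ℂ := {z | 0 < z.re} with hH
  have hHo : IsOpen H := isOpen_lt continuous_const Complex.continuous_re
  have hmeas : ∀ (b r : ℂ), AEStronglyMeasurable (fun t : ℝ => (t : ℂ) ^ b * Complex.exp (-(r * t)))
      (volume.restrict (Ioi 0)) := by
    intro b r
    refine ContinuousOn.aestronglyMeasurable (fun t ht =>
      ContinuousAt.continuousWithinAt ?_) measurableSet_Ioi
    refine ContinuousAt.mul ?_ (by fun_prop)
    exact Complex.continuousAt_ofReal_cpow_const _ _ (Or.inr (ne_of_gt ht))
  have hnorm : ∀ (b r : ℂ) (t : ℝ), 0 < t → ‖(t : ℂ) ^ b * Complex.exp (-(r * t))‖ = t ^ b.re * exp (-(r.re * t)) := by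
    intro b r t ht
    rw [norm_mul, Complex.norm_cpow_eq_rpow_re_of_pos ht, Complex.norm_exp]
    simp
  have hint : ∀ (b : ℝ) (c : ℝ), -1 < b → 0 < c → IntegrableOn (fun t => t ^ b * exp (-(c * t))) (Ioi 0) := by
    intro b c hb hc
    simpa [neg_mul] using integrableOn_rpow_mul_exp_neg_mul_rpow hb (one_pos : (0:ℝ) < 1) hc
  have hdiff : DifferentiableOn ℂ F H := by
    intro z hz
    have hz' : 0 < z.re := hz
    refine DifferentiableAt.differentiableWithinAt ?_
    have hs : {w : ℂ | z.re / 2 < w.re} ∈ 𝓝 z :=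
      (isOpen_lt continuous_const Complex.continuous_re).mem_nhds (show z.re / 2 < z.re by linarith)
    have := hasDerivAt_integral_of_dominated_loc_of_deriv_le (μ := volume.restrict (Ioi (0:ℝ)))
      (F := fun (r : ℂ) (t : ℝ) => (t : ℂ) ^ (a - 1) * Complex.exp (-(r * t)))
      (F' := fun (r : ℂ) (t : ℝ) => -((t : ℂ) ^ a * Complex.exp (-(r * t))))
      (bound := fun t => t ^ a.re * exp (-(z.re / 2 * t))) hs
      (Eventually.of_forall fun r => hmeas _ _) ?_ (hmeas _ _).neg ?_ (hint _ _ (by linarith) (by linarith)) ?_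
    · exact this.2.differentiableAt
    · refine (integrable_norm_iff (hmeas _ _)).1 (IntegrableOn.congr_fun (hint (a.re - 1) z.re (by linarith) hz')
        (fun t ht => ?_) measurableSet_Ioi)
      rw [hnorm _ _ _ ht]; simp
    · refine (ae_restrict_mem measurableSet_Ioi).mono fun t ht w hw => ?_
      rw [norm_neg, hnorm _ _ _ ht]
      have ht' : 0 < t := ht
      have hw' : z.re / 2 < w.re := hw
      gcongr
    · refine (ae_restrict_mem measurableSet_Ioi).mono fun t ht w _ => ?_
      have ht' : (t:ℂ) ≠ 0 := Complex.ofReal_ne_zero.2 (ne_of_gt ht)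
      have h1 : HasDerivAt (fun r : ℂ =>
        Complex.exp (-(r * t))) (Complex.exp (-(w * t)) * (-(1 * t))) w :=
        (((hasDerivAt_id w).mul_const (t:ℂ)).neg).cexp
      refine (h1.const_mul ((t:ℂ) ^ (a - 1))).congr_deriv ?_
      rw [Complex.cpow_sub _ _ ht', Complex.cpow_one]
      field_simp
  have hGd : DifferentiableOn ℂ (fun r : ℂ => (1 / r) ^ a * Complex.Gamma a) H := by
    intro z hz
    have hz' : 0 < z.re := hz
    have hz0 : z ≠ 0 := fun h => by simp [h] at hz'
    refine DifferentiableAt.differentiableWithinAt (DifferentiableAt.mul_const ?_ _)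
    refine DifferentiableAt.cpow_const ((differentiableAt_const _).div differentiableAt_id hz0) ?_
    left
    simp only [one_div]
    show 0 < (z⁻¹).re
    rw [Complex.inv_re]
    exact div_pos hz' (Complex.normSq_pos.2 hz0)
  have hpre : IsPreconnected H := (convex_halfSpace_re_gt 0).isPreconnected
  -- The two sides agree at the points `1 + 1 / (n + 1)`, which accumulate at `1`.
  have hfreq : ∃ᶠ z in 𝓝[≠] (1:ℂ), F z = (1 / z) ^ a * Complex.Gamma a := by
    have htend : Tendsto (fun n : ℕ => ((1 + 1 / ((n:ℝ) + 1) : ℝ) : ℂ)) atTop (𝓝[≠] (1:ℂ)) := by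
      refine tendsto_nhdsWithin_iff.2 ⟨?_, Eventually.of_forall fun n => ?_⟩
      · have := (tendsto_one_div_add_atTop_nhds_zero_nat (𝕜 := ℝ)).const_add 1
        rw [add_zero] at this
        exact_mod_cast (Complex.continuous_ofReal.tendsto 1).comp this
      · simp only [mem_compl_iff, mem_singleton_iff]
        intro h
        have h2 : (1 + 1 / ((n:ℝ) + 1) : ℝ) = 1 := by exact_mod_cast h
        have : 0 < 1 / ((n:ℝ) + 1) := by positivity
        linarith
    refine htend.frequently (Frequently.of_forall fun n => ?_)
    have hp : 0 < 1 + 1 / ((n:ℝ) + 1) := by positivity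
    exact Complex.integral_cpow_mul_exp_neg_mul_Ioi ha hp
  exact (hdiff.analyticOnNhd hHo).eqOn_of_preconnected_of_frequently_eq (hGd.analyticOnNhd hHo) hpre
    (show (1:ℂ) ∈ H by simp [hH]) hfreq hr

theorem Complex.ofReal_mul_cpow_of_pos {r : ℝ} (hr : 0 < r) {z : ℂ} (hz : z ≠ 0) (s : ℂ) :
    ((r : ℂ) * z) ^ s = (r : ℂ) ^ s * z ^ s := by
  have hr' : (r : ℂ) ≠ 0 := Complex.ofReal_ne_zero.2 hr.ne'
  rw [Complex.cpow_def_of_ne_zero (mul_ne_zero hr' hz), Complex.cpow_def_of_ne_zero hr',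
    Complex.cpow_def_of_ne_zero hz, ← Complex.exp_add, Complex.log_ofReal_mul hr hz,
    Complex.ofReal_log hr.le]
  ring_nf

/-- The coefficients `c_n = 3·[2 ∣ n] - 1 - 2·[4 ∣ n]`, which depend on `n` modulo `4` only. They come from
the combination `3 θ(z) - θ(z/4) - 2 θ(4z)` of theta functions, in which the constant terms cancel. -/
noncomputable def thetaCoeff (n : ℕ) : ℂ :=
  3 * (if 2 ∣ n then 1 else 0) - 1 - 2 * (if 4 ∣ n then 1 else 0)

theorem thetaCoeff_zero : thetaCoeff 0 = 0 := by norm_num [thetaCoeff]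

theorem norm_thetaCoeff_le (n : ℕ) : ‖thetaCoeff n‖ ≤ 2 := by
  unfold thetaCoeff
  split_ifs with h1 h2 h2
  · norm_num
  · norm_num
  · exact absurd (dvd_trans (by norm_num) h2) h1
  · norm_num

theorem conj_thetaCoeff (n : ℕ) : (starRingEnd ℂ) (thetaCoeff n) = thetaCoeff n := by
  unfold thetaCoeff
  split_ifs <;> simp [map_ofNat]

/-- The theta series `Θ(z) = ∑_n c_n exp(-π n² z / 4)` with the coefficients `thetaCoeff`, meaningful
for `Re z > 0`. -/
noncomputable def twistTheta (z : ℂ) : ℂ :=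
  ∑' n : ℕ, thetaCoeff n * Complex.exp (-(π / 4 * n ^ 2 * z))

/-- Comparison with a geometric series: `n² ≥ 1 + (n - 1)` for `n ≥ 1`. The truncated subtraction at
`n = 0` is harmless since `c_0 = 0`. -/
theorem norm_twistTheta_term_le (n : ℕ) {z : ℂ} (hz : 0 < z.re) :
    ‖thetaCoeff n * Complex.exp (-(π / 4 * n ^ 2 * z))‖ ≤
      2 * exp (-(π / 4 * z.re)) * exp (-(π / 4 * z.re)) ^ (n - 1) := by
  rcases Nat.eq_zero_or_pos n with rfl | hn
  · rw [thetaCoeff_zero]; simp; positivity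
  rw [norm_mul, Complex.norm_exp]
  have e : (-(π / 4 * n ^ 2 * z) : ℂ).re = -(π / 4 * n ^ 2 * z.re) := by
    rw [show (-(π / 4 * n ^ 2 * z) : ℂ) =
      ((-(π / 4 * n ^ 2) : ℝ) : ℂ) * z by push_cast; ring, Complex.re_ofReal_mul]
    ring
  rw [e, mul_assoc 2, ← pow_succ', Nat.sub_add_cancel hn, ← Real.exp_nat_mul]
  gcongr
  · exact norm_thetaCoeff_le n
  · have : (n:ℝ) ≤ n ^ 2 := by exact_mod_cast Nat.le_self_pow two_ne_zero n
    have : 0 < π / 4 * z.re := by positivity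
    nlinarith

theorem summable_twistTheta {z : ℂ} (hz : 0 < z.re) :
    Summable fun n : ℕ => thetaCoeff n * Complex.exp (-(π / 4 * n ^ 2 * z)) := by
  refine Summable.of_norm_bounded (g := fun n =>
    2 * exp (-(π / 4 * z.re)) * exp (-(π / 4 * z.re)) ^ (n - 1)) ?_
    fun n => norm_twistTheta_term_le n hz
  refine Summable.mul_left _ ?_
  rw [← summable_nat_add_iff 1]
  refine summable_geometric_of_lt_one (Real.exp_pos _).le ?_
  rw [Real.exp_lt_one_iff]
  have : 0 < π / 4 * z.re := by positivity
  linarith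

theorem norm_twistTheta_le {z : ℂ} {ρ : ℝ} (hρ : 0 < ρ) (hz : ρ ≤ z.re) :
    ‖twistTheta z‖ ≤ 2 / (1 - exp (-(π / 4 * ρ))) * exp (-(π / 4 * z.re)) := by
  have hz0 : 0 < z.re := hρ.trans_le hz
  have hr : exp (-(π / 4 * z.re)) < 1 := by
    rw [Real.exp_lt_one_iff]
    have : 0 < π / 4 * z.re := by positivity
    linarith
  have hr' : exp (-(π / 4 * ρ)) < 1 := by
    rw [Real.exp_lt_one_iff]
    have : 0 < π / 4 * ρ := by positivity
    linarith
  have hg := hasSum_geometric_of_lt_one (Real.exp_pos _).le hr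
  rw [twistTheta, (summable_twistTheta hz0).tsum_eq_zero_add, thetaCoeff_zero, zero_mul, zero_add]
  refine (tsum_of_norm_bounded (hg.mul_left (2 * exp (-(π / 4 * z.re)))) fun n => ?_).trans ?_
  · simpa using norm_twistTheta_term_le (n + 1) hz0
  · rw [mul_right_comm, ← div_eq_mul_inv]
    gcongr

theorem continuousOn_twistTheta : ContinuousOn twistTheta {z | 0 < z.re} := by
  intro z hz
  have hz' : 0 < z.re := hz
  refine ContinuousAt.continuousWithinAt ?_
  have hs : {w : ℂ | z.re / 2 < w.re} ∈ 𝓝 z :=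
    (isOpen_lt continuous_const Complex.continuous_re).mem_nhds (show z.re / 2 < z.re by linarith)
  refine ContinuousOn.continuousAt ?_ hs
  unfold twistTheta
  refine continuousOn_tsum (u := fun n =>
    2 * exp (-(π / 4 * (z.re / 2))) * exp (-(π / 4 * (z.re / 2))) ^ (n - 1))
    (fun n => by fun_prop) ?_ ?_
  · refine Summable.mul_left _ ?_
    rw [← summable_nat_add_iff 1]
    refine summable_geometric_of_lt_one (Real.exp_pos _).le ?_
    rw [Real.exp_lt_one_iff]
    have : 0 < π / 4 * (z.re / 2) := by positivity
    linarith
  · intro n w hw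
    have hw' : z.re / 2 < w.re := hw
    refine (norm_twistTheta_term_le n (by linarith)).trans ?_
    gcongr

theorem twistTheta_conj {z : ℂ} : twistTheta ((starRingEnd ℂ) z) =
    (starRingEnd ℂ) (twistTheta z) := by
  unfold twistTheta
  rw [Complex.conj_tsum]
  refine tsum_congr fun n => ?_
  rw [map_mul, conj_thetaCoeff, ← Complex.exp_conj]
  simp [map_ofNat]

theorem summable_exp_int_sq {z : ℂ} (hz : 0 < z.re) : Summable fun n : ℤ =>
    Complex.exp (-π * z * (n:ℂ) ^ 2) := by
  have := summable_jacobiTheta₂_term_iff 0 (Complex.I * z) |>.2 (by simpa using hz)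
  refine this.congr fun n => ?_
  rw [jacobiTheta₂_term]
  congr 1
  linear_combination (π * z * (n:ℂ)^2) * Complex.I_sq

/-- `2Θ(z) = 3 θ(z) - θ(z/4) - 2 θ(4z)` with `θ(z) = ∑_{n ∈ ℤ} exp(-π n² z)`: on writing all three series
in terms of `exp(-π n² z / 4)`, the first and the last run over the multiples of `2` and of `4`. -/
theorem two_mul_twistTheta {z : ℂ} (hz : 0 < z.re) : 2 * twistTheta z =
    3 * (∑' n : ℤ, Complex.exp (-π * z * (n:ℂ) ^ 2)) -
      (∑' n : ℤ, Complex.exp (-π * (z / 4) * (n:ℂ) ^ 2))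
      - 2 * ∑' n : ℤ, Complex.exp (-π * (4 * z) * (n:ℂ) ^ 2) := by
  set q : ℤ → ℂ := fun n => Complex.exp (-π * (z / 4) * (n:ℂ) ^ 2) with hq
  have hz4 : 0 < (z / 4).re := by
    rw [Complex.div_ofNat_re]; positivity
  have h4z : 0 < (4 * z).re := by
    simpa using hz
  have s1 := (summable_exp_int_sq hz4).hasSum
  have s2 : HasSum (fun n : ℤ => if 2 ∣ n then q n else 0)
    (∑' n : ℤ, Complex.exp (-π * z * (n:ℂ) ^ 2)) := by
    have inj : Function.Injective (fun n : ℤ => 2 * n) := fun a b h => by simpa using h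
    rw [← inj.hasSum_iff]
    · convert (summable_exp_int_sq hz).hasSum using 1
      ext n
      simp only [Function.comp, dvd_mul_right, if_true, hq]
      congr 1
      push_cast; ring
    · intro n hn
      rw [if_neg]
      rintro ⟨k, rfl⟩
      exact hn ⟨k, rfl⟩
  have s4 : HasSum (fun n : ℤ => if 4 ∣ n then q n else 0)
    (∑' n : ℤ, Complex.exp (-π * (4 * z) * (n:ℂ) ^ 2)) := by
    have inj : Function.Injective (fun n : ℤ => 4 * n) := fun a b h => by simpa using h
    rw [← inj.hasSum_iff]
    · convert (summable_exp_int_sq h4z).hasSum using 1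
      ext n
      simp only [Function.comp, dvd_mul_right, if_true, hq]
      congr 1
      push_cast; ring
    · intro n hn
      rw [if_neg]
      rintro ⟨k, rfl⟩
      exact hn ⟨k, rfl⟩
  have sZ := ((s2.mul_left 3).sub s1).sub (s4.mul_left 2)
  have sN : HasSum (fun n : ℕ => thetaCoeff n * Complex.exp (-(π / 4 * n ^ 2 * z)))
    (twistTheta z) :=
    (summable_twistTheta hz).hasSum
  have hN : HasSum (fun n : ℤ =>
    3 * (if 2 ∣ n then q n else 0) - q n - 2 * (if 4 ∣ n then q n else 0))
      (twistTheta z + twistTheta z - 0) := by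
    have hterm : ∀ n : ℕ, 3 * (if (2:ℤ) ∣ (n:ℤ) then q n else 0) - q n - 2 *
      (if (4:ℤ) ∣ (n:ℤ) then q n else 0) =
        thetaCoeff n * Complex.exp (-(π / 4 * n ^ 2 * z)) := by
      intro n
      have e : q n = Complex.exp (-(π / 4 * n ^ 2 * z)) := by
        simp only [hq]; congr 1; push_cast; ring
      have d2 : (2:ℤ) ∣ (n:ℤ) ↔ 2 ∣ n := by exact_mod_cast Int.natCast_dvd_natCast (m := 2)
      have d4 : (4:ℤ) ∣ (n:ℤ) ↔ 4 ∣ n := by exact_mod_cast Int.natCast_dvd_natCast (m := 4)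
      simp only [d2, d4, e, thetaCoeff]
      split_ifs <;> ring
    have h0 := hterm 0
    rw [thetaCoeff_zero, zero_mul] at h0
    have hneg : ∀ n : ℤ, q (-n) = q n := fun n => by simp [hq]
    have := HasSum.of_nat_of_neg (f := fun n : ℤ =>
      3 * (if 2 ∣ n then q n else 0) - q n - 2 * (if 4 ∣ n then q n else 0))
      (g := twistTheta z) (g' := twistTheta z) (by simpa only [hterm] using sN)
      (by simpa only [dvd_neg, hneg, hterm] using sN)
    rwa [show (3 * (if (2:ℤ) ∣ 0 then q 0 else 0) - q 0 - 2 * (if (4:ℤ) ∣ 0 then q 0 else 0)) =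
      0 from h0] at this
  have := hN.unique sZ
  rw [← this]; ring

/-- The transformation law `Θ(1/z) = z^{1/2} Θ(z)`. Inversion exchanges `θ(z/4)` and `2 θ(4z)` up to
the factor `z^{1/2}`. -/
theorem twistTheta_one_div {z : ℂ} (hz : 0 < z.re) : twistTheta (1 / z) =
    z ^ (1 / 2 : ℂ) * twistTheta z := by
  have hz0 : z ≠ 0 := fun h => by simp [h] at hz
  have hz1 : 0 < (1 / z).re := by
    rw [one_div, Complex.inv_re]; exact div_pos hz (Complex.normSq_pos.2 hz0)
  have hz4 : 0 < (z / 4).re := by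
    rw [Complex.div_ofNat_re]; positivity
  have h4z : 0 < (4 * z).re := by simpa using hz
  have a := two_mul_twistTheta hz
  have b := two_mul_twistTheta hz1
  have hc0 : z ^ (1 / 2 : ℂ) ≠ 0 := by
    rw [Ne, Complex.cpow_eq_zero_iff]; tauto
  have e4 : ((4:ℝ):ℂ) ^ (1 / 2 : ℂ) = 2 := by
    rw [show (1 / 2 : ℂ) =
      ((1 / 2 : ℝ) :
      ℂ) by push_cast; ring, ← Complex.ofReal_cpow (by norm_num), ← Real.sqrt_eq_rpow,
      show (4:ℝ) = 2 ^ 2 by norm_num]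
    simp
  have c1 : (4 * z) ^ (1 / 2 : ℂ) = 2 * z ^ (1 / 2 : ℂ) := by
    have h := Complex.ofReal_mul_cpow_of_pos (show (0:ℝ) < 4 by norm_num) hz0 (1 / 2)
    rw [e4] at h
    rw [← h]; push_cast; rfl
  have c2 : 2 * (z / 4) ^ (1 / 2 : ℂ) = z ^ (1 / 2 : ℂ) := by
    have h := Complex.ofReal_mul_cpow_of_pos (show (0:ℝ) < 4 by norm_num)
      (div_ne_zero hz0 (by norm_num : (4:ℂ) ≠ 0)) (1 / 2)
    rw [e4] at h
    rw [← h]; congr 1; push_cast; field_simp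
  have t1 := Complex.tsum_exp_neg_mul_int_sq hz
  have t2 := Complex.tsum_exp_neg_mul_int_sq hz4
  have t3 := Complex.tsum_exp_neg_mul_int_sq h4z
  have u1 : ∀ n : ℤ, Complex.exp (-π * (1 / z) * (n:ℂ) ^ 2) = Complex.exp (-π / z * (n:ℂ) ^ 2) :=
    fun n => by congr 1; ring
  have u2 : ∀ n : ℤ, Complex.exp (-π * (4 * (1 / z)) * (n:ℂ) ^ 2) =
    Complex.exp (-π / (z / 4) * (n:ℂ) ^ 2) := fun n => by
    congr 1; field_simp
  have u3 : ∀ n : ℤ, Complex.exp (-π * (1 / z / 4) * (n:ℂ) ^ 2) =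
    Complex.exp (-π / (4 * z) * (n:ℂ) ^ 2) := fun n => by
    congr 1; field_simp
  simp only [u1, u2, u3] at b
  rw [t1, t2, t3, c1] at a
  have c2' : (z / 4) ^ (1 / 2 : ℂ) = z ^ (1 / 2 : ℂ) / 2 := by rw [← c2]; ring
  rw [c2'] at a
  have : 2 * twistTheta (1 / z) = 2 * (z ^ (1 / 2 : ℂ) * twistTheta z) := by
    rw [mul_left_comm, a, b]
    field_simp
    ring
  exact mul_left_cancel₀ two_ne_zero this

theorem re_ofReal_mul_pos {w : ℂ} (hw : 0 < w.re) {x : ℝ} (hx : 0 < x) : 0 < (x * w).re := by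
  rw [Complex.re_ofReal_mul]; positivity

theorem continuousOn_twistTheta_ray {w : ℂ} (hw : 0 < w.re) :
    ContinuousOn (fun x : ℝ => twistTheta (x * w)) (Ioi 0) :=
  continuousOn_twistTheta.comp (by fun_prop) fun _ hx => re_ofReal_mul_pos hw hx

/-- Inversion on the ray through `w` with `|w| = 1`. Since `1/w` is the conjugate of `w`, the conjugate of
`Θ` keeps the argument on the same ray. -/
theorem twistTheta_inv_mul {w : ℂ} (hw : 0 < w.re) (hw1 : ‖w‖ = 1) {x : ℝ} (hx : 0 < x) :
    twistTheta ((x⁻¹ : ℝ) * w) = (x * (starRingEnd ℂ) w) ^ (1 / 2 : ℂ) *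
      (starRingEnd ℂ) (twistTheta (x * w)) := by
  have hwc : (starRingEnd ℂ) w = w⁻¹ := by
    rw [Complex.inv_def, Complex.normSq_eq_norm_sq, hw1]; simp
  have h := twistTheta_one_div
    (z := x * (starRingEnd ℂ) w) (re_ofReal_mul_pos (by simpa using hw) hx)
  have e : (1 / (x * (starRingEnd ℂ) w) : ℂ) = ((x⁻¹ : ℝ) : ℂ) * w := by
    rw [hwc, one_div, mul_inv, inv_inv]; push_cast; rfl
  rw [e] at h
  rw [h, ← twistTheta_conj]
  simp

theorem norm_twistTheta_inv_mul {w : ℂ} (hw : 0 < w.re) (hw1 : ‖w‖ = 1) {x : ℝ} (hx : 0 < x) :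
    ‖twistTheta ((x⁻¹ : ℝ) * w)‖ = √x * ‖twistTheta (x * w)‖ := by
  rw [twistTheta_inv_mul hw hw1 hx, norm_mul, Complex.norm_conj]
  congr 1
  rw [show (1 / 2 : ℂ) =
    ((1 / 2 : ℝ) : ℂ) by push_cast; ring, Complex.norm_cpow_real, norm_mul, Complex.norm_conj, hw1,
    Complex.norm_real, Real.norm_of_nonneg hx.le, mul_one, sqrt_eq_rpow]

theorem exists_twistTheta_ray_le {w : ℂ} (hw : 0 < w.re) : ∃ C : ℝ, 0 < C ∧ ∀ x : ℝ, 1 ≤ x →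
    ‖twistTheta (x * w)‖ ≤ C * exp (-(π / 4 * w.re) * x) := by
  refine ⟨2 / (1 - exp (-(π / 4 * w.re))), ?_, fun x hx => ?_⟩
  · have : exp (-(π / 4 * w.re)) < 1 := by
      rw [Real.exp_lt_one_iff]
      have : 0 < π / 4 * w.re := by positivity
      linarith
    exact div_pos two_pos (by linarith)
  · refine (norm_twistTheta_le hw ?_).trans (le_of_eq ?_)
    · rw [Complex.re_ofReal_mul]; nlinarith
    · rw [Complex.re_ofReal_mul]; ring_nf

theorem isBigO_twistTheta_ray_atTop {w : ℂ} (hw : 0 < w.re) :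
    (fun x : ℝ => twistTheta (x * w)) =O[atTop] fun x => exp (-(π / 4 * w.re) * x) := by
  obtain ⟨C, _, h⟩ := exists_twistTheta_ray_le hw
  refine Asymptotics.IsBigO.of_bound C ((eventually_ge_atTop 1).mono fun x hx => ?_)
  rw [Real.norm_of_nonneg (Real.exp_pos _).le]
  exact h x hx

theorem isBigO_twistTheta_ray_zero {w : ℂ} (hw : 0 < w.re) (hw1 : ‖w‖ = 1) (b : ℝ) :
    (fun x : ℝ => twistTheta (x * w)) =O[𝓝[>] 0] fun x => x ^ (-b) := by
  have hc : 0 < π / 4 * w.re := by positivity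
  have h1 : (fun x : ℝ => twistTheta ((x⁻¹ : ℝ) * w)) =O[atTop] fun x => x ^ b := by
    have h2 : (fun x : ℝ => twistTheta ((x⁻¹ : ℝ) * w)) =O[atTop] fun x =>
      x ^ (1 / 2 : ℝ) * x ^ (b - 1 / 2) := by
      have h3 : (fun x : ℝ => x ^ (1 / 2 : ℝ) * ‖twistTheta (x * w)‖) =O[atTop] fun x =>
        x ^ (1 / 2 : ℝ) * x ^ (b - 1 / 2) :=
        (Asymptotics.isBigO_refl _ _).mul ((isBigO_twistTheta_ray_atTop hw).norm_left.trans
          (isLittleO_exp_neg_mul_rpow_atTop hc _).isBigO)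
      refine (Asymptotics.IsBigO.of_bound 1 ((eventually_gt_atTop 0).mono fun x hx => ?_)).trans h3
      rw [norm_twistTheta_inv_mul hw hw1 hx, sqrt_eq_rpow, one_mul]
      exact le_abs_self _
    refine h2.trans (Asymptotics.IsBigO.of_bound 1 ((eventually_gt_atTop 0).mono fun x hx => ?_))
    rw [← rpow_add hx]; simp
  have h2 := h1.comp_tendsto tendsto_inv_nhdsGT_zero
  refine (h2.congr' ?_ ?_)
  · exact Eventually.of_forall fun x => by simp
  · filter_upwards [self_mem_nhdsWithin] with x hx
    simp only [Function.comp]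
    rw [inv_rpow (le_of_lt hx), rpow_neg (le_of_lt hx)]

theorem mellinConvergent_twistTheta_ray {w : ℂ} (hw : 0 < w.re) (hw1 : ‖w‖ = 1) (s : ℂ) :
    MellinConvergent (fun x : ℝ => twistTheta (x * w)) s :=
  mellinConvergent_of_isBigO_rpow_exp (b := s.re - 1) (show 0 < π / 4 * w.re by positivity)
    ((continuousOn_twistTheta_ray hw).locallyIntegrableOn measurableSet_Ioi)
    (isBigO_twistTheta_ray_atTop hw) (isBigO_twistTheta_ray_zero hw hw1 _) (by linarith)

theorem differentiable_mellin_twistTheta_ray {w : ℂ} (hw : 0 < w.re) (hw1 : ‖w‖ = 1) :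
    Differentiable ℂ (mellin fun x : ℝ => twistTheta (x * w)) := fun s =>
  mellin_differentiableAt_of_isBigO_rpow_exp (b := s.re - 1) (show 0 < π / 4 * w.re by positivity)
    ((continuousOn_twistTheta_ray hw).locallyIntegrableOn measurableSet_Ioi)
    (isBigO_twistTheta_ray_atTop hw) (isBigO_twistTheta_ray_zero hw hw1 _) (by linarith)

/-- The Dirichlet series of the coefficients is the zeta function times a Dirichlet polynomial. -/
theorem hasSum_thetaCoeff_cpow {s : ℂ} (hs : 1 < s.re) :
    HasSum (fun n : ℕ => 2 ^ s * (thetaCoeff n * (1 / (n : ℂ) ^ s)))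
      ((3 - 2 ^ s - 2 * 2 ^ (-s)) * riemannZeta s) := by
  have hs0 : s ≠ 0 := fun h => by simp [h] at hs; linarith
  have h1 : HasSum (fun n : ℕ => 1 / (n : ℂ) ^ s) (riemannZeta s) := by
    rw [zeta_eq_tsum_one_div_nat_cpow hs]
    exact (Complex.summable_one_div_nat_cpow.2 hs).hasSum
  have hd : ∀ m : ℕ, 0 < m → HasSum (fun n : ℕ => if m ∣ n then 1 / (n : ℂ) ^ s else 0)
      ((m : ℂ) ^ (-s) * riemannZeta s) := by
    intro m hm
    have inj : Function.Injective (fun n : ℕ => m * n) := fun a b h =>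
      Nat.eq_of_mul_eq_mul_left hm h
    rw [← inj.hasSum_iff]
    · refine (h1.mul_left ((m:ℂ) ^ (-s))).congr_fun fun n => ?_
      simp only [Function.comp, dvd_mul_right, if_true]
      rw [Nat.cast_mul, Complex.natCast_mul_natCast_cpow, Complex.cpow_neg]
      field_simp
    · intro n hn
      rw [if_neg]
      rintro ⟨k, rfl⟩
      exact hn ⟨k, rfl⟩
  have h2 := hd 2 (by norm_num)
  have h4 := hd 4 (by norm_num)
  have key := (((h2.mul_left 3).sub h1).sub (h4.mul_left 2)).mul_left (2 ^ s)
  have h20 : (2:ℂ) ^ s ≠ 0 := by rw [Ne, Complex.cpow_eq_zero_iff]; simp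
  have e4 : (4:ℂ) ^ (-s) = 2 ^ (-s) * 2 ^ (-s) := by
    have := Complex.natCast_mul_natCast_cpow 2 2 (-s)
    push_cast at this
    rw [← this]; norm_num
  have hfun : (fun n : ℕ => 2 ^ s * (thetaCoeff n * (1 / (n : ℂ) ^ s))) = fun n : ℕ =>
      2 ^ s * ((3 * if 2 ∣ n then 1 / (n : ℂ) ^ s else 0) - 1 /
        (n : ℂ) ^ s - 2 * if 4 ∣ n then 1 / (n : ℂ) ^ s else 0) := by
    ext n
    simp only [thetaCoeff]
    split_ifs <;> ring
  have hval : (3 - 2 ^ s - 2 * 2 ^ (-s)) * riemannZeta s =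
    2 ^ s * (3 * (((2:ℕ):ℂ) ^ (-s) * riemannZeta s) -
      riemannZeta s - 2 * (((4:ℕ):ℂ) ^ (-s) * riemannZeta s)) := by
    push_cast
    rw [e4, Complex.cpow_neg]
    field_simp
  rw [hfun, hval]
  exact key

/-- Termwise Mellin transform of `Θ` along a ray, in the region of absolute convergence. -/
theorem hasSum_mellin_twistTheta_ray {w : ℂ} (hw : 0 < w.re) {u : ℂ} (hu : 1 / 2 < u.re) :
    HasSum (fun n : ℕ => thetaCoeff n * ((1 / (π / 4 * n ^ 2 * w)) ^ u * Complex.Gamma u))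
      (mellin (fun x : ℝ => twistTheta (x * w)) u) := by
  have hu0 : 0 < u.re := by linarith
  have hre : ∀ n : ℕ, 0 < n → 0 < (π / 4 * n ^ 2 * w : ℂ).re := by
    intro n hn
    have hn' : (0:ℝ) < n := by exact_mod_cast hn
    rw [show (π / 4 * n ^ 2 * w : ℂ) = ((π / 4 * n ^ 2 : ℝ) : ℂ) * w by push_cast; ring]
    exact re_ofReal_mul_pos hw (by positivity)
  set F : ℕ → ℝ → ℂ := fun n x =>
    thetaCoeff n * ((x:ℂ) ^ (u - 1) * Complex.exp (-((π / 4 * n ^ 2 * w) * x))) with hF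
  have hnorm : ∀ n (x : ℝ), 0 < x → ‖F n x‖ =
    ‖thetaCoeff n‖ * (x ^ (u.re - 1) * exp (-(π / 4 * n ^ 2 * w.re * x))) := by
    intro n x hx
    simp only [hF]
    rw [norm_mul, norm_mul, Complex.norm_cpow_eq_rpow_re_of_pos hx, Complex.norm_exp,
      show (-((π / 4 * n ^ 2 * w) * x) : ℂ) =
        ((-(π / 4 * n ^ 2 * x) : ℝ) : ℂ) * w by push_cast; ring, Complex.re_ofReal_mul,
      Complex.sub_re, Complex.one_re]
    ring_nf
  have hmeas : ∀ n, AEStronglyMeasurable (F n) (volume.restrict (Ioi 0)) := by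
    intro n
    refine ContinuousOn.aestronglyMeasurable (fun t ht =>
      ContinuousAt.continuousWithinAt ?_) measurableSet_Ioi
    refine ContinuousAt.mul (by fun_prop) (ContinuousAt.mul ?_ (by fun_prop))
    exact Complex.continuousAt_ofReal_cpow_const _ _ (Or.inr (ne_of_gt ht))
  have hint : ∀ n, Integrable (F n) (volume.restrict (Ioi 0)) := by
    intro n
    rcases Nat.eq_zero_or_pos n with rfl | hn
    · simp only [hF, thetaCoeff_zero, zero_mul]; exact integrable_zero _ _ _
    have hn' : (0:ℝ) < n := by exact_mod_cast hn
    refine (integrable_norm_iff (hmeas n)).1 (IntegrableOn.congr_fun ?_ (fun x hx =>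
      (hnorm n x hx).symm) measurableSet_Ioi)
    refine Integrable.const_mul ?_ _
    have := integrableOn_rpow_mul_exp_neg_mul_rpow (s := u.re - 1) (by linarith) (one_pos : (0:ℝ) <
      1)
      (show 0 < π / 4 * n ^ 2 * w.re by positivity)
    simpa [neg_mul, IntegrableOn] using this
  have hsum : Summable fun n => ∫ x in Ioi 0, ‖F n x‖ := by
    have hv : ∀ n : ℕ, ∫ x in Ioi 0, ‖F n x‖ ≤
      2 * ((4 / (π * w.re)) ^ u.re * Real.Gamma u.re) * (1 / (n:ℝ) ^ (2 * u.re)) := by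
      intro n
      rcases Nat.eq_zero_or_pos n with rfl | hn
      · simp only [hF, thetaCoeff_zero, zero_mul, norm_zero, integral_zero]
        have := Real.Gamma_pos_of_pos hu0
        positivity
      have hn' : (0:ℝ) < n := by exact_mod_cast hn
      rw [setIntegral_congr_fun measurableSet_Ioi (fun x hx => hnorm n x hx), integral_const_mul,
        Real.integral_rpow_mul_exp_neg_mul_Ioi hu0 (by positivity)]
      have hG := Real.Gamma_pos_of_pos hu0
      rw [show 1 / (π / 4 * (n:ℝ) ^ 2 * w.re) = 4 / (π * w.re) * (1 / n ^ 2) by field_simp,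
        mul_rpow (by positivity) (by positivity), div_rpow zero_le_one (by positivity), one_rpow,
        ← rpow_natCast, ← rpow_mul hn'.le]
      push_cast
      calc _ ≤ 2 * ((4 / (π * w.re)) ^ u.re * (1 / (n:ℝ) ^ (2 * u.re)) * Real.Gamma u.re) := by
            gcongr; exact norm_thetaCoeff_le n
        _ = _ := by ring
    refine Summable.of_nonneg_of_le (fun n => integral_nonneg fun x => norm_nonneg _) hv ?_
    exact (Real.summable_one_div_nat_rpow.2 (by linarith)).mul_left _
  have key := hasSum_integral_of_summable_integral_norm hint hsum
  have e1 : ∀ n, ∫ x in Ioi 0, F n x =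
    thetaCoeff n * ((1 / (π / 4 * n ^ 2 * w)) ^ u * Complex.Gamma u) := by
    intro n
    rcases Nat.eq_zero_or_pos n with rfl | hn
    · simp [hF, thetaCoeff_zero]
    simp only [hF]
    rw [integral_const_mul, integral_cpow_mul_cexp_neg_mul_Ioi_of_re_pos hu0 (hre n hn)]
  simp only [e1] at key
  have hm : mellin (fun x : ℝ => twistTheta (x * w)) u = ∫ x in Ioi 0, ∑' n, F n x := by
    rw [mellin]
    refine setIntegral_congr_fun measurableSet_Ioi fun x hx => ?_
    simp only [hF, smul_eq_mul]
    rw [twistTheta, ← tsum_mul_left]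
    refine tsum_congr fun n => ?_
    ring_nf
  rw [hm]
  exact key

theorem mellin_twistTheta_ray_of_one_lt_re {w : ℂ} (hw : 0 < w.re) {s : ℂ} (hs : 1 < s.re) :
    mellin (fun x : ℝ => twistTheta (x * w)) (s / 2) =
      w⁻¹ ^ (s / 2) * ((3 - 2 ^ s - 2 * 2 ^ (-s)) * completedRiemannZeta s) := by
  have hs0 : s ≠ 0 := fun h => by simp [h] at hs; linarith
  have hw0 : w ≠ 0 := fun h => by simp [h] at hw
  have hu : 1 / 2 < (s / 2).re := by rw [Complex.div_ofNat_re]; linarith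
  have hG : Complex.Gammaℝ s ≠ 0 := Complex.Gammaℝ_ne_zero_of_re_pos (by linarith)
  have h1 := hasSum_mellin_twistTheta_ray hw hu
  have h2 := (hasSum_thetaCoeff_cpow hs).mul_left (w⁻¹ ^ (s / 2) * Complex.Gammaℝ s)
  have e : ∀ n : ℕ, w⁻¹ ^ (s / 2) * Complex.Gammaℝ s *
    (2 ^ s * (thetaCoeff n * (1 / (n : ℂ) ^ s))) =
      thetaCoeff n * ((1 / (π / 4 * n ^ 2 * w)) ^ (s / 2) * Complex.Gamma (s / 2)) := by
    intro n
    rcases Nat.eq_zero_or_pos n with rfl | hn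
    · simp [thetaCoeff_zero]
    have hn' : (0:ℝ) < n := by exact_mod_cast hn
    have hr : 0 < 4 / (π * n ^ 2) := by positivity
    rw [show (1 / (π / 4 * n ^ 2 * w) : ℂ) =
      ((4 / (π * n ^ 2) : ℝ) : ℂ) * w⁻¹ by push_cast; field_simp,
      Complex.ofReal_mul_cpow_of_pos hr (inv_ne_zero hw0), Complex.Gammaℝ_def, one_div,
        ← Complex.cpow_neg]
    have e2 : ((4 / (π * n ^ 2) : ℝ) : ℂ) ^ (s / 2) =
      2 ^ s * (π : ℂ) ^ (-s / 2) * (n:ℂ) ^ (-s) := by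
      rw [Complex.cpow_def_of_ne_zero (Complex.ofReal_ne_zero.2 hr.ne'),
        Complex.cpow_def_of_ne_zero two_ne_zero,
        Complex.cpow_def_of_ne_zero (Complex.ofReal_ne_zero.2 pi_ne_zero),
        Complex.cpow_def_of_ne_zero (Nat.cast_ne_zero.2 hn.ne'), ← Complex.exp_add,
          ← Complex.exp_add,
        ← Complex.ofReal_log hr.le, ← Complex.ofReal_log pi_pos.le, ← Complex.natCast_log,
        show (2:ℂ) = ((2:ℝ):ℂ) by push_cast; rfl, ← Complex.ofReal_log two_pos.le,
        Real.log_div (by norm_num) (by positivity), Real.log_mul (by positivity) (by positivity),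
          Real.log_pow,
        show (4:ℝ) = 2 ^ 2 by norm_num, Real.log_pow]
      congr 1
      push_cast
      ring
    rw [e2]
    ring
  simp only [e] at h2
  rw [h1.unique h2, riemannZeta_def_of_ne_zero hs0]
  field_simp

/-- The Mellin transform of `Θ` along a ray. The right side has no poles at `0` and `1` after
multiplication by the Dirichlet polynomial, but these points are excluded, being
poles of the completed zeta function. -/
theorem mellin_twistTheta_ray {w : ℂ} (hw : 0 < w.re) (hw1 : ‖w‖ = 1) {s : ℂ}
    (hs0 : s ≠ 0) (hs1 : s ≠ 1) :
    mellin (fun x : ℝ => twistTheta (x * w)) (s / 2) =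
      w⁻¹ ^ (s / 2) * ((3 - 2 ^ s - 2 * 2 ^ (-s)) * completedRiemannZeta s) := by
  have hw0 : w⁻¹ ≠ 0 := inv_ne_zero fun h => by simp [h] at hw
  set U : Set ℂ := ({0, 1} : Set ℂ)ᶜ with hU
  have hUo : IsOpen U := (Set.toFinite _).isClosed.isOpen_compl
  have hUc : IsPreconnected U :=
    (Set.Countable.isConnected_compl_of_one_lt_rank (by simp) (Set.toFinite _).countable).2
  have h1 : DifferentiableOn ℂ (fun s => mellin (fun x : ℝ => twistTheta (x * w)) (s / 2)) U :=
    fun s _ =>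
    ((differentiable_mellin_twistTheta_ray hw hw1 _).comp s (by fun_prop)).differentiableWithinAt
  have h2 : DifferentiableOn ℂ (fun s =>
    w⁻¹ ^ (s / 2) * ((3 - 2 ^ s - 2 * 2 ^ (-s)) * completedRiemannZeta s)) U := by
    intro s hs
    simp only [hU, mem_compl_iff, mem_insert_iff, mem_singleton_iff, not_or] at hs
    refine DifferentiableAt.differentiableWithinAt ?_
    refine DifferentiableAt.mul ?_ (DifferentiableAt.mul ?_
      (differentiableAt_completedZeta hs.1 hs.2))
    · exact DifferentiableAt.const_cpow (by fun_prop) (Or.inl hw0)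
    · refine ((differentiableAt_const _).sub (DifferentiableAt.const_cpow (by fun_prop)
      (Or.inl two_ne_zero))).sub
        ((differentiableAt_const _).mul (DifferentiableAt.const_cpow (by fun_prop)
          (Or.inl two_ne_zero)))
  have h2U : (2:ℂ) ∈ U := by simp [hU]
  have hev : (fun s => mellin (fun x : ℝ => twistTheta (x * w)) (s / 2)) =ᶠ[𝓝 2]
      fun s => w⁻¹ ^ (s / 2) * ((3 - 2 ^ s - 2 * 2 ^ (-s)) * completedRiemannZeta s) := by
    filter_upwards [(isOpen_lt continuous_const Complex.continuous_re).mem_nhds (show (1:ℝ) <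
      (2:ℂ).re by simp)] with s hs
    exact mellin_twistTheta_ray_of_one_lt_re hw hs
  exact (h1.analyticOnNhd hUo).eqOn_of_preconnected_of_eventuallyEq
    (h2.analyticOnNhd hUo) hUc h2U hev
    (show s ∈ U by simp [hU, hs0, hs1])

/-! ### The square of the Mellin transform as a Fourier transform -/

theorem image_exp_univ : Real.exp '' univ = Ioi 0 := by rw [Set.image_univ, Real.range_exp]

theorem setIntegral_Ioi_eq_integral_exp (g : ℝ → ℂ) : ∫ x in Ioi 0, g x =
    ∫ v : ℝ, (exp v : ℂ) * g (exp v) := by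
  rw [← image_exp_univ, integral_image_eq_integral_abs_deriv_smul MeasurableSet.univ
    (fun x _ => (Real.hasDerivAt_exp x).hasDerivWithinAt) Real.exp_injective.injOn]
  simp [abs_of_pos (Real.exp_pos _)]

theorem integrableOn_Ioi_iff_exp (g : ℝ → ℂ) :
    IntegrableOn g (Ioi 0) ↔ Integrable (fun v : ℝ => (exp v : ℂ) * g (exp v)) := by
  rw [← image_exp_univ, integrableOn_image_iff_integrableOn_abs_deriv_smul MeasurableSet.univ
    (fun x _ => (Real.hasDerivAt_exp x).hasDerivWithinAt) Real.exp_injective.injOn]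
  simp [abs_of_pos (Real.exp_pos _)]

/-- The function `v ↦ e^{v/4} Θ(e^v w)`: the restriction of `Θ` to the ray through `w` in logarithmic
coordinates, normalized so that its Fourier transform is the Mellin transform on the critical line. -/
noncomputable def rayTheta (w : ℂ) (v : ℝ) : ℂ := twistTheta (exp v * w) * exp (v / 4)

theorem rayTheta_mul_cexp (w : ℂ) (t v : ℝ) : rayTheta w v * Complex.exp (Complex.I * t * v / 2) =
    (exp v : ℂ) * ((exp v : ℂ) ^ ((1 / 2 + Complex.I * t) / 2 - 1) * twistTheta (exp v * w)) := by
  rw [rayTheta, Complex.ofReal_exp, Complex.ofReal_exp,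
    Complex.cpow_def_of_ne_zero (Complex.exp_ne_zero _),
    ← Complex.ofReal_exp, ← Complex.ofReal_log (Real.exp_pos _).le, Real.log_exp,
      Complex.ofReal_exp, mul_assoc,
    ← Complex.exp_add, ← mul_assoc, ← Complex.exp_add, mul_comm]
  congr 2
  push_cast
  ring

theorem integrable_rayTheta_mul_cexp {w : ℂ} (hw : 0 < w.re) (hw1 : ‖w‖ = 1) (t : ℝ) :
    Integrable fun v => rayTheta w v * Complex.exp (Complex.I * t * v / 2) := by
  simp_rw [rayTheta_mul_cexp]
  exact (integrableOn_Ioi_iff_exp _).1 (mellinConvergent_twistTheta_ray hw hw1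
    ((1 / 2 + Complex.I * t) / 2))

theorem integral_rayTheta_mul_cexp (w : ℂ) (t : ℝ) :
    ∫ v, rayTheta w v * Complex.exp (Complex.I * t * v / 2) =
      mellin (fun x : ℝ => twistTheta (x * w)) ((1 / 2 + Complex.I * t) / 2) := by
  simp_rw [rayTheta_mul_cexp]
  rw [← setIntegral_Ioi_eq_integral_exp (fun x : ℝ =>
    (x : ℂ) ^ ((1 / 2 + Complex.I * t) / 2 - 1) * twistTheta (x * w))]
  rfl

theorem rayTheta_neg {w : ℂ} (hw : 0 < w.re) (hw1 : ‖w‖ = 1) (v : ℝ) :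
    rayTheta w (-v) = ((starRingEnd ℂ) w) ^ (1 / 2 : ℂ) * (starRingEnd ℂ) (rayTheta w v) := by
  have hw0 : (starRingEnd ℂ) w ≠ 0 := fun h => by
    rw [map_eq_zero] at h
    simp [h] at hw
  have h := twistTheta_inv_mul hw hw1 (Real.exp_pos v)
  rw [← Real.exp_neg] at h
  rw [rayTheta, h, Complex.ofReal_mul_cpow_of_pos (Real.exp_pos v) hw0, rayTheta, map_mul,
    Complex.conj_ofReal]
  have e : ((exp v : ℝ) : ℂ) ^ (1 / 2 : ℂ) * (exp (-v / 4) : ℝ) = (exp (v / 4) : ℝ) := by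
    rw [show (1 / 2 : ℂ) =
      ((1 / 2 : ℝ) :
      ℂ) by push_cast; ring, ← Complex.ofReal_cpow (Real.exp_pos _).le, ← Complex.ofReal_mul,
      ← Real.exp_mul, ← Real.exp_add]
    ring_nf
  rw [← e]
  ring

/-- The self-convolution of `rayTheta w`. -/
noncomputable def rayConv (w : ℂ) (x : ℝ) : ℂ := ∫ u, rayTheta w u * rayTheta w (x - u)

open scoped Convolution in
theorem rayConv_mul_cexp_eq_convolution (w : ℂ) (t : ℝ) :
    (fun x : ℝ => rayConv w x * Complex.exp (Complex.I * t * x / 2)) =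
    MeasureTheory.convolution (fun v : ℝ => rayTheta w v * Complex.exp (Complex.I * t * v / 2))
      (fun v : ℝ =>
        rayTheta w v * Complex.exp (Complex.I * t * v / 2))
        (ContinuousLinearMap.mul ℝ ℂ) volume := by
  ext x
  rw [MeasureTheory.convolution, rayConv, ← integral_mul_const]
  refine integral_congr_ae (ae_of_all _ fun u => ?_)
  simp only [ContinuousLinearMap.mul_apply']
  rw [mul_mul_mul_comm, ← Complex.exp_add]
  congr 2
  push_cast
  ring

theorem integrable_rayConv_mul_cexp {w : ℂ} (hw : 0 < w.re) (hw1 : ‖w‖ = 1) (t : ℝ) :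
    Integrable fun x : ℝ => rayConv w x * Complex.exp (Complex.I * t * x / 2) := by
  rw [rayConv_mul_cexp_eq_convolution]
  exact (integrable_rayTheta_mul_cexp hw hw1 t).integrable_convolution _
    (integrable_rayTheta_mul_cexp hw hw1 t)

theorem integrable_rayConv {w : ℂ} (hw : 0 < w.re) (hw1 : ‖w‖ = 1) : Integrable (rayConv w) := by
  simpa using integrable_rayConv_mul_cexp hw hw1 0

/-- The Fourier transform of the self-convolution is the square of the Mellin transform. -/
theorem integral_rayConv_mul_cexp {w : ℂ} (hw : 0 < w.re) (hw1 : ‖w‖ = 1) (t : ℝ) :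
    ∫ x : ℝ, rayConv w x * Complex.exp (Complex.I * t * x / 2) =
      (mellin (fun x : ℝ => twistTheta (x * w)) ((1 / 2 + Complex.I * t) / 2)) ^ 2 := by
  rw [rayConv_mul_cexp_eq_convolution,
    integral_convolution _ (integrable_rayTheta_mul_cexp hw hw1 t)
    (integrable_rayTheta_mul_cexp hw hw1 t), integral_rayTheta_mul_cexp,
      ContinuousLinearMap.mul_apply', sq]

theorem rayConv_neg {w : ℂ} (hw : 0 < w.re) (hw1 : ‖w‖ = 1) (x : ℝ) :
    rayConv w (-x) = (starRingEnd ℂ) w * (starRingEnd ℂ) (rayConv w x) := by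
  have hw0 : (starRingEnd ℂ) w ≠ 0 := fun h => by
    rw [map_eq_zero] at h
    simp [h] at hw
  rw [rayConv, ← integral_neg_eq_self, rayConv, ← integral_conj, ← integral_const_mul]
  refine integral_congr_ae (ae_of_all _ fun u => ?_)
  simp only
  rw [show -x - -u = -(x - u) by ring, rayTheta_neg hw hw1, rayTheta_neg hw hw1, map_mul]
  have : ((starRingEnd ℂ) w) ^ (1 / 2 : ℂ) * ((starRingEnd ℂ) w) ^
    (1 / 2 : ℂ) = (starRingEnd ℂ) w := by
    rw [← Complex.cpow_add _ _ hw0]; norm_num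
  rw [mul_mul_mul_comm, this]

/-- By `rayConv_neg` the integrals over the two half lines have equal modulus, so that the half line
`x > 0` suffices. -/
theorem norm_mellin_sq_le {w : ℂ} (hw : 0 < w.re) (hw1 : ‖w‖ = 1) (t : ℝ) :
    ‖mellin (fun x : ℝ => twistTheta (x * w)) ((1 / 2 + Complex.I * t) / 2)‖ ^ 2 ≤
      2 * ‖∫ x in Ioi (0:ℝ), rayConv w x * Complex.exp (Complex.I * t * x / 2)‖ := by
  have hi := integrable_rayConv_mul_cexp hw hw1 t
  rw [← norm_pow, ← integral_rayConv_mul_cexp hw hw1 t, ← intervalIntegral.integral_Iic_add_Ioi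
    (b := 0) hi.integrableOn hi.integrableOn,
    two_mul]
  refine (norm_add_le _ _).trans (add_le_add (le_of_eq ?_) le_rfl)
  rw [← neg_zero, ← integral_comp_neg_Ioi, neg_zero]
  have : ∀ x : ℝ, rayConv w (-x) * Complex.exp (Complex.I * t * ((-x : ℝ) : ℂ) / 2) =
      (starRingEnd ℂ) w * (starRingEnd ℂ) (rayConv w x * Complex.exp (Complex.I * t * x / 2)) := by
    intro x
    rw [rayConv_neg hw hw1, map_mul, ← Complex.exp_conj, mul_assoc]
    congr 3
    simp [map_ofNat]
  simp_rw [this]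
  rw [integral_const_mul, integral_conj, norm_mul, Complex.norm_conj, Complex.norm_conj, hw1,
    one_mul]

/-! ### The Bessel kernel as a Laplace transform -/

/-- The kernel `∫_ℝ exp(-ρ w cosh v) dv`, which is the Bessel function `2 K₀(ρ w)`. -/
noncomputable def besselKer (w : ℂ) (ρ : ℝ) : ℂ := ∫ v : ℝ, Complex.exp (-(ρ * w * cosh v))

/-- The weight `W(b) = 2 b^{-1/2} (2w + b)^{-1/2}`, written with the constant `π` that the Gaussian
integral produces, whose Laplace transform is `exp(ρ w)` times the kernel `besselKer w ρ`. -/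
noncomputable def besselWeight (w : ℂ) (b : ℝ) : ℂ :=
  ((2 / √π * b ^ (-(1 / 2) : ℝ) : ℝ) : ℂ) * (π / (2 * w + b)) ^ (1 / 2 : ℂ)

/-- The substitution `v = 2 arsinh x`, under which `cosh v = 1 + 2x²`. -/
theorem integral_eq_integral_two_arsinh (g : ℝ → ℂ) :
    ∫ v, g v = ∫ x : ℝ, ((2 * (√(1 + x ^ 2))⁻¹ : ℝ) : ℂ) * g (2 * arsinh x) := by
  have himg : (fun x : ℝ => 2 * arsinh x) '' univ = univ := by
    rw [Set.image_univ, Set.range_eq_univ]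
    intro v
    exact ⟨sinh (v / 2), by simp only [arsinh_sinh]; ring⟩
  rw [← setIntegral_univ, ← himg, integral_image_eq_integral_abs_deriv_smul MeasurableSet.univ
    (fun x _ => ((Real.hasDerivAt_arsinh x).const_mul 2).hasDerivWithinAt)
    (fun x _ y _ h => Real.arsinh_injective (by simpa using h)), setIntegral_univ]
  refine integral_congr_ae (ae_of_all _ fun x => ?_)
  simp only
  rw [abs_of_nonneg (by positivity), Complex.real_smul]

theorem cosh_two_mul_arsinh (x : ℝ) : cosh (2 * arsinh x) = 1 + 2 * x ^ 2 := by
  rw [Real.cosh_two_mul, Real.cosh_sq, Real.sinh_arsinh]; ring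

theorem besselKer_eq_integral_sq (w : ℂ) (ρ : ℝ) : besselKer w ρ =
    Complex.exp (-(ρ * w)) * ∫ x : ℝ, ((2 * (√(1 + x ^ 2))⁻¹ : ℝ) : ℂ) *
      Complex.exp (-(2 * ρ * w * x ^ 2)) := by
  rw [besselKer, integral_eq_integral_two_arsinh, ← integral_const_mul]
  refine integral_congr_ae (ae_of_all _ fun x => ?_)
  simp only
  rw [cosh_two_mul_arsinh, mul_left_comm, ← Complex.exp_add]
  congr 2
  push_cast
  ring

theorem integrable_besselWeight_kernel {w : ℂ} (hw : 0 < w.re) {ρ : ℝ} (hρ : 0 < ρ) :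
    Integrable (fun p : ℝ × ℝ =>
      ((p.1 ^ (-(1 / 2) : ℝ) : ℝ) : ℂ) * Complex.exp (-(ρ * p.1 * (1 + p.2 ^ 2)))
      * Complex.exp (-(2 * ρ * w * p.2 ^ 2))) ((volume.restrict (Ioi 0)).prod volume) := by
  have h1 : Integrable (fun b : ℝ =>
    b ^ (-(1 / 2) : ℝ) * exp (-ρ * b)) (volume.restrict (Ioi 0)) := by
    have := integrableOn_rpow_mul_exp_neg_mul_rpow (s := -(1/2)) (p := 1)
      (b := ρ) (by norm_num) (one_pos) hρ
    simpa [IntegrableOn] using this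
  have h2 : Integrable (fun x : ℝ => exp (-(2 * ρ * w.re) * x ^ 2)) :=
    integrable_exp_neg_mul_sq (by positivity)
  refine (h1.mul_prod h2).mono' ?_ ?_
  · refine (Measurable.aestronglyMeasurable ?_)
    fun_prop
  · have hae : ∀ᵐ p : ℝ × ℝ ∂((volume.restrict (Ioi 0)).prod volume), p.1 ∈ Ioi (0:ℝ) :=
      Measure.quasiMeasurePreserving_fst.ae (ae_restrict_mem measurableSet_Ioi)
    filter_upwards [hae] with p hp
    have hp' : 0 < p.1 := hp
    rw [norm_mul, norm_mul, Complex.norm_real, Real.norm_of_nonneg (by positivity),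
      Complex.norm_exp, Complex.norm_exp]
    have e1 : (-(ρ * p.1 * (1 + p.2 ^ 2)) : ℂ).re = -(ρ * p.1 * (1 + p.2 ^ 2)) := by
      rw [show (-(ρ * p.1 * (1 + p.2 ^ 2)) : ℂ) =
        ((-(ρ * p.1 * (1 + p.2 ^ 2)) : ℝ) : ℂ) by push_cast; ring, Complex.ofReal_re]
    have e2 : (-(2 * ρ * w * p.2 ^ 2) : ℂ).re = -(2 * ρ * w.re) * p.2 ^ 2 := by
      rw [show (-(2 * ρ * w * p.2 ^ 2) : ℂ) =
        ((-(2 * ρ * p.2 ^ 2) : ℝ) : ℂ) * w by push_cast; ring, Complex.re_ofReal_mul]; ring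
    rw [e1, e2]
    refine mul_le_mul_of_nonneg_right (mul_le_mul_of_nonneg_left (Real.exp_le_exp.2 ?_)
      (by positivity)) (Real.exp_pos _).le
    have : 0 ≤ ρ * p.1 * p.2 ^ 2 := by positivity
    linarith

/-- The kernel as `exp(-ρ w)` times a Laplace transform of an integrable weight. Both sides are iterated
integrals of one absolutely integrable function of `(b, x)`: the integral over `b` produces
`(1 + x²)^{-1/2}`, and the one over `x` is Gaussian. -/
theorem besselKer_eq_laplace {w : ℂ} (hw : 0 < w.re) {ρ : ℝ} (hρ : 0 < ρ) :
    besselKer w ρ = Complex.exp (-(ρ * w)) * ∫ b in Ioi (0:ℝ), besselWeight w b *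
      Complex.exp (-(ρ * b)) := by
  rw [besselKer_eq_integral_sq]
  congr 1
  have hsw := integral_integral_swap (μ := volume.restrict (Ioi (0:ℝ))) (ν := volume)
    (f := fun b x : ℝ => ((b ^ (-(1 / 2) : ℝ) : ℝ) : ℂ) * Complex.exp (-(ρ * b * (1 + x ^ 2)))
      * Complex.exp (-(2 * ρ * w * x ^ 2))) (integrable_besselWeight_kernel hw hρ)
  have hL : ∀ b ∈ Ioi (0:ℝ), (∫ x : ℝ, ((b ^ (-(1 / 2) : ℝ) : ℝ) :
    ℂ) * Complex.exp (-(ρ * b * (1 + x ^ 2)))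
      * Complex.exp (-(2 * ρ * w * x ^ 2))) =
        ((√π / 2 * ρ ^ (-(1 / 2) : ℝ) : ℝ) : ℂ) * (besselWeight w b * Complex.exp (-(ρ * b))) := by
    intro b hb
    have hb' : 0 < b := hb
    have e : ∀ x : ℝ, ((b ^ (-(1 / 2) : ℝ) : ℝ) : ℂ) * Complex.exp (-(ρ * b * (1 + x ^ 2)))
      * Complex.exp (-(2 * ρ * w * x ^ 2)) =
        ((b ^ (-(1 / 2) : ℝ) : ℝ) : ℂ) * Complex.exp (-(ρ * b)) *
        Complex.exp (-(ρ * (2 * w + b)) * x ^ 2) := by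
      intro x
      rw [mul_assoc _ (Complex.exp _), mul_assoc _ (Complex.exp _), ← Complex.exp_add,
        ← Complex.exp_add]
      congr 2
      ring
    simp_rw [e]
    have hz : 0 < (2 * w + b).re := by simp; positivity
    have hz' : 0 < (ρ * (2 * w + b)).re := by rw [Complex.re_ofReal_mul]; positivity
    rw [integral_const_mul, integral_gaussian_complex hz', besselWeight]
    have hz0 : (π / (2 * w + b) : ℂ) ≠ 0 :=
      div_ne_zero (by exact_mod_cast pi_pos.ne') fun h => by rw [h] at hz; simp at hz
    have e2 : (π / (ρ * (2 * w + b)) : ℂ) = ((ρ⁻¹ : ℝ) : ℂ) * (π / (2 * w + b)) := by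
      push_cast; rw [div_mul_eq_div_div_swap, inv_mul_eq_div]
    rw [e2, Complex.ofReal_mul_cpow_of_pos (by positivity) hz0]
    have e3 : ((ρ⁻¹ : ℝ) : ℂ) ^ (1 / 2 : ℂ) = ((ρ ^ (-(1 / 2) : ℝ) : ℝ) : ℂ) := by
      rw [show (1 / 2 : ℂ) =
        ((1 / 2 : ℝ) :
        ℂ) by push_cast; ring, ← Complex.ofReal_cpow (by positivity), Real.inv_rpow hρ.le,
        Real.rpow_neg hρ.le]
    rw [e3]
    have h4 : (√π : ℂ) ≠ 0 := by exact_mod_cast (sqrt_pos.2 pi_pos).ne'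
    push_cast
    field_simp
  have hR : ∀ x : ℝ, (∫ b in Ioi (0:ℝ), ((b ^ (-(1 / 2) : ℝ) : ℝ) :
    ℂ) * Complex.exp (-(ρ * b * (1 + x ^ 2)))
      * Complex.exp (-(2 * ρ * w * x ^ 2))) = ((√π / 2 * ρ ^ (-(1 / 2) : ℝ) : ℝ) : ℂ) *
        (((2 * (√(1 + x ^ 2))⁻¹ : ℝ) : ℂ) * Complex.exp (-(2 * ρ * w * x ^ 2))) := by
    intro x
    have h0 : 0 < ρ * (1 + x ^ 2) := by positivity
    have h5 : ∫ b in Ioi (0:ℝ), b ^ (-(1 / 2) : ℝ) * exp (-(ρ * (1 + x ^ 2) * b)) =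
      (ρ * (1 + x ^ 2))⁻¹ ^ (1 / 2 : ℝ) * √π := by
      have := Real.integral_rpow_mul_exp_neg_mul_Ioi (a := 1 / 2) (by norm_num) h0
      rw [Real.Gamma_one_half_eq, one_div (ρ * (1 + x ^ 2))] at this
      rw [← this]; norm_num
    rw [integral_mul_const]
    have h6 : ∫ b in Ioi (0:ℝ), ((b ^ (-(1 / 2) : ℝ) : ℝ) : ℂ) *
      Complex.exp (-(ρ * b * (1 + x ^ 2))) =
        (((ρ * (1 + x ^ 2))⁻¹ ^ (1 / 2 : ℝ) * √π : ℝ) : ℂ) := by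
      rw [← h5, ← integral_complex_ofReal]
      refine integral_congr_ae (ae_of_all _ fun b => ?_)
      push_cast
      ring_nf
    rw [h6, Real.inv_rpow h0.le, Real.mul_rpow hρ.le (by positivity), Real.rpow_neg hρ.le,
      ← sqrt_eq_rpow (1 + x ^ 2)]
    push_cast
    field_simp
  rw [setIntegral_congr_fun measurableSet_Ioi hL, integral_const_mul] at hsw
  simp_rw [hR] at hsw
  rw [integral_const_mul] at hsw
  refine (mul_left_cancel₀ ?_ hsw).symm
  rw [Complex.ofReal_ne_zero]
  positivity

theorem norm_besselWeight {w : ℂ} {b : ℝ} (hb : 0 < b) :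
    ‖besselWeight w b‖ = 2 * b ^ (-(1 / 2) : ℝ) * ‖2 * w + b‖ ^ (-(1 / 2) : ℝ) := by
  rw [besselWeight, norm_mul, Complex.norm_real, Real.norm_of_nonneg (by positivity),
    show (1 / 2 : ℂ) =
      ((1 / 2 : ℝ) : ℂ) by push_cast; ring, Complex.norm_cpow_real, norm_div, Complex.norm_real,
    Real.norm_of_nonneg pi_pos.le, Real.div_rpow pi_pos.le (norm_nonneg _), ← sqrt_eq_rpow π,
      Real.rpow_neg (norm_nonneg _)]
  have : √π ≠ 0 := (sqrt_pos.2 pi_pos).ne'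
  field_simp

/-! ### Expansion of the self-convolution in Bessel functions -/

theorem one_add_sq_div_two_le_cosh (v : ℝ) : 1 + v ^ 2 / 2 ≤ cosh v := by
  have h := Real.cosh_two_mul (v / 2)
  rw [show 2 * (v / 2) = v by ring, Real.cosh_sq] at h
  have h2 : (v / 2) ^ 2 ≤ sinh (v / 2) ^ 2 := by
    rw [sq_le_sq]
    rcases le_total 0 (v / 2) with h0 | h0
    · rw [abs_of_nonneg h0]; exact (Real.self_le_sinh_iff.2 h0).trans (le_abs_self _)
    · rw [abs_of_nonpos h0]; exact (neg_le_neg (Real.sinh_le_self_iff.2 h0)).trans (neg_le_abs _)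
  linarith

theorem exp_neg_mul_cosh_le {ρ : ℝ} (hρ : 0 < ρ) (v : ℝ) :
    exp (-(ρ * cosh v)) ≤ exp (-ρ) * exp (-(ρ / 2) * v ^ 2) := by
  rw [← Real.exp_add, Real.exp_le_exp]
  have := mul_le_mul_of_nonneg_left (one_add_sq_div_two_le_cosh v) hρ.le
  linarith

theorem integrable_exp_neg_mul_cosh {ρ : ℝ} (hρ : 0 < ρ) : Integrable fun v =>
    exp (-(ρ * cosh v)) := by
  refine ((integrable_exp_neg_mul_sq (show 0 < ρ / 2 by positivity)).const_mul (exp (-ρ))).mono'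
    (by fun_prop) (ae_of_all _ fun v => ?_)
  rw [Real.norm_of_nonneg (Real.exp_pos _).le]
  exact exp_neg_mul_cosh_le hρ v

theorem integral_exp_neg_mul_cosh_le {ρ : ℝ} (hρ : 0 < ρ) :
    ∫ v, exp (-(ρ * cosh v)) ≤ exp (-ρ) * √(π / (ρ / 2)) := by
  rw [← integral_gaussian, ← integral_const_mul]
  exact integral_mono (integrable_exp_neg_mul_cosh hρ)
    ((integrable_exp_neg_mul_sq (by positivity)).const_mul _)
    (exp_neg_mul_cosh_le hρ)

/-- Recentering at the point where `m² e^u = n² e^{x - u}`. -/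
theorem mul_exp_add_mul_exp_eq (A : ℝ) {m n : ℝ} (hm : 0 < m) (hn : 0 < n) (x v : ℝ) :
    A * (m ^ 2 * exp (v + (x / 2 + log (n / m))) + n ^ 2 * exp (x - (v + (x / 2 + log (n / m))))) =
      2 * A * (m * n) * exp (x / 2) * cosh v := by
  rw [show x - (v + (x / 2 + log (n / m))) =
    -v + (x / 2 + -log (n / m)) by ring, Real.exp_add, Real.exp_add, Real.exp_add, Real.exp_add,
    Real.exp_neg (log _), Real.exp_log (by positivity), Real.cosh_eq]
  field_simp

theorem integral_cexp_eq_besselKer (w : ℂ) (A : ℝ) {m n : ℝ} (hm : 0 < m) (hn : 0 < n) (x : ℝ) :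
    ∫ u : ℝ, Complex.exp (-(((A * (m ^ 2 * exp u + n ^ 2 * exp (x - u)) : ℝ) : ℂ) * w)) =
      besselKer w (2 * A * (m * n) * exp (x / 2)) := by
  rw [← integral_add_right_eq_self _ (x / 2 + log (n / m)), besselKer]
  refine integral_congr_ae (ae_of_all _ fun v => ?_)
  simp only
  rw [mul_exp_add_mul_exp_eq A hm hn]
  push_cast
  ring_nf

theorem integrable_exp_neg_pair {A : ℝ} (hA : 0 < A) {m n : ℝ} (hm : 0 < m) (hn : 0 < n) (x : ℝ) :
    Integrable fun u : ℝ => exp (-(A * (m ^ 2 * exp u + n ^ 2 * exp (x - u)))) := by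
  have h :=
    (integrable_exp_neg_mul_cosh
    (ρ := 2 * A * (m * n) * exp (x / 2)) (by positivity)).comp_sub_right (x / 2 + log (n / m))
  refine h.congr (ae_of_all _ fun u => ?_)
  simp only
  rw [← mul_exp_add_mul_exp_eq A hm hn, sub_add_cancel]

theorem integral_exp_neg_pair_le {A : ℝ} (hA : 0 < A) {m n : ℝ} (hm : 0 < m) (hn : 0 < n) (x : ℝ) :
    ∫ u : ℝ, exp (-(A * (m ^ 2 * exp u + n ^ 2 * exp (x - u)))) ≤
      exp (-(2 * A * (m * n) * exp (x / 2))) * √(π / (2 * A * (m * n) * exp (x / 2) / 2)) := by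
  rw [← integral_add_right_eq_self _ (x / 2 + log (n / m))]
  simp_rw [mul_exp_add_mul_exp_eq A hm hn]
  exact integral_exp_neg_mul_cosh_le (by positivity)

/-- The term of the double series `Θ(e^u w) Θ(e^{x-u} w)` with index `p = (m, n)`. -/
noncomputable def pairTerm (w : ℂ) (x : ℝ) (p : ℕ × ℕ) (u : ℝ) : ℂ :=
  thetaCoeff p.1 * thetaCoeff p.2 *
    Complex.exp (-(((π / 4 * ((p.1:ℝ) ^ 2 * exp u + (p.2:ℝ) ^ 2 * exp (x - u)) : ℝ) : ℂ) * w))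

theorem rayTheta_mul_rayTheta {w : ℂ} (hw : 0 < w.re) (x u : ℝ) :
    rayTheta w u * rayTheta w (x - u) = (exp (x / 4) : ℝ) * ∑' p : ℕ × ℕ, pairTerm w x p u := by
  have h1 := summable_twistTheta (re_ofReal_mul_pos hw (Real.exp_pos u))
  have h2 := summable_twistTheta (re_ofReal_mul_pos hw (Real.exp_pos (x - u)))
  rw [rayTheta, rayTheta, mul_mul_mul_comm, twistTheta, twistTheta,
    tsum_mul_tsum_of_summable_norm h1.norm h2.norm, mul_comm,
    ← Complex.ofReal_mul, ← Real.exp_add]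
  congr 1
  · ring_nf
  · refine tsum_congr fun p => ?_
    rw [pairTerm, mul_mul_mul_comm, ← Complex.exp_add]
    congr 2
    push_cast
    ring

theorem norm_pairTerm (w : ℂ) (x : ℝ) (p : ℕ × ℕ) (u : ℝ) : ‖pairTerm w x p u‖ =
    ‖thetaCoeff p.1 * thetaCoeff p.2‖ *
      exp (-(π / 4 * w.re * ((p.1:ℝ) ^ 2 * exp u + (p.2:ℝ) ^ 2 * exp (x - u)))) := by
  rw [pairTerm, norm_mul, Complex.norm_exp, Complex.neg_re, Complex.re_ofReal_mul]
  congr 3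
  ring

theorem pairTerm_of_mul_eq_zero (w : ℂ) (x : ℝ) {p : ℕ × ℕ}
    (hp : p.1 * p.2 = 0) (u : ℝ) : pairTerm w x p u = 0 := by
  rcases Nat.mul_eq_zero.1 hp with h | h <;> simp [pairTerm, h, thetaCoeff_zero]

theorem continuous_pairTerm (w : ℂ) (x : ℝ) (p : ℕ × ℕ) : Continuous (pairTerm w x p) := by
  unfold pairTerm
  fun_prop

theorem integrable_pairTerm {w : ℂ} (hw : 0 < w.re) (x : ℝ) (p : ℕ × ℕ) :
    Integrable (pairTerm w x p) := by
  by_cases hp : p.1 * p.2 = 0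
  · have : pairTerm w x p = 0 := by ext u; exact pairTerm_of_mul_eq_zero w x hp u
    rw [this]; exact integrable_zero _ _ _
  · rw [Nat.mul_eq_zero, not_or] at hp
    rw [← integrable_norm_iff (continuous_pairTerm w x p).aestronglyMeasurable]
    simp_rw [norm_pairTerm]
    refine (integrable_exp_neg_pair (by positivity) ?_ ?_ x).const_mul _
    · exact_mod_cast Nat.pos_of_ne_zero hp.1
    · exact_mod_cast Nat.pos_of_ne_zero hp.2

/-- A bound that is geometric in both indices, by `2mn ≥ m + n` for `m, n ≥ 1`. -/
theorem integral_norm_pairTerm_le {w : ℂ} (hw : 0 < w.re) (x : ℝ) (p : ℕ × ℕ) :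
    ∫ u, ‖pairTerm w x p u‖ ≤ 4 * √(π / (π / 4 * w.re * exp (x / 2))) *
      (exp (-(π / 4 * w.re * exp (x / 2))) ^ p.1 * exp (-(π / 4 * w.re * exp (x / 2))) ^ p.2) := by
  by_cases hp : p.1 * p.2 = 0
  · simp_rw [pairTerm_of_mul_eq_zero w x hp, norm_zero]
    rw [integral_zero]; positivity
  rw [Nat.mul_eq_zero, not_or] at hp
  have h1 : (1:ℝ) ≤ p.1 := by exact_mod_cast Nat.pos_of_ne_zero hp.1
  have h2 : (1:ℝ) ≤ p.2 := by exact_mod_cast Nat.pos_of_ne_zero hp.2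
  simp_rw [norm_pairTerm]
  rw [integral_const_mul, mul_assoc]
  refine mul_le_mul ?_ ((integral_exp_neg_pair_le (by positivity) (by linarith)
    (by linarith) x).trans ?_)
    (integral_nonneg fun _ => (Real.exp_pos _).le) (by norm_num)
  · rw [norm_mul]
    have := mul_le_mul (norm_thetaCoeff_le p.1) (norm_thetaCoeff_le p.2) (norm_nonneg _)
      (by norm_num)
    linarith
  · rw [mul_comm]
    have hq : 0 < π / 4 * w.re * exp (x / 2) := by positivity
    have hmn : (1:ℝ) ≤ p.1 * p.2 := by nlinarith
    refine mul_le_mul (Real.sqrt_le_sqrt (div_le_div_of_nonneg_left pi_pos.le hq ?_)) ?_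
      (Real.exp_pos _).le (Real.sqrt_nonneg _)
    · nlinarith
    · rw [← Real.exp_nat_mul, ← Real.exp_nat_mul, ← Real.exp_add, Real.exp_le_exp]
      have h3 : (p.1:ℝ) + p.2 ≤ 2 * (p.1 * p.2) := by nlinarith
      nlinarith [mul_le_mul_of_nonneg_left h3 hq.le]

theorem summable_integral_norm_pairTerm {w : ℂ} (hw : 0 < w.re) (x : ℝ) :
    Summable fun p : ℕ × ℕ => ∫ u, ‖pairTerm w x p u‖ := by
  have hq : exp (-(π / 4 * w.re * exp (x / 2))) < 1 := by
    rw [Real.exp_lt_one_iff]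
    have : 0 < π / 4 * w.re * exp (x / 2) := by positivity
    linarith
  have hg := summable_geometric_of_lt_one (Real.exp_pos _).le hq
  refine Summable.of_nonneg_of_le (fun p => integral_nonneg fun _ =>
    norm_nonneg _) (integral_norm_pairTerm_le hw x) ?_
  exact (hg.mul_of_nonneg hg (fun _ => by positivity) (fun _ => by positivity)).mul_left _

/-- The coefficients `a_k = ∑_{mn = k} c_m c_n` of the square of the theta series, a twisted form of the
divisor function. -/
noncomputable def twistDivisorCoeff (k : ℕ) : ℂ := ∑ p ∈ k.divisorsAntidiagonal, thetaCoeff p.1 *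
    thetaCoeff p.2

theorem norm_twistDivisorCoeff_le (k : ℕ) : ‖twistDivisorCoeff k‖ ≤ 4 * k.divisors.card := by
  refine (norm_sum_le _ _).trans ?_
  have h : ∀ p ∈ k.divisorsAntidiagonal, ‖thetaCoeff p.1 * thetaCoeff p.2‖ ≤ 4 := fun p _ => by
    rw [norm_mul]
    have := mul_le_mul (norm_thetaCoeff_le p.1) (norm_thetaCoeff_le p.2) (norm_nonneg _)
      (by norm_num)
    linarith
  refine (Finset.sum_le_sum h).trans (le_of_eq ?_)
  rw [Nat.sum_divisorsAntidiagonal (f := fun _ _ => (4:ℝ)), Finset.sum_const, nsmul_eq_mul,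
    mul_comm]

theorem integral_pairTerm (w : ℂ) (x : ℝ) {p : ℕ × ℕ} (hp : p.1 * p.2 ≠ 0) :
    ∫ u, pairTerm w x p u =
      thetaCoeff p.1 * thetaCoeff p.2 * besselKer w (π / 2 * (p.1 * p.2 : ℕ) * exp (x / 2)) := by
  rw [Nat.mul_ne_zero_iff] at hp
  unfold pairTerm
  rw [integral_const_mul, integral_cexp_eq_besselKer w (π / 4)
    (by exact_mod_cast Nat.pos_of_ne_zero hp.1)
    (by exact_mod_cast Nat.pos_of_ne_zero hp.2)]
  congr 2
  push_cast
  ring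

/-- The expansion of the self-convolution in Bessel functions. The sets of pairs with `mn ≤ N` exhaust
`ℕ × ℕ`; pairs with a zero entry contribute nothing. -/
theorem tendsto_sum_besselKer {w : ℂ} (hw : 0 < w.re) (x : ℝ) :
    Tendsto (fun N : ℕ => (exp (x / 4) : ℝ) * ∑ k ∈ Finset.Icc 1 N,
      twistDivisorCoeff k * besselKer w (π / 2 * k * exp (x / 2)))
      atTop (𝓝 (rayConv w x)) := by
  have h : HasSum (fun p : ℕ × ℕ => ∫ u, pairTerm w x p u) (∫ u, ∑' p, pairTerm w x p u) :=
    hasSum_integral_of_summable_integral_norm (integrable_pairTerm hw x)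
      (summable_integral_norm_pairTerm hw x)
  have hr : rayConv w x = (exp (x / 4) : ℝ) * ∫ u, ∑' p, pairTerm w x p u := by
    rw [rayConv, ← integral_const_mul]
    refine integral_congr_ae (ae_of_all _ fun u => ?_)
    exact rayTheta_mul_rayTheta hw x u
  rw [hr]
  refine Tendsto.const_mul _ ?_
  set s : ℕ → Finset (ℕ × ℕ) := fun N =>
    (Finset.range (N + 1) ×ˢ Finset.range (N + 1)).filter fun p => p.1 * p.2 ≤ N with hs
  have hst : Tendsto s atTop atTop := by
    refine tendsto_atTop_finset_of_monotone (fun M N hMN p hp => ?_) fun p =>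
      ⟨p.1 + p.2 + p.1 * p.2, ?_⟩
    · simp only [hs, Finset.mem_filter, Finset.mem_product, Finset.mem_range] at hp ⊢
      omega
    · simp only [hs, Finset.mem_filter, Finset.mem_product, Finset.mem_range]
      refine ⟨⟨?_, ?_⟩, ?_⟩ <;> linarith [Nat.zero_le (p.1 * p.2), Nat.zero_le p.1, Nat.zero_le p.2]
  refine (h.comp hst).congr fun N => ?_
  simp only [Function.comp]
  have hdisj : Set.PairwiseDisjoint (↑(Finset.Icc 1 N)) Nat.divisorsAntidiagonal := by
    intro i _ j _ hij
    rw [Function.onFun, Finset.disjoint_left]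
    intro p hp hq
    rw [Nat.mem_divisorsAntidiagonal] at hp hq
    exact hij (hp.1.symm.trans hq.1)
  have hsub : (Finset.Icc 1 N).biUnion Nat.divisorsAntidiagonal ⊆ s N := by
    intro p hp
    simp only [Finset.mem_biUnion, Finset.mem_Icc, Nat.mem_divisorsAntidiagonal] at hp
    obtain ⟨k, ⟨_, hk⟩, hpk, hk0⟩ := hp
    have h0 : p.1 * p.2 ≠ 0 := hpk ▸ hk0
    rw [Nat.mul_ne_zero_iff] at h0
    simp only [hs, Finset.mem_filter, Finset.mem_product, Finset.mem_range]
    have := Nat.le_mul_of_pos_right p.1 (Nat.pos_of_ne_zero h0.2)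
    have := Nat.le_mul_of_pos_left p.2 (Nat.pos_of_ne_zero h0.1)
    omega
  rw [← Finset.sum_subset hsub, Finset.sum_biUnion hdisj]
  · refine Finset.sum_congr rfl fun k _ => ?_
    rw [twistDivisorCoeff, Finset.sum_mul]
    refine Finset.sum_congr rfl fun p hp => ?_
    rw [Nat.mem_divisorsAntidiagonal] at hp
    rw [integral_pairTerm w x (hp.1 ▸ hp.2), hp.1]
  · intro p hp hp'
    have h0 : p.1 * p.2 = 0 := by
      by_contra h0
      refine hp' ?_
      simp only [hs, Finset.mem_filter] at hp
      simp only [Finset.mem_biUnion, Finset.mem_Icc, Nat.mem_divisorsAntidiagonal]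
      exact ⟨p.1 * p.2, ⟨Nat.pos_of_ne_zero h0, hp.2⟩, rfl, h0⟩
    simp_rw [pairTerm_of_mul_eq_zero w x h0]
    exact integral_zero _ _

/-! ### A quadratic form in coefficients of divisor size -/

theorem rpow_le_exp_of_le_one {u p : ℝ} (hu : 0 ≤ u) (hp : 0 ≤ p) (hp1 : p ≤ 1) : u ^ p ≤
    exp u := by
  rcases le_total u 1 with h | h
  · exact (Real.rpow_le_one hu h hp).trans (Real.one_le_exp hu)
  · calc u ^ p ≤ u ^ (1:ℝ) := Real.rpow_le_rpow_of_exponent_le h hp1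
      _ = u := Real.rpow_one u
      _ ≤ exp u := by linarith [Real.add_one_le_exp u]

theorem exp_neg_le_rpow_neg {u p : ℝ} (hu : 0 < u) (hp : 0 ≤ p) (hp1 : p ≤ 1) : exp (-u) ≤
    u ^ (-p) := by
  rw [Real.exp_neg, Real.rpow_neg hu.le]
  exact inv_anti₀ (Real.rpow_pos_of_pos hu p) (rpow_le_exp_of_le_one hu.le hp hp1)

/-- An off-diagonal term of the double sum. The denominator is bounded below by
`((k + l) η)^κ (|k - l| / 2)^{1 - κ}`, which cancels the divisor bound `(kl)^{κ/2}` and keeps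
`|k - l|` summable once part of `exp(-(k + l) η) = exp(-|k - l| η) exp(-2 min(k, l) η)` is used. -/
theorem offDiag_term_le {κ η : ℝ} (hκ : 0 < κ) (hκ1 : κ ≤ 1 / 2) (hη : 0 < η) {k l Z : ℝ}
    (hk : 1 ≤ k) (hl : 1 ≤ l)
    (hkl : k ≠ l) (hA : (k + l) * η ≤ Z) (hB : |k - l| / 2 ≤ Z) :
    (k * l) ^ (κ / 2) * exp (-((k + l) * η)) / Z ≤
      2 * η ^ (-(3 * κ)) * |k - l| ^ (-(1 + κ)) * (exp (-(2 * k * η)) + exp (-(2 * l * η))) := by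
  have hj : 0 < |k - l| := abs_pos.2 (sub_ne_zero.2 hkl)
  set j := |k - l| with hjdef
  have hs : 0 < k + l := by linarith
  have hZ : 0 < Z := lt_of_lt_of_le (by positivity) hA
  have h1 : (k * l) ^ (κ / 2) ≤ (k + l) ^ κ := by
    calc (k * l) ^ (κ / 2) ≤ ((k + l) ^ 2) ^ (κ / 2) :=
      Real.rpow_le_rpow (by positivity) (by nlinarith) (by positivity)
      _ = (k + l) ^ κ := by rw [← Real.rpow_natCast, ← Real.rpow_mul hs.le]; congr 1; push_cast; ring
  have h2 : exp (-((k + l) * η)) ≤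
    (j * η) ^ (-(2 * κ)) * (exp (-(2 * k * η)) + exp (-(2 * l * η))) := by
    have h3 := exp_neg_le_rpow_neg (u := j * η)
      (p := 2 * κ) (by positivity) (by linarith) (by linarith)
    have h4 : exp (-((k + l) * η)) ≤
      exp (-(j * η)) * (exp (-(2 * k * η)) + exp (-(2 * l * η))) := by
      rcases le_total k l with h | h
      · rw [hjdef, abs_of_nonpos (by linarith), mul_add, ← Real.exp_add, ← Real.exp_add]
        rw [show -(-(k - l) * η) + -(2 * k * η) = -((k + l) * η) by ring]
        linarith [Real.exp_pos (-(-(k - l) * η) + -(2 * l * η))]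
      · rw [hjdef, abs_of_nonneg (by linarith), mul_add, ← Real.exp_add, ← Real.exp_add]
        rw [show -((k - l) * η) + -(2 * l * η) = -((k + l) * η) by ring]
        linarith [Real.exp_pos (-((k - l) * η) + -(2 * k * η))]
    exact h4.trans (mul_le_mul_of_nonneg_right h3 (by positivity))
  have h5 : ((k + l) * η) ^ κ * (j ^ (1 - κ) / 2) ≤ Z := by
    have e : Z = Z ^ κ * Z ^ (1 - κ) := by rw [← Real.rpow_add hZ]; simp
    rw [e]
    refine mul_le_mul (Real.rpow_le_rpow (by positivity) hA hκ.le) ?_ (by positivity)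
      (by positivity)
    refine le_trans ?_ (Real.rpow_le_rpow (by positivity) hB (by linarith))
    rw [Real.div_rpow hj.le (by norm_num)]
    refine div_le_div_of_nonneg_left (by positivity) (by positivity) ?_
    calc (2:ℝ) ^ (1 - κ) ≤ 2 ^ (1:ℝ) := Real.rpow_le_rpow_of_exponent_le (by norm_num) (by linarith)
      _ = 2 := Real.rpow_one 2
  have hden : 0 < ((k + l) * η) ^ κ * (j ^ (1 - κ) / 2) := by positivity
  calc (k * l) ^ (κ / 2) * exp (-((k + l) * η)) / Z
      ≤ (k + l) ^ κ * ((j * η) ^ (-(2 * κ)) * (exp (-(2 * k * η)) + exp (-(2 * l * η)))) /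
        (((k + l) * η) ^ κ * (j ^ (1 - κ) / 2)) := by
        refine div_le_div₀ (by positivity) (mul_le_mul h1 h2 (Real.exp_pos _).le
          (by positivity)) hden h5
    _ = _ := by
        rw [Real.mul_rpow hs.le hη.le, Real.mul_rpow hj.le hη.le]
        have e1 : j ^ (-(2 * κ)) / j ^ (1 - κ) = j ^ (-(1 + κ)) := by
          rw [← Real.rpow_sub hj]; ring_nf
        have e2 : η ^ (-(2 * κ)) / η ^ κ = η ^ (-(3 * κ)) := by
          rw [← Real.rpow_sub hη]; ring_nf
        rw [← e1, ← e2]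
        have : (k + l) ^ κ ≠ 0 := by positivity
        field_simp

theorem diag_term_le {κ η : ℝ} (hκ : 0 < κ) (hκ1 : κ ≤ 1 / 2) (hη : 0 < η) {k Z : ℝ}
    (hk : 1 ≤ k) (hA : (k + k) * η ≤ Z) :
    (k * k) ^ (κ / 2) * exp (-((k + k) * η)) / Z ≤ η ^ (-(1 + 2 * κ)) * k ^ (-(1 + κ)) := by
  have hk0 : 0 < k := by linarith
  have hZ : k * η ≤ Z := le_trans (by nlinarith) hA
  have h1 : (k * k) ^ (κ / 2) = k ^ κ := by
    rw [← sq, ← Real.rpow_natCast, ← Real.rpow_mul hk0.le]; congr 1; push_cast; ring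
  have h2 : exp (-((k + k) * η)) ≤ (k * η) ^ (-(2 * κ)) := by
    refine le_trans (Real.exp_le_exp.2 ?_) (exp_neg_le_rpow_neg (u := k * η)
      (p := 2 * κ) (by positivity) (by linarith) (by linarith))
    nlinarith [mul_pos hk0 hη]
  calc (k * k) ^ (κ / 2) * exp (-((k + k) * η)) / Z ≤ k ^ κ * (k * η) ^ (-(2 * κ)) / (k * η) := by
        rw [h1]
        exact div_le_div₀ (by positivity) (mul_le_mul_of_nonneg_left h2 (by positivity))
          (by positivity) hZ
    _ = _ := by
        rw [Real.mul_rpow hk0.le hη.le]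
        have e1 : k ^ κ * k ^ (-(2 * κ)) / k = k ^ (-(1 + κ)) := by
          rw [← Real.rpow_add hk0]
          nth_rewrite 2 [← Real.rpow_one k]
          rw [← Real.rpow_sub hk0]; ring_nf
        have e2 : η ^ (-(2 * κ)) / η = η ^ (-(1 + 2 * κ)) := by
          nth_rewrite 2 [← Real.rpow_one η]
          rw [← Real.rpow_sub hη]; ring_nf
        rw [← e1, ← e2]
        ring

theorem sum_exp_neg_mul_le {a : ℝ} (ha : 0 < a) (N : ℕ) : ∑ k ∈ Finset.Icc 1 N,
    exp (-(a * k)) ≤ 1 / a := by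
  have hr : exp (-a) < 1 := by rw [Real.exp_lt_one_iff]; linarith
  have h1 : ∑ k ∈ Finset.Icc 1 N, exp (-(a * k)) =
    exp (-a) * ∑ k ∈ Finset.range N, exp (-a) ^ k := by
    rw [Finset.mul_sum, Finset.range_eq_Ico, Finset.sum_Ico_eq_sum_range,
      ← Finset.Ico_add_one_right_eq_Icc, Finset.sum_Ico_eq_sum_range]
    refine Finset.sum_congr (by simp) fun k _ => ?_
    rw [← Real.exp_nat_mul, ← Real.exp_add]
    push_cast
    ring_nf
  have h2 : ∑ k ∈ Finset.range N, exp (-a) ^ k ≤ (1 - exp (-a))⁻¹ := by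
    rw [← tsum_geometric_of_lt_one (Real.exp_pos _).le hr]
    exact (summable_geometric_of_lt_one
      (Real.exp_pos _).le hr).sum_le_tsum _ fun _ _ => by positivity
  rw [h1]
  refine (mul_le_mul_of_nonneg_left h2 (Real.exp_pos _).le).trans ?_
  rw [← div_eq_mul_inv, div_le_div_iff₀ (by linarith) ha]
  have h3 : a * exp (-a) + exp (-a) ≤ 1 := by
    have := mul_le_mul_of_nonneg_right (Real.add_one_le_exp a) (Real.exp_pos (-a)).le
    rw [← Real.exp_add, add_neg_cancel, Real.exp_zero] at this
    linarith
  linarith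

/-- The double sum for coefficients of divisor size, with denominators
`Z k l ≥ max((k + l) η, |k - l| / 2)`. The bound is uniform in the length `N` and loses only small
powers of `η` against `1 / η`. -/
theorem sum_divisor_quadratic_le {κ : ℝ} (hκ : 0 < κ) (hκ1 : κ ≤ 1 / 2) : ∃ M : ℝ, 0 < M ∧
    ∀ (η : ℝ) (N : ℕ) (a : ℕ → ℝ) (Z : ℕ → ℕ → ℝ) (D : ℝ), 0 < η → 0 ≤ D → (∀ k, 0 ≤ a k) →
      (∀ k, a k ≤ D * (k:ℝ) ^ (κ / 2)) →
      (∀ k l : ℕ, ((k:ℝ) + l) * η ≤ Z k l) → (∀ k l : ℕ, |(k:ℝ) - l| / 2 ≤ Z k l) →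
      ∑ k ∈ Finset.Icc 1 N, ∑ l ∈ Finset.Icc 1 N, a k * a l * exp (-(((k:ℝ) + l) * η)) / Z k l ≤
        M * D ^ 2 * (η ^ (-(1 + 2 * κ)) + η ^ (-(1 + 3 * κ))) := by
  have hsum : Summable fun n : ℤ => |(n:ℝ)| ^ (-(1 + κ)) := by
    exact Real.summable_abs_int_rpow (by linarith)
  set M := ∑' n : ℤ, |(n:ℝ)| ^ (-(1 + κ)) with hM
  have hM0 : 0 ≤ M := tsum_nonneg fun n => by positivity
  have hshift : ∀ (c : ℤ) (s : Finset ℕ), ∑ l ∈ s, |(c:ℝ) - l| ^ (-(1 + κ)) ≤ M := by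
    intro c s
    have hinj : Function.Injective fun l : ℕ => c - (l:ℤ) := fun x y h => by
      have : c - (x:ℤ) = c - y := h
      omega
    have h := hsum.sum_le_tsum (s.map ⟨_, hinj⟩) fun _ _ => by positivity
    rw [Finset.sum_map] at h
    refine le_trans (le_of_eq (Finset.sum_congr rfl fun l _ => ?_)) h
    simp
  refine ⟨2 * M + 1, by positivity, fun η N a Z D hη hD ha0 ha hA hB => ?_⟩
  have hterm : ∀ k ∈ Finset.Icc 1 N, ∀ l ∈ Finset.Icc 1 N, a k * a l * exp (-(((k:ℝ) + l) * η)) /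
    Z k l ≤
      D ^ 2 * ((if k = l then η ^ (-(1 + 2 * κ)) * (k:ℝ) ^ (-(1 + κ)) else 0) +
        2 * η ^ (-(3 * κ)) * |(k:ℝ) - l| ^ (-(1 + κ)) *
          (exp (-(2 * k * η)) + exp (-(2 * l * η)))) := by
    intro k hk l hl
    have hk1 : (1:ℝ) ≤ k := by exact_mod_cast (Finset.mem_Icc.1 hk).1
    have hl1 : (1:ℝ) ≤ l := by exact_mod_cast (Finset.mem_Icc.1 hl).1
    have hZ : 0 < Z k l := lt_of_lt_of_le (by positivity) (hA k l)
    have h1 : a k * a l * exp (-(((k:ℝ) + l) * η)) / Z k l ≤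
        D ^ 2 * (((k:ℝ) * l) ^ (κ / 2) * exp (-(((k:ℝ) + l) * η)) / Z k l) := by
      rw [← mul_div_assoc, ← mul_assoc, Real.mul_rpow (by positivity) (by positivity)]
      have h2 := mul_le_mul (ha k) (ha l) (ha0 l) (by positivity)
      refine div_le_div_of_nonneg_right (mul_le_mul_of_nonneg_right ?_ (Real.exp_pos _).le) hZ.le
      linarith
    refine h1.trans (mul_le_mul_of_nonneg_left ?_ (by positivity))
    by_cases hkl : k = l
    · subst hkl
      rw [if_pos rfl]
      have := diag_term_le hκ hκ1 hη hk1 (hA k k)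
      have h0 : 0 ≤ 2 * η ^ (-(3 * κ)) * |(k:ℝ) - k| ^ (-(1 + κ)) *
        (exp (-(2 * k * η)) + exp (-(2 * k * η))) := by positivity
      linarith
    · rw [if_neg hkl, zero_add]
      exact offDiag_term_le hκ hκ1 hη hk1 hl1 (by exact_mod_cast hkl) (hA k l) (hB k l)
  refine (Finset.sum_le_sum fun k hk => Finset.sum_le_sum fun l hl => hterm k hk l hl).trans ?_
  simp_rw [← Finset.mul_sum, Finset.sum_add_distrib]
  have hd : ∑ k ∈ Finset.Icc 1 N, ∑ l ∈ Finset.Icc 1 N,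
    (if k = l then η ^ (-(1 + 2 * κ)) * (k:ℝ) ^ (-(1 + κ)) else 0) ≤
      η ^ (-(1 + 2 * κ)) * M := by
    have : ∀ k ∈ Finset.Icc 1 N, ∑ l ∈ Finset.Icc 1 N,
      (if k = l then η ^ (-(1 + 2 * κ)) * (k:ℝ) ^ (-(1 + κ)) else 0) =
        η ^ (-(1 + 2 * κ)) * |((0:ℤ):ℝ) - k| ^ (-(1 + κ)) := by
      intro k hk
      rw [Finset.sum_ite_eq, if_pos hk]
      simp
    rw [Finset.sum_congr rfl this, ← Finset.mul_sum]
    exact mul_le_mul_of_nonneg_left (hshift 0 _) (by positivity)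
  have hE := sum_exp_neg_mul_le (a := 2 * η) (by positivity) N
  have hE' : ∑ k ∈ Finset.Icc 1 N, exp (-(2 * k * η)) ≤ 1 / (2 * η) := by
    refine le_trans (le_of_eq (Finset.sum_congr rfl fun k _ => ?_)) hE
    ring_nf
  have ho1 : ∑ k ∈ Finset.Icc 1 N, ∑ l ∈ Finset.Icc 1 N, |(k:ℝ) - l| ^ (-(1 + κ)) *
    exp (-(2 * k * η)) ≤ M * (1 / (2 * η)) := by
    refine le_trans (Finset.sum_le_sum fun k _ =>
      ?_) ((Finset.mul_sum _ _ _).symm.le.trans (mul_le_mul_of_nonneg_left hE' hM0))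
    rw [← Finset.sum_mul]
    exact mul_le_mul_of_nonneg_right (by exact_mod_cast hshift k _) (Real.exp_pos _).le
  have ho2 : ∑ k ∈ Finset.Icc 1 N, ∑ l ∈ Finset.Icc 1 N, |(k:ℝ) - l| ^ (-(1 + κ)) *
    exp (-(2 * l * η)) ≤ M * (1 / (2 * η)) := by
    rw [Finset.sum_comm]
    refine le_trans (le_of_eq ?_) ho1
    refine Finset.sum_congr rfl fun k _ => Finset.sum_congr rfl fun l _ => ?_
    rw [abs_sub_comm]
  have ho : ∑ k ∈ Finset.Icc 1 N, ∑ l ∈ Finset.Icc 1 N,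
      2 * η ^ (-(3 * κ)) * |(k:ℝ) - l| ^ (-(1 + κ)) *
        (exp (-(2 * k * η)) + exp (-(2 * l * η))) ≤ 2 * η ^ (-(1 + 3 * κ)) * M := by
    have e : ∀ k l : ℕ, 2 * η ^ (-(3 * κ)) * |(k:ℝ) - l| ^ (-(1 + κ)) *
      (exp (-(2 * k * η)) + exp (-(2 * l * η))) =
      2 * η ^ (-(3 * κ)) * (|(k:ℝ) - l| ^ (-(1 + κ)) * exp (-(2 * k * η)) + |(k:ℝ) - l| ^
        (-(1 + κ)) * exp (-(2 * l * η))) := by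
      intro k l; ring
    simp_rw [e, ← Finset.mul_sum, Finset.sum_add_distrib]
    refine (mul_le_mul_of_nonneg_left (add_le_add ho1 ho2) (by positivity)).trans (le_of_eq ?_)
    have e2 : η ^ (-(3 * κ)) / η = η ^ (-(1 + 3 * κ)) := by
      nth_rewrite 2 [← Real.rpow_one η]
      rw [← Real.rpow_sub hη]; ring_nf
    rw [← e2]
    field_simp
    ring
  have hp1 : 0 < η ^ (-(1 + 2 * κ)) := by positivity
  have hp2 : 0 < η ^ (-(1 + 3 * κ)) := by positivity
  have := mul_le_mul_of_nonneg_left (add_le_add hd ho) (sq_nonneg D)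
  have h2 : η ^ (-(1 + 2 * κ)) * M + 2 * η ^ (-(1 + 3 * κ)) * M ≤
      (2 * M + 1) * (η ^ (-(1 + 2 * κ)) + η ^ (-(1 + 3 * κ))) := by nlinarith
  refine this.trans ((mul_le_mul_of_nonneg_left h2 (sq_nonneg D)).trans (le_of_eq (by ring)))

/-! ### Mean square of an exponential sum -/

theorem hasDerivAt_cexp_neg_exp_half_mul {Z : ℂ} (hZ : Z ≠ 0) (x : ℝ) :
    HasDerivAt (fun x : ℝ => -(2 / Z) * Complex.exp (-((exp (x / 2) : ℝ) * Z)))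
      ((exp (x / 2) : ℝ) * Complex.exp (-((exp (x / 2) : ℝ) * Z))) x := by
  have h1 : HasDerivAt (fun x : ℝ => ((exp (x / 2) : ℝ) : ℂ)) ((exp (x / 2) * (1 / 2) : ℝ) : ℂ) x :=
    (((hasDerivAt_id x).div_const 2).exp).ofReal_comp
  have h2 := (((h1.mul_const Z).neg).cexp).const_mul (-(2 / Z))
  refine h2.congr_deriv ?_
  push_cast
  field_simp
  rfl

theorem integrableOn_exp_half_mul_cexp {Z : ℂ} (hZ : 0 < Z.re) :
    IntegrableOn (fun x : ℝ =>
      ((exp (x / 2) : ℝ) : ℂ) * Complex.exp (-((exp (x / 2) : ℝ) * Z))) (Ioi 0) := by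
  have hn : IntegrableOn (fun x : ℝ => exp (x / 2) * exp (-(exp (x / 2) * Z.re))) (Ioi 0) := by
    have hd : ∀ x : ℝ, HasDerivAt (fun x : ℝ =>
      -(2 / Z.re) * exp (-(exp (x / 2) * Z.re))) (exp (x / 2) * exp (-(exp (x / 2) * Z.re))) x := by
      intro x
      have h1 : HasDerivAt (fun x : ℝ => exp (x / 2)) (exp (x / 2) * (1 / 2)) x :=
        ((hasDerivAt_id x).div_const 2).exp
      refine ((((h1.mul_const Z.re).neg).exp).const_mul (-(2 / Z.re))).congr_deriv ?_
      field_simp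
      rfl
    have ht : Tendsto (fun x : ℝ => -(2 / Z.re) * exp (-(exp (x / 2) * Z.re))) atTop
      (𝓝 (-(2 / Z.re) * 0)) := by
      refine Tendsto.const_mul _ (Real.tendsto_exp_neg_atTop_nhds_zero.comp ?_)
      exact ((Real.tendsto_exp_atTop.comp (tendsto_id.atTop_div_const
        (by norm_num))).atTop_mul_const hZ)
    exact integrableOn_Ioi_deriv_of_nonneg' (fun x _ => hd x) (fun x _ => by positivity) ht
  refine Integrable.mono' hn (Continuous.aestronglyMeasurable (by fun_prop)) (ae_of_all _ fun x =>
    ?_)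
  rw [norm_mul, Complex.norm_exp, Complex.norm_real, Real.norm_of_nonneg (Real.exp_pos _).le,
    Complex.neg_re, Complex.re_ofReal_mul]

theorem integral_exp_half_mul_cexp {Z : ℂ} (hZ : 0 < Z.re) :
    ∫ x in Ioi (0:ℝ), ((exp (x / 2) : ℝ) : ℂ) * Complex.exp (-((exp (x / 2) : ℝ) * Z)) =
      2 * Complex.exp (-Z) / Z := by
  have hZ0 : Z ≠ 0 := fun h => by simp [h] at hZ
  have ht : Tendsto (fun x : ℝ => -(2 / Z) * Complex.exp (-((exp (x / 2) : ℝ) * Z))) atTop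
    (𝓝 (-(2 / Z) * 0)) := by
    refine Tendsto.const_mul _ ?_
    rw [tendsto_zero_iff_norm_tendsto_zero]
    have h2 : Tendsto (fun x : ℝ => exp (-(exp (x / 2) * Z.re))) atTop (𝓝 0) := by
      refine Real.tendsto_exp_neg_atTop_nhds_zero.comp ?_
      exact ((Real.tendsto_exp_atTop.comp (tendsto_id.atTop_div_const
        (by norm_num))).atTop_mul_const hZ)
    refine h2.congr fun x => ?_
    rw [Complex.norm_exp, Complex.neg_re, Complex.re_ofReal_mul]
  rw [integral_Ioi_of_hasDerivAt_of_tendsto' (fun x _ =>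
    hasDerivAt_cexp_neg_exp_half_mul hZ0 x) (integrableOn_exp_half_mul_cexp hZ) ht]
  simp
  ring

/-- The exponential sum `e^{x/4} ∑_{k ≤ N} a_k exp(-π k e^{x/2} z / 2)`. -/
noncomputable def expSum (a : ℕ → ℂ) (N : ℕ) (z : ℂ) (x : ℝ) : ℂ :=
  (exp (x / 4) : ℝ) * ∑ k ∈ Finset.Icc 1 N, a k *
    Complex.exp (-(((π / 2 * k * exp (x / 2) : ℝ) : ℂ) * z))

/-- The exponent `(π/2)(k z + l conj z) - δ` that belongs to the pair `(k, l)` in the expansion of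
`|expSum a N z x|² exp(δ e^{x/2})`. -/
noncomputable def pairFreq (z : ℂ) (δ : ℝ) (k l : ℕ) : ℂ :=
    ((π / 2 * k : ℝ) : ℂ) * z + ((π / 2 * l : ℝ) : ℂ) * (starRingEnd ℂ) z - (δ : ℂ)

theorem pairFreq_re (z : ℂ) (δ : ℝ) (k l : ℕ) : (pairFreq z δ k l).re =
    π / 2 * (k + l) * z.re - δ := by
  simp only [pairFreq, Complex.sub_re, Complex.add_re, Complex.re_ofReal_mul, Complex.conj_re,
    Complex.ofReal_re]; ring

theorem pairFreq_im (z : ℂ) (δ : ℝ) (k l : ℕ) : (pairFreq z δ k l).im = π / 2 * (k - l) * z.im := by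
  simp only [pairFreq, Complex.sub_im, Complex.add_im, Complex.im_ofReal_mul, Complex.conj_im,
    Complex.ofReal_im]; ring

theorem norm_expSum_sq (a : ℕ → ℂ) (N : ℕ) (z : ℂ) (δ x : ℝ) :
    ((‖expSum a N z x‖ ^ 2 * exp (δ * exp (x / 2)) : ℝ) : ℂ) =
      ∑ k ∈ Finset.Icc 1 N, ∑ l ∈ Finset.Icc 1 N,
      a k * (starRingEnd ℂ) (a l) *
        (((exp (x / 2) : ℝ) : ℂ) * Complex.exp (-((exp (x / 2) : ℝ) * pairFreq z δ k l))) := by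
  rw [expSum, norm_mul, mul_pow, Complex.norm_real, Real.norm_of_nonneg (Real.exp_pos _).le,
    ← Real.exp_nat_mul]
  rw [show ((2:ℕ):ℝ) * (x / 4) = x / 2 by push_cast; ring]
  push_cast
  rw [← Complex.mul_conj', map_sum, Finset.sum_mul_sum, Finset.mul_sum, Finset.sum_mul]
  refine Finset.sum_congr rfl fun k _ => ?_
  rw [Finset.mul_sum, Finset.sum_mul]
  refine Finset.sum_congr rfl fun l _ => ?_
  rw [map_mul, ← Complex.exp_conj]
  have e : Complex.exp (-(Complex.exp (x / 2) * pairFreq z δ k l)) =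
    Complex.exp (-(π / 2 * k * Complex.exp (x / 2) * z)) *
      Complex.exp ((starRingEnd ℂ) (-(π / 2 * l * Complex.exp (x / 2) * z))) *
        Complex.exp (δ * Complex.exp (x / 2)) := by
    rw [← Complex.exp_add, ← Complex.exp_add]
    congr 1
    have : (starRingEnd ℂ) (Complex.exp (x / 2)) = Complex.exp (x / 2) := by
      rw [← Complex.exp_conj]; simp [map_ofNat]
    simp only [pairFreq, map_neg, map_mul, map_div₀, Complex.conj_ofReal, map_natCast, map_ofNat,
      this]
    push_cast
    ring
  rw [e]
  ring

/-- The mean square of the exponential sum against the weight `e^{εx/2}`. With `y = e^{x/2}` the weight is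
`y^ε ≤ η₀^{-ε} exp(ε η₀ y)`, which is absorbed in the exponents, and every term integrates to
`2 exp(-Z) / Z`. -/
theorem lintegral_norm_expSum_sq_le {κ : ℝ} (hκ : 0 < κ) (hκ1 : κ ≤ 1 / 2) : ∃ M : ℝ, 0 < M ∧
    ∀ (η₀ ε D : ℝ) (N : ℕ) (a : ℕ → ℂ) (z : ℂ), 0 < η₀ → η₀ ≤ z.re → 1 / 2 ≤ z.im → 0 < ε → ε ≤
      1 / 2 → 0 ≤ D →
      (∀ k, ‖a k‖ ≤ D * (k:ℝ) ^ (κ / 2)) →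
      ∫⁻ x in Ioi (0:ℝ), ‖expSum a N z x‖ₑ ^ 2 * ENNReal.ofReal (exp (ε * x / 2)) ≤
        ENNReal.ofReal (M * D ^ 2 * η₀ ^ (-ε) * (z.re ^ (-(1 + 2 * κ)) + z.re ^
          (-(1 + 3 * κ)))) := by
  obtain ⟨M, hM0, hM⟩ := sum_divisor_quadratic_le hκ hκ1
  refine ⟨2 * M, by positivity, fun η₀ ε D N a z hη₀ hη him hε hε1 hD ha => ?_⟩
  set η := z.re with hηdef
  have hη0 : 0 < η := hη₀.trans_le hη
  set δ := ε * η₀ with hδ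
  have hδη : δ ≤ η / 2 := by nlinarith
  have hπ := Real.pi_gt_three
  have hre : ∀ k l : ℕ, 1 ≤ k + l → ((k:ℝ) + l) * η ≤ (pairFreq z δ k l).re := by
    intro k l hkl
    have : (1:ℝ) ≤ k + l := by exact_mod_cast hkl
    rw [pairFreq_re]
    nlinarith [mul_nonneg (sub_nonneg.2 this) hη0.le, mul_nonneg (show (0:ℝ) ≤
      k + l by positivity) hη0.le]
  have hA : ∀ k l : ℕ, ((k:ℝ) + l) * η ≤ ‖pairFreq z δ k l‖ := by
    intro k l
    rcases Nat.eq_zero_or_pos (k + l) with h | h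
    · have hk : k = 0 := by omega
      have hl : l = 0 := by omega
      simp [hk, hl]
    · exact (hre k l h).trans (Complex.re_le_norm _)
  have hB : ∀ k l : ℕ, |(k:ℝ) - l| / 2 ≤ ‖pairFreq z δ k l‖ := by
    intro k l
    refine le_trans ?_ (Complex.abs_im_le_norm _)
    rw [pairFreq_im, abs_mul, abs_mul, abs_of_nonneg (by positivity : (0:ℝ) ≤
      π / 2), abs_of_nonneg (by linarith : (0:ℝ) ≤ z.im)]
    nlinarith [mul_nonneg (abs_nonneg ((k:ℝ) - l)) (show (0:ℝ) ≤ z.im - 1 / 2 by linarith),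
      abs_nonneg ((k:ℝ) - l),
      mul_nonneg (mul_nonneg (abs_nonneg ((k:ℝ) - l)) (show (0:ℝ) ≤
        z.im by linarith)) (show (0:ℝ) ≤ π / 2 - 1 by linarith)]
  have hpos : ∀ k ∈ Finset.Icc 1 N, ∀ l ∈ Finset.Icc 1 N, 0 < (pairFreq z δ k l).re := by
    intro k hk l hl
    have hk1 := (Finset.mem_Icc.1 hk).1
    refine lt_of_lt_of_le ?_ (hre k l (by omega))
    have : (1:ℝ) ≤ k := by exact_mod_cast hk1
    positivity
  set F : ℝ → ℂ := fun x => ∑ k ∈ Finset.Icc 1 N, ∑ l ∈ Finset.Icc 1 N,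
      a k * (starRingEnd ℂ) (a l) *
        (((exp (x / 2) : ℝ) : ℂ) * Complex.exp (-((exp (x / 2) : ℝ) * pairFreq z δ k l))) with hF
  have hi : ∀ k ∈ Finset.Icc 1 N, ∀ l ∈ Finset.Icc 1 N, IntegrableOn (fun x : ℝ =>
    a k * (starRingEnd ℂ) (a l) *
      (((exp (x / 2) : ℝ) : ℂ) * Complex.exp (-((exp (x / 2) : ℝ) * pairFreq z δ k l)))) (Ioi 0) :=
        fun k hk l hl =>
    (integrableOn_exp_half_mul_cexp (hpos k hk l hl)).const_mul _
  have hFi : IntegrableOn F (Ioi 0) := integrable_finsetSum _ fun k hk =>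
    integrable_finsetSum _ fun l hl => hi k hk l hl
  have hreal : ∀ x, ‖expSum a N z x‖ ^ 2 * exp (δ * exp (x / 2)) = (F x).re := by
    intro x
    rw [hF]
    simp only
    rw [← norm_expSum_sq, Complex.ofReal_re]
  have hint : ∫ x in Ioi (0:ℝ), (F x).re ≤
    2 * (M * D ^ 2 * (η ^ (-(1 + 2 * κ)) + η ^ (-(1 + 3 * κ)))) := by
    have h1 : ∫ x in Ioi (0:ℝ), (F x).re = (∫ x in Ioi (0:ℝ), F x).re := integral_re hFi
    rw [h1]
    refine (Complex.re_le_norm _).trans ?_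
    rw [hF, integral_finsetSum _ fun k hk => integrable_finsetSum _ fun l hl => hi k hk l hl]
    refine (norm_sum_le _ _).trans ?_
    refine le_trans ?_ (mul_le_mul_of_nonneg_left (hM η N (fun k => ‖a k‖) (fun k l =>
      ‖pairFreq z δ k l‖) D hη0 hD (fun _ => norm_nonneg _)
      ha hA hB) (by norm_num))
    rw [Finset.mul_sum]
    refine Finset.sum_le_sum fun k hk => ?_
    rw [integral_finsetSum _ fun l hl => hi k hk l hl, Finset.mul_sum]
    refine (norm_sum_le _ _).trans (Finset.sum_le_sum fun l hl => ?_)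
    rw [integral_const_mul, integral_exp_half_mul_cexp (hpos k hk l hl), norm_mul, norm_mul,
      norm_div, norm_mul, Complex.norm_conj,
      Complex.norm_exp, Complex.neg_re]
    have h2 : exp (-(pairFreq z δ k l).re) ≤ exp (-(((k:ℝ) + l) * η)) :=
      Real.exp_le_exp.2 (neg_le_neg (hre k l (by have := (Finset.mem_Icc.1 hk).1; omega)))
    rw [Complex.norm_ofNat, mul_div_assoc, mul_left_comm, ← mul_div_assoc]
    refine mul_le_mul_of_nonneg_left (div_le_div_of_nonneg_right (mul_le_mul_of_nonneg_left h2
      (by positivity)) (norm_nonneg _)) (by norm_num)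
  have hpt : ∀ x : ℝ, ‖expSum a N z x‖ₑ ^ 2 * ENNReal.ofReal (exp (ε * x / 2)) ≤
    ENNReal.ofReal (η₀ ^ (-ε) * (F x).re) := by
    intro x
    rw [← hreal, ← ofReal_norm, ← ENNReal.ofReal_pow (norm_nonneg _),
      ← ENNReal.ofReal_mul (by positivity)]
    refine ENNReal.ofReal_le_ofReal ?_
    rw [mul_left_comm]
    refine mul_le_mul_of_nonneg_left ?_ (by positivity)
    have h3 : (η₀ * exp (x / 2)) ^ ε ≤ exp (δ * exp (x / 2)) := by
      rw [Real.rpow_def_of_pos (by positivity), Real.exp_le_exp, hδ]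
      have := Real.log_le_sub_one_of_pos (show 0 < η₀ * exp (x / 2) by positivity)
      nlinarith
    rw [Real.mul_rpow hη₀.le (Real.exp_pos _).le, ← Real.exp_mul] at h3
    rw [Real.rpow_neg hη₀.le, inv_mul_eq_div, le_div_iff₀ (by positivity), mul_comm]
    rwa [show ε * x / 2 = x / 2 * ε by ring]
  refine (lintegral_mono hpt).trans ?_
  have hnn : ∀ x, 0 ≤ (F x).re := fun x => by rw [← hreal]; positivity
  have hFr : Integrable (fun x => η₀ ^ (-ε) * (F x).re) (volume.restrict (Ioi 0)) :=
    hFi.re.const_mul _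
  rw [← ofReal_integral_eq_lintegral_ofReal hFr (ae_of_all _ fun x =>
    mul_nonneg (by positivity) (hnn x)),
    integral_const_mul]
  refine ENNReal.ofReal_le_ofReal ?_
  refine (mul_le_mul_of_nonneg_left hint (by positivity)).trans (le_of_eq (by ring))

/-! ### Mean square of the self-convolution -/

theorem lintegral_mul_sq_le_mul {α : Type*} [MeasurableSpace α] {μ : Measure α} {f g : α → ENNReal}
    (hf : AEMeasurable f μ) (hg : AEMeasurable g μ) :
    (∫⁻ a, f a * g a ∂μ) ^ 2 ≤ (∫⁻ a, f a ^ 2 ∂μ) * ∫⁻ a, g a ^ 2 ∂μ := by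
  have h := ENNReal.lintegral_mul_le_Lp_mul_Lq μ (Real.HolderConjugate.two_two) hf hg
  have h2 := pow_le_pow_left' h 2
  rw [mul_pow, ← ENNReal.rpow_natCast, ← ENNReal.rpow_natCast, ← ENNReal.rpow_natCast,
    ← ENNReal.rpow_mul, ← ENNReal.rpow_mul] at h2
  simpa using h2

/-- The first weight of the Cauchy inequality over the Laplace variable `b`; it is integrable on `(0, ∞)`. -/
noncomputable def laplaceMajorant (ε b : ℝ) : ℝ := 2 * b ^ (ε / 2 - 1) * (max 1 b) ^ (-(1 / 2) : ℝ)

/-- The second weight of the Cauchy inequality. The product of the two weights dominates the square of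
`besselWeight`, and `b^{ε-1}` times the second weight is the first one. -/
noncomputable def laplaceMajorant' (ε b : ℝ) : ℝ := 2 * b ^ (-(ε / 2)) * (max 1 b) ^ (-(1 / 2) : ℝ)

theorem integrableOn_laplaceMajorant {ε : ℝ} (hε : 0 < ε) (hε1 : ε < 1) :
    IntegrableOn (laplaceMajorant ε) (Ioi 0) := by
  have hm : Measurable (laplaceMajorant ε) := by unfold laplaceMajorant; fun_prop
  rw [← Ioc_union_Ioi_eq_Ioi (zero_le_one' ℝ)]
  refine IntegrableOn.union ?_ ?_
  · have h1 : IntegrableOn (fun b : ℝ => 2 * b ^ (ε / 2 - 1)) (Ioc 0 1) := by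
      have := (intervalIntegral.intervalIntegrable_rpow' (a := 0) (b := 1)
        (r := ε / 2 - 1) (by linarith)).const_mul 2
      rwa [intervalIntegrable_iff_integrableOn_Ioc_of_le zero_le_one] at this
    refine Integrable.mono' h1 hm.aestronglyMeasurable
      ((ae_restrict_mem measurableSet_Ioc).mono fun b hb => ?_)
    have hb0 : 0 < b := hb.1
    rw [laplaceMajorant, max_eq_left hb.2, Real.one_rpow, mul_one,
      Real.norm_of_nonneg (by positivity)]
  · have h1 : IntegrableOn (fun b : ℝ => 2 * b ^ (ε / 2 - 3 / 2)) (Ioi 1) :=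
      (integrableOn_Ioi_rpow_of_lt (by linarith) one_pos).const_mul 2
    refine Integrable.mono' h1 hm.aestronglyMeasurable
      ((ae_restrict_mem measurableSet_Ioi).mono fun b hb => ?_)
    have hb1 : 1 < b := hb
    have hb0 : 0 < b := by linarith
    rw [laplaceMajorant, max_eq_right hb1.le, Real.norm_of_nonneg (by positivity), mul_assoc,
      ← Real.rpow_add hb0]
    ring_nf
    exact le_rfl

theorem norm_besselWeight_le {w : ℂ} (hw : 0 < w.re) (him : 1 / 2 ≤ w.im) {b : ℝ} (hb : 0 < b) :
    ‖besselWeight w b‖ ≤ 2 * b ^ (-(1 / 2) : ℝ) * (max 1 b) ^ (-(1 / 2) : ℝ) := by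
  rw [norm_besselWeight hb]
  refine mul_le_mul_of_nonneg_left (Real.rpow_le_rpow_of_nonpos (by positivity) (max_le ?_ ?_)
    (by norm_num)) (by positivity)
  · refine le_trans ?_ (Complex.im_le_norm _)
    simp; linarith
  · refine le_trans ?_ (Complex.re_le_norm _)
    simp; linarith

theorem norm_besselWeight_le_sqrt {w : ℂ} (hw : 0 < w.re) (him : 1 / 2 ≤ w.im) (ε : ℝ) {b :
    ℝ} (hb : 0 < b) :
    ‖besselWeight w b‖ ≤ √(laplaceMajorant ε b) * √(laplaceMajorant' ε b) := by
  refine (norm_besselWeight_le hw him hb).trans ?_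
  have hm : 0 < max 1 b := by positivity
  rw [← Real.sqrt_mul (by unfold laplaceMajorant; positivity)]
  refine Real.le_sqrt_of_sq_le (le_of_eq ?_)
  rw [laplaceMajorant, laplaceMajorant']
  have e : b ^ (-(1 / 2) : ℝ) * b ^ (-(1 / 2) : ℝ) = b ^ (ε / 2 - 1) * b ^ (-(ε / 2)) := by
    rw [← Real.rpow_add hb, ← Real.rpow_add hb]; ring_nf
  linear_combination (4 * (max 1 b) ^ (-(1 / 2) : ℝ) * (max 1 b) ^ (-(1 / 2) : ℝ)) * e

theorem measurable_besselWeight (w : ℂ) : Measurable (besselWeight w) := by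
  unfold besselWeight
  fun_prop

theorem integrableOn_besselWeight_mul_cexp {w : ℂ} (hw : 0 < w.re)
    (him : 1 / 2 ≤ w.im) {ρ : ℝ} (hρ : 0 < ρ) :
    IntegrableOn (fun b : ℝ => besselWeight w b * Complex.exp (-(ρ * b))) (Ioi 0) := by
  have h1 : IntegrableOn (fun b : ℝ => 2 * (b ^ (-(1 / 2) : ℝ) * exp (-ρ * b))) (Ioi 0) := by
    have := integrableOn_rpow_mul_exp_neg_mul_rpow (s := -(1/2)) (p := 1)
      (b := ρ) (by norm_num) (one_pos) hρ
    simpa [IntegrableOn] using this.const_mul 2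
  refine Integrable.mono' h1 ((measurable_besselWeight w).mul (by fun_prop)).aestronglyMeasurable
    ((ae_restrict_mem measurableSet_Ioi).mono fun b hb => ?_)
  have hb0 : 0 < b := hb
  rw [norm_mul, Complex.norm_exp]
  have e : (-(ρ * b) : ℂ).re =
    -ρ * b := by rw [← Complex.ofReal_mul, ← Complex.ofReal_neg, Complex.ofReal_re]; ring
  rw [e, ← mul_assoc]
  refine mul_le_mul_of_nonneg_right ((norm_besselWeight_le hw him hb0).trans ?_) (Real.exp_pos _).le
  exact mul_le_of_le_one_right (by positivity) (Real.rpow_le_one_of_one_le_of_nonpos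
    (le_max_left _ _) (by norm_num))

theorem sum_besselKer_eq_integral {w : ℂ} (hw : 0 < w.re) (him : 1 / 2 ≤ w.im)
    (a : ℕ → ℂ) (N : ℕ) (x : ℝ) :
    (exp (x / 4) : ℝ) * ∑ k ∈ Finset.Icc 1 N, a k * besselKer w (π / 2 * k * exp (x / 2)) =
      ∫ b in Ioi (0:ℝ), besselWeight w b * expSum a N (w + b) x := by
  have hρ : ∀ k ∈ Finset.Icc 1 N, 0 < π / 2 * k * exp (x / 2) := by
    intro k hk
    have : (1:ℝ) ≤ k := by exact_mod_cast (Finset.mem_Icc.1 hk).1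
    positivity
  have h1 : ∀ b : ℝ, besselWeight w b * expSum a N (w + b) x = ∑ k ∈ Finset.Icc 1 N,
      ((exp (x / 4) : ℝ) * a k * Complex.exp (-((π / 2 * k * exp (x / 2) : ℝ) * w))) *
        (besselWeight w b * Complex.exp (-((π / 2 * k * exp (x / 2) : ℝ) * b))) := by
    intro b
    rw [expSum, Finset.mul_sum, Finset.mul_sum]
    refine Finset.sum_congr rfl fun k _ => ?_
    rw [mul_add, neg_add, Complex.exp_add]
    ring
  simp_rw [h1]
  rw [integral_finsetSum _ fun k hk =>
    (integrableOn_besselWeight_mul_cexp hw him (hρ k hk)).const_mul _, Finset.mul_sum]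
  refine Finset.sum_congr rfl fun k hk => ?_
  rw [integral_const_mul, besselKer_eq_laplace hw (hρ k hk)]
  ring

/-- Cauchy's inequality for the truncated expansion, as an average over `b` of exponential sums. -/
theorem enorm_sum_besselKer_sq_le {w : ℂ} (hw : 0 < w.re) (him : 1 / 2 ≤ w.im) (ε : ℝ)
    (a : ℕ → ℂ) (N : ℕ) (x : ℝ) :
    ‖(exp (x / 4) : ℝ) * ∑ k ∈ Finset.Icc 1 N, a k * besselKer w (π / 2 * k * exp (x / 2))‖ₑ ^ 2 ≤
      (∫⁻ b in Ioi (0:ℝ), ENNReal.ofReal (laplaceMajorant ε b)) *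
        ∫⁻ b in Ioi (0:ℝ), ENNReal.ofReal (laplaceMajorant' ε b) * ‖expSum a N (w + b) x‖ₑ ^ 2 := by
  rw [sum_besselKer_eq_integral hw him]
  have hS : Measurable fun b : ℝ => expSum a N (w + b) x := by
    unfold expSum; fun_prop
  have hm1 : Measurable (laplaceMajorant ε) := by unfold laplaceMajorant; fun_prop
  have hm2 : Measurable (laplaceMajorant' ε) := by unfold laplaceMajorant'; fun_prop
  have h1 : ‖∫ b in Ioi (0:ℝ), besselWeight w b * expSum a N (w + b) x‖ₑ ≤
      ∫⁻ b in Ioi (0:ℝ), ENNReal.ofReal (√(laplaceMajorant ε b)) *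
        (ENNReal.ofReal (√(laplaceMajorant' ε b)) * ‖expSum a N (w + b) x‖ₑ) := by
    refine (enorm_integral_le_lintegral_enorm _).trans
      (setLIntegral_mono' measurableSet_Ioi fun b hb => ?_)
    rw [enorm_mul, ← mul_assoc, ← ENNReal.ofReal_mul (Real.sqrt_nonneg _), ← ofReal_norm]
    gcongr
    exact norm_besselWeight_le_sqrt hw him ε hb
  refine (pow_le_pow_left' h1 2).trans ((lintegral_mul_sq_le_mul (by fun_prop) (by fun_prop)).trans
    (le_of_eq ?_))
  have hsq : ∀ y : ℝ, 0 ≤ y → ENNReal.ofReal (√y) ^ 2 = ENNReal.ofReal y := fun y hy => by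
    rw [← ENNReal.ofReal_pow (Real.sqrt_nonneg _), Real.sq_sqrt hy]
  congr 1
  · refine setLIntegral_congr_fun measurableSet_Ioi fun b hb => ?_
    have hb0 : 0 < b := hb
    exact hsq _ (by unfold laplaceMajorant; positivity)
  · refine setLIntegral_congr_fun measurableSet_Ioi fun b hb => ?_
    have hb0 : 0 < b := hb
    rw [mul_pow, hsq _ (by unfold laplaceMajorant'; positivity)]

theorem rpow_neg_add_rpow_neg_le {ε κ η₀ η b : ℝ} (hε : 0 < ε) (hε1 : ε < 1)
    (hκ : 3 * κ = ε) (hη₀ : 0 < η₀) (hη₀1 : η₀ ≤ 1) (hη : η₀ ≤ η)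
    (hb : 0 < b) (hbη : b ≤ η) :
    η ^ (-(1 + 2 * κ)) + η ^ (-(1 + 3 * κ)) ≤ 2 * (b ^ (ε - 1) * η₀ ^ (-(2 * ε))) := by
  have hη0 : 0 < η := by linarith
  have hκ0 : 0 < κ := by linarith
  have key : ∀ p : ℝ, 0 ≤ p → p ≤ ε → η ^ (-(1 + p)) ≤ b ^ (ε - 1) * η₀ ^ (-(2 * ε)) := by
    intro p hp hp1
    calc η ^ (-(1 + p)) = η ^ (ε - 1) * η ^ (-(ε + p)) := by rw [← Real.rpow_add hη0]; ring_nf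
      _ ≤ b ^ (ε - 1) * η₀ ^ (-(ε + p)) := by
          refine mul_le_mul (Real.rpow_le_rpow_of_nonpos hb hbη (by linarith))
            (Real.rpow_le_rpow_of_nonpos hη₀ hη (by linarith))
            (by positivity) (by positivity)
      _ ≤ b ^ (ε - 1) * η₀ ^ (-(2 * ε)) :=
          mul_le_mul_of_nonneg_left (Real.rpow_le_rpow_of_exponent_ge hη₀ hη₀1 (by linarith))
            (by positivity)
  linarith [key (2 * κ) (by linarith) (by linarith), key (3 * κ) (by linarith) (by linarith)]

/-- The mean square of the self-convolution on `x > 0` against the weight `e^{εx/2}` is bounded by a small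
power of `1 / Re w`. The bound is proved for the truncated expansions, and Fatou's lemma passes to
the limit. -/
theorem exists_lintegral_rayConv_sq_le {ε D : ℝ} (hε : 0 < ε) (hε1 : ε ≤ 1 / 2) (hD : 0 ≤ D)
    (hd : ∀ k, ‖twistDivisorCoeff k‖ ≤ D * (k:ℝ) ^ (ε / 3 / 2)) :
    ∃ C : ℝ, 0 < C ∧ ∀ w : ℂ, 0 < w.re → w.re ≤ 1 → 1 / 2 ≤ w.im →
      ∫⁻ x in Ioi (0:ℝ), ‖rayConv w x‖ₑ ^ 2 * ENNReal.ofReal (exp (ε * x / 2)) ≤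
        ENNReal.ofReal (C * w.re ^ (-(3 * ε))) := by
  obtain ⟨M, hM0, hM⟩ := lintegral_norm_expSum_sq_le (κ := ε / 3) (by positivity) (by linarith)
  set I := ∫ b in Ioi (0:ℝ), laplaceMajorant ε b with hI
  have hI0 : 0 ≤ I := setIntegral_nonneg measurableSet_Ioi fun b hb => by
    have hb0 : 0 < b := hb
    unfold laplaceMajorant; positivity
  have hIl : ∫⁻ b in Ioi (0:ℝ), ENNReal.ofReal (laplaceMajorant ε b) = ENNReal.ofReal I := by
    rw [hI, ofReal_integral_eq_lintegral_ofReal (integrableOn_laplaceMajorant hε (by linarith))]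
    refine (ae_restrict_mem measurableSet_Ioi).mono fun b hb => ?_
    have hb0 : 0 < b := hb
    simp only [Pi.zero_apply]
    unfold laplaceMajorant; positivity
  refine ⟨2 * M * D ^ 2 * I ^ 2 + 1, by positivity, fun w hw hw1 him => ?_⟩
  set H := 2 * M * D ^ 2 * w.re ^ (-(3 * ε)) with hH
  have hH0 : 0 ≤ H := by positivity
  set Q : ℕ → ℝ → ENNReal := fun N x =>
    ∫⁻ b in Ioi (0:ℝ), ENNReal.ofReal (laplaceMajorant' ε b) *
      ‖expSum twistDivisorCoeff N (w + b) x‖ₑ ^ 2 with hQ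
  have hm2 : Measurable (laplaceMajorant' ε) := by unfold laplaceMajorant'; fun_prop
  have hmj : ∀ N, Measurable fun p : ℝ × ℝ => ENNReal.ofReal (laplaceMajorant' ε p.2) *
      ‖expSum twistDivisorCoeff N (w + p.2) p.1‖ₑ ^ 2 := by
    intro N
    have : Measurable fun p : ℝ × ℝ => expSum twistDivisorCoeff N (w + p.2) p.1 := by
      unfold expSum; fun_prop
    fun_prop
  have hQm : ∀ N, Measurable (Q N) := fun N => (hmj N).lintegral_prod_right'
  have hQint : ∀ N, ∫⁻ x in Ioi (0:ℝ), Q N x *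
    ENNReal.ofReal (exp (ε * x / 2)) ≤ ENNReal.ofReal H * ENNReal.ofReal I := by
    intro N
    have e1 : ∀ x, Q N x * ENNReal.ofReal (exp (ε * x / 2)) =
      ∫⁻ b in Ioi (0:ℝ), ENNReal.ofReal (laplaceMajorant' ε b) *
        ‖expSum twistDivisorCoeff N (w + b) x‖ₑ ^ 2 * ENNReal.ofReal (exp (ε * x / 2)) := fun x =>
      (lintegral_mul_const' _ _ ENNReal.ofReal_ne_top).symm
    simp_rw [e1]
    rw [lintegral_lintegral_swap ((((hmj N).mul (by fun_prop : Measurable fun p : ℝ × ℝ =>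
      ENNReal.ofReal (exp (ε * p.1 / 2))))).aemeasurable),
      ← hIl, ← lintegral_const_mul' _ _ ENNReal.ofReal_ne_top]
    refine setLIntegral_mono' measurableSet_Ioi fun b hb => ?_
    have hb0 : 0 < b := hb
    simp_rw [mul_assoc]
    rw [lintegral_const_mul' _ _ ENNReal.ofReal_ne_top]
    have hre : (w + b).re = w.re + b := by simp
    have h1 :=
      hM w.re ε D N twistDivisorCoeff (w + b) hw (by rw [hre]; linarith)
      (by simpa using him) hε hε1 hD hd
    refine (mul_le_mul_right h1 _).trans ?_
    rw [← ENNReal.ofReal_mul (by unfold laplaceMajorant'; positivity), ← ENNReal.ofReal_mul hH0]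
    refine ENNReal.ofReal_le_ofReal ?_
    -- The mean square at `b` is `O(b^{ε - 1})`, which turns the second weight into the integrable first one.
    have h2 := rpow_neg_add_rpow_neg_le (b := b)
      (η := w.re + b) hε (by linarith) (show 3 * (ε / 3) =
      ε by ring) hw hw1 (by linarith) hb0 (by linarith)
    rw [hre]
    have e3 : w.re ^ (-ε) * w.re ^ (-(2 * ε)) =
      w.re ^ (-(3 * ε)) := by rw [← Real.rpow_add hw]; ring_nf
    have e4 : b ^ (-(ε / 2)) * b ^ (ε - 1) = b ^ (ε / 2 - 1) := by rw [← Real.rpow_add hb0]; ring_nf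
    calc laplaceMajorant' ε b *
      (M * D ^ 2 * w.re ^ (-ε) * ((w.re + b) ^ (-(1 + 2 * (ε / 3))) + (w.re + b) ^
      (-(1 + 3 * (ε / 3)))))
        ≤ laplaceMajorant' ε b *
          (M * D ^ 2 * w.re ^ (-ε) * (2 * (b ^ (ε - 1) * w.re ^ (-(2 * ε))))) := by
          refine mul_le_mul_of_nonneg_left (mul_le_mul_of_nonneg_left h2 (by positivity))
            (by unfold laplaceMajorant'; positivity)
      _ = H * laplaceMajorant ε b := by
          rw [hH, laplaceMajorant, laplaceMajorant', ← e3, ← e4]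
          ring
  have hpt : ∀ x, ‖rayConv w x‖ₑ ^ 2 * ENNReal.ofReal (exp (ε * x / 2)) ≤
      liminf (fun N => ENNReal.ofReal I * (Q N x * ENNReal.ofReal (exp (ε * x / 2)))) atTop := by
    intro x
    have ht := ENNReal.Tendsto.pow (n := 2) (tendsto_sum_besselKer hw x).enorm
    have ht2 := ENNReal.Tendsto.mul_const
      (b := ENNReal.ofReal (exp (ε * x / 2))) ht (Or.inr ENNReal.ofReal_ne_top)
    rw [← ht2.liminf_eq]
    refine liminf_le_liminf (Eventually.of_forall fun N => ?_)
    have h3 := enorm_sum_besselKer_sq_le hw him ε twistDivisorCoeff N x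
    rw [hIl] at h3
    rw [← mul_assoc]
    exact mul_le_mul_left h3 _
  calc ∫⁻ x in Ioi (0:ℝ), ‖rayConv w x‖ₑ ^ 2 * ENNReal.ofReal (exp (ε * x / 2))
      ≤ ∫⁻ x in Ioi (0:ℝ), liminf (fun N =>
        ENNReal.ofReal I * (Q N x * ENNReal.ofReal (exp (ε * x / 2)))) atTop := lintegral_mono hpt
    _ ≤ liminf (fun N =>
      ∫⁻ x in Ioi (0:ℝ), ENNReal.ofReal I * (Q N x * ENNReal.ofReal (exp (ε * x / 2)))) atTop :=
        lintegral_liminf_le fun N => ((hQm N).mul (by fun_prop)).const_mul _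
    _ ≤ ENNReal.ofReal I * (ENNReal.ofReal H * ENNReal.ofReal I) := by
        refine (liminf_le_liminf (Eventually.of_forall fun N =>
          ?_)).trans (le_of_eq (liminf_const _))
        rw [lintegral_const_mul' _ _ ENNReal.ofReal_ne_top]
        exact mul_le_mul_right (hQint N) _
    _ ≤ _ := by
        rw [← ENNReal.ofReal_mul hH0, ← ENNReal.ofReal_mul hI0]
        refine ENNReal.ofReal_le_ofReal ?_
        have : 0 ≤ w.re ^ (-(3 * ε)) := by positivity
        rw [hH]
        nlinarith

/-! ### A large sieve inequality on the half line -/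

theorem norm_sq_sum_mul_exp_neg (b : ℕ → ℂ) (t : ℕ → ℝ) (R : ℕ) (δ x : ℝ) :
    ((‖∑ r ∈ Finset.Icc 1 R, b r * Complex.exp (Complex.I * t r * x / 2)‖ ^ 2 * exp (-(δ * x)) :
      ℝ) : ℂ) =
      ∑ r ∈ Finset.Icc 1 R, ∑ s ∈ Finset.Icc 1 R, b r * (starRingEnd ℂ) (b s) *
        Complex.exp ((-δ + (t r - t s) / 2 * Complex.I) * x) := by
  push_cast
  rw [← Complex.mul_conj', map_sum, Finset.sum_mul_sum, Finset.sum_mul]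
  refine Finset.sum_congr rfl fun r _ => ?_
  rw [Finset.sum_mul]
  refine Finset.sum_congr rfl fun s _ => ?_
  rw [map_mul, ← Complex.exp_conj]
  have e : Complex.exp ((-δ + (t r - t s) / 2 * Complex.I) * x) =
    Complex.exp (Complex.I * t r * x / 2) *
      Complex.exp ((starRingEnd ℂ) (Complex.I * t s * x / 2)) * Complex.exp (-(δ * x)) := by
    rw [← Complex.exp_add, ← Complex.exp_add]
    congr 1
    simp only [map_mul, map_div₀, Complex.conj_ofReal, map_ofNat, Complex.conj_I]
    ring
  rw [e]
  ring

/-- The dual form of the large sieve: the mean square of a sum of `1`-spaced exponentials against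
`exp(-δx)`, by a Hilbert type inequality with a logarithmic loss. -/
theorem lintegral_norm_sq_sum_mul_exp_neg_le {δ : ℝ} (hδ : 0 < δ) (b : ℕ → ℂ) (t : ℕ → ℝ) (R : ℕ)
    (ht : ∀ r ∈ Finset.Icc 1 R, ∀ s ∈ Finset.Icc 1 R, |(r:ℝ) - s| ≤ |t r - t s|) :
    ∫⁻ x in Ioi (0:ℝ), ‖∑ r ∈ Finset.Icc 1 R, b r * Complex.exp (Complex.I * t r * x / 2)‖ₑ ^ 2 *
      ENNReal.ofReal (exp (-(δ * x))) ≤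
      ENNReal.ofReal ((1 / δ + 4 * (1 + log R)) * ∑ r ∈ Finset.Icc 1 R, ‖b r‖ ^ 2) := by
  set a : ℕ → ℕ → ℂ := fun r s => -δ + (t r - t s) / 2 * Complex.I with ha
  have har : ∀ r s, (a r s).re = -δ := by intro r s; simp [ha]
  have hai : ∀ r s, (a r s).im = (t r - t s) / 2 := by intro r s; simp [ha]
  have hneg : ∀ r s, (a r s).re < 0 := fun r s => by rw [har]; linarith
  set F : ℝ → ℂ := fun x => ∑ r ∈ Finset.Icc 1 R, ∑ s ∈ Finset.Icc 1 R, b r *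
    (starRingEnd ℂ) (b s) * Complex.exp (a r s * x) with hF
  have hi : ∀ r s, IntegrableOn (fun x : ℝ =>
    b r * (starRingEnd ℂ) (b s) * Complex.exp (a r s * x)) (Ioi 0) := fun r s =>
    (integrableOn_exp_mul_complex_Ioi (hneg r s) 0).const_mul _
  have hFi : IntegrableOn F (Ioi 0) := integrable_finsetSum _ fun r _ =>
    integrable_finsetSum _ fun s _ => hi r s
  have hreal : ∀ x : ℝ, ‖∑ r ∈ Finset.Icc 1 R, b r *
    Complex.exp (Complex.I * t r * x / 2)‖ ^ 2 * exp (-(δ * x)) = (F x).re := by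
    intro x
    rw [hF]
    simp only [ha]
    rw [← norm_sq_sum_mul_exp_neg, Complex.ofReal_re]
  have hterm : ∀ r ∈ Finset.Icc 1 R, ∀ s ∈ Finset.Icc 1 R, ‖∫ x in Ioi (0:ℝ), b r *
    (starRingEnd ℂ) (b s) * Complex.exp (a r s * x)‖ ≤
      (if r = s then 1 / δ else 2 * (1 / |(r:ℝ) - s|)) * ((‖b r‖ ^ 2 + ‖b s‖ ^ 2) / 2) := by
    intro r hr s hs
    rw [integral_const_mul, integral_exp_mul_complex_Ioi (hneg r s), norm_mul, norm_mul,
      Complex.norm_conj, mul_comm]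
    have h1 : ‖b r‖ * ‖b s‖ ≤
      (‖b r‖ ^ 2 + ‖b s‖ ^ 2) / 2 := by nlinarith [sq_nonneg (‖b r‖ - ‖b s‖)]
    refine mul_le_mul ?_ h1 (by positivity) (by split_ifs <;> positivity)
    simp only [Complex.ofReal_zero, mul_zero, Complex.exp_zero, norm_div, norm_neg, norm_one]
    split_ifs with h
    · refine one_div_le_one_div_of_le hδ ?_
      have := Complex.abs_re_le_norm (a r s)
      rwa [har, abs_neg, abs_of_pos hδ] at this
    · have hrs : 0 < |(r:ℝ) - s| := abs_pos.2 (sub_ne_zero.2 (by exact_mod_cast h))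
      rw [show 2 * (1 / |(r:ℝ) - s|) = 1 / (|(r:ℝ) - s| / 2) by field_simp]
      refine one_div_le_one_div_of_le (by positivity) ?_
      have := Complex.abs_im_le_norm (a r s)
      rw [hai, abs_div, abs_of_pos (by norm_num : (0:ℝ) < 2)] at this
      exact le_trans (div_le_div_of_nonneg_right (ht r hr s hs) (by norm_num)) this
  have hrow : ∀ r ∈ Finset.Icc 1 R, ∑ s ∈ Finset.Icc 1 R,
    (if r = s then 1 / δ else 2 * (1 / |(r:ℝ) - s|)) ≤ 1 / δ + 4 * (1 + log R) := by
    intro r hr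
    rw [← Finset.add_sum_erase _ _ hr, if_pos rfl]
    refine add_le_add le_rfl ?_
    have : ∑ s ∈ (Finset.Icc 1 R).erase r, (if r = s then 1 / δ else 2 * (1 / |(r:ℝ) - s|)) =
        2 * ∑ s ∈ (Finset.Icc 1 R).erase r, (1 / |(r:ℝ) - s|) := by
      rw [Finset.mul_sum]
      refine Finset.sum_congr rfl fun s hs => ?_
      rw [if_neg (Finset.ne_of_mem_erase hs).symm]
    rw [this]
    linarith [sum_one_div_abs_sub_le R r hr]
  have hS : ∑ r ∈ Finset.Icc 1 R, ∑ s ∈ Finset.Icc 1 R,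
    (if r = s then 1 / δ else 2 * (1 / |(r:ℝ) - s|)) * (‖b r‖ ^ 2) ≤
      (1 / δ + 4 * (1 + log R)) * ∑ r ∈ Finset.Icc 1 R, ‖b r‖ ^ 2 := by
    rw [Finset.mul_sum]
    refine Finset.sum_le_sum fun r hr => ?_
    rw [← Finset.sum_mul]
    exact mul_le_mul_of_nonneg_right (hrow r hr) (by positivity)
  have hS' : ∑ r ∈ Finset.Icc 1 R, ∑ s ∈ Finset.Icc 1 R,
    (if r = s then 1 / δ else 2 * (1 / |(r:ℝ) - s|)) * (‖b s‖ ^ 2) ≤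
      (1 / δ + 4 * (1 + log R)) * ∑ r ∈ Finset.Icc 1 R, ‖b r‖ ^ 2 := by
    rw [Finset.sum_comm]
    refine le_trans (le_of_eq (Finset.sum_congr rfl fun r _ => Finset.sum_congr rfl fun s _ =>
      ?_)) hS
    simp only [eq_comm (a := s) (b := r), abs_sub_comm (s:ℝ) r]
  have hint : ∫ x in Ioi (0:ℝ), (F x).re ≤
    (1 / δ + 4 * (1 + log R)) * ∑ r ∈ Finset.Icc 1 R, ‖b r‖ ^ 2 := by
    have h1 : ∫ x in Ioi (0:ℝ), (F x).re = (∫ x in Ioi (0:ℝ), F x).re := integral_re hFi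
    rw [h1]
    refine (Complex.re_le_norm _).trans ?_
    rw [hF, integral_finsetSum _ fun r _ => integrable_finsetSum _ fun s _ => hi r s]
    have h2 : ‖∑ r ∈ Finset.Icc 1 R, ∫ x in Ioi (0:ℝ), ∑ s ∈ Finset.Icc 1 R, b r *
      (starRingEnd ℂ) (b s) * Complex.exp (a r s * x)‖ ≤
        ∑ r ∈ Finset.Icc 1 R, ∑ s ∈ Finset.Icc 1 R,
          (if r = s then 1 / δ else 2 * (1 / |(r:ℝ) - s|)) * ((‖b r‖ ^ 2 + ‖b s‖ ^ 2) / 2) := by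
      refine (norm_sum_le _ _).trans (Finset.sum_le_sum fun r hr => ?_)
      rw [integral_finsetSum _ fun s _ => hi r s]
      exact (norm_sum_le _ _).trans (Finset.sum_le_sum fun s hs => hterm r hr s hs)
    refine h2.trans ?_
    have e : ∀ r s : ℕ, (if r = s then 1 / δ else 2 * (1 / |(r:ℝ) - s|)) *
      ((‖b r‖ ^ 2 + ‖b s‖ ^ 2) / 2) =
        1 / 2 * ((if r = s then 1 / δ else 2 * (1 / |(r:ℝ) - s|)) * (‖b r‖ ^ 2) +
          (if r = s then 1 / δ else 2 * (1 / |(r:ℝ) - s|)) * (‖b s‖ ^ 2)) := by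
      intro r s; ring
    simp_rw [e, ← Finset.mul_sum, Finset.sum_add_distrib]
    linarith
  have hpt : ∀ x : ℝ, ‖∑ r ∈ Finset.Icc 1 R, b r * Complex.exp (Complex.I * t r * x / 2)‖ₑ ^ 2 *
    ENNReal.ofReal (exp (-(δ * x))) =
      ENNReal.ofReal ((F x).re) := by
    intro x
    rw [← hreal, ← ofReal_norm, ← ENNReal.ofReal_pow (norm_nonneg _),
      ← ENNReal.ofReal_mul (by positivity)]
  simp_rw [hpt]
  have hFr : Integrable (fun x => (F x).re) (volume.restrict (Ioi 0)) := hFi.re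
  rw [← ofReal_integral_eq_lintegral_ofReal hFr (ae_of_all _ fun x => by
    simp only [Pi.zero_apply]; rw [← hreal]; positivity)]
  exact ENNReal.ofReal_le_ofReal hint

/-- A large sieve inequality on the half line, for the Fourier transform of `g` at `1`-spaced points.
By duality it follows from the mean square of the exponential sum whose coefficients are the
conjugates of the values to be bounded. -/
theorem sum_norm_sq_integral_mul_cexp_le {g : ℝ → ℂ} (hg : IntegrableOn g (Ioi 0)) {G δ : ℝ}
    (hG : 0 ≤ G) (hδ : 0 < δ)
    (hgG : ∫⁻ x in Ioi (0:ℝ), ‖g x‖ₑ ^ 2 * ENNReal.ofReal (exp (δ * x)) ≤ ENNReal.ofReal G)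
      (t : ℕ → ℝ) (R : ℕ)
    (ht : ∀ r ∈ Finset.Icc 1 R, ∀ s ∈ Finset.Icc 1 R, |(r:ℝ) - s| ≤ |t r - t s|) :
    ∑ r ∈ Finset.Icc 1 R, ‖∫ x in Ioi (0:ℝ), g x * Complex.exp (Complex.I * t r * x / 2)‖ ^ 2 ≤
      G * (1 / δ + 4 * (1 + log R)) := by
  set A : ℕ → ℂ := fun r => ∫ x in Ioi (0:ℝ), g x * Complex.exp (Complex.I * t r * x / 2) with hA
  set S := ∑ r ∈ Finset.Icc 1 R, ‖A r‖ ^ 2 with hS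
  have hS0 : 0 ≤ S := Finset.sum_nonneg fun r _ => by positivity
  set b : ℕ → ℂ := fun r => (starRingEnd ℂ) (A r) with hb
  have hi : ∀ r, IntegrableOn (fun x : ℝ =>
    g x * Complex.exp (Complex.I * t r * x / 2)) (Ioi 0) := by
    intro r
    refine Integrable.mono' hg.norm (hg.aestronglyMeasurable.mul (Continuous.aestronglyMeasurable
      (by fun_prop))) (ae_of_all _ fun x => ?_)
    rw [norm_mul, Complex.norm_exp]
    have : (Complex.I * t r * x / 2).re = 0 := by
      rw [show Complex.I * t r * x / 2 =
        ((t r * x / 2 : ℝ) : ℂ) * Complex.I by push_cast; ring, Complex.re_ofReal_mul]; simp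
    rw [this, Real.exp_zero, mul_one]
  have h1 : (S : ℂ) = ∫ x in Ioi (0:ℝ), g x * ∑ r ∈ Finset.Icc 1 R, b r *
    Complex.exp (Complex.I * t r * x / 2) := by
    have e : ∀ x : ℝ, g x * ∑ r ∈ Finset.Icc 1 R, b r * Complex.exp (Complex.I * t r * x / 2) =
        ∑ r ∈ Finset.Icc 1 R, b r * (g x * Complex.exp (Complex.I * t r * x / 2)) := by
      intro x
      rw [Finset.mul_sum]
      exact Finset.sum_congr rfl fun r _ => by ring
    simp_rw [e]
    rw [integral_finsetSum _ fun r _ => (hi r).const_mul _, hS]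
    push_cast
    refine Finset.sum_congr rfl fun r _ => ?_
    rw [integral_const_mul, hb, ← Complex.conj_mul']
  set B : ℝ → ℂ := fun x =>
    ∑ r ∈ Finset.Icc 1 R, b r * Complex.exp (Complex.I * t r * x / 2) with hB
  have hBm : Measurable B := by rw [hB]; fun_prop
  have h2 : ENNReal.ofReal S ≤
    ∫⁻ x in Ioi (0:ℝ), (‖g x‖ₑ * ENNReal.ofReal (exp (δ * x / 2))) *
    (‖B x‖ₑ * ENNReal.ofReal (exp (-(δ * x / 2)))) := by
    have e : ENNReal.ofReal S = ‖(S : ℂ)‖ₑ := by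
      rw [← ofReal_norm, Complex.norm_real, Real.norm_of_nonneg hS0]
    rw [e, h1]
    refine (enorm_integral_le_lintegral_enorm _).trans (le_of_eq (lintegral_congr fun x => ?_))
    rw [mul_mul_mul_comm, ← ENNReal.ofReal_mul (Real.exp_pos _).le, ← Real.exp_add, add_neg_cancel,
      Real.exp_zero, ENNReal.ofReal_one,
      mul_one, enorm_mul]
  have hsq : ∀ y : ℝ, ENNReal.ofReal (exp (y / 2)) ^ 2 = ENNReal.ofReal (exp y) := fun y => by
    rw [← ENNReal.ofReal_pow (Real.exp_pos _).le, ← Real.exp_nat_mul]; congr 2; push_cast; ring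
  have h3 : ENNReal.ofReal S ^ 2 ≤
    ENNReal.ofReal G * ENNReal.ofReal ((1 / δ + 4 * (1 + log R)) * S) := by
    refine (pow_le_pow_left' h2 2).trans
      ((lintegral_mul_sq_le_mul (hg.aestronglyMeasurable.enorm.mul (by fun_prop))
      (by fun_prop)).trans ?_)
    refine mul_le_mul' (le_trans (le_of_eq (lintegral_congr fun x => ?_)) hgG)
      (le_trans (le_of_eq (lintegral_congr fun x =>
        ?_)) ((lintegral_norm_sq_sum_mul_exp_neg_le hδ b t R ht).trans (le_of_eq ?_)))
    · rw [Pi.mul_apply, mul_pow, hsq]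
    · rw [mul_pow, ← neg_div, hsq]
    · simp only [hb, Complex.norm_conj]; rfl
  rw [← ENNReal.ofReal_pow hS0, ← ENNReal.ofReal_mul hG] at h3
  rcases hS0.eq_or_lt with h0 | h0
  · rw [← h0]
    have := log_natCast_nonneg R
    positivity
  · have hpos : 0 ≤ G * ((1 / δ + 4 * (1 + log R)) * S) := by
      have := log_natCast_nonneg R
      positivity
    have h4 := (ENNReal.ofReal_le_ofReal_iff hpos).1 h3
    nlinarith

/-! ### The discrete fourth moment of the zeta function -/

/-- The factor equals `-(2^s - 1)(2^s - 2) / 2^s`, and `|2^s| = √2` on the critical line. -/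
theorem one_eighth_le_norm_eulerFactor (t : ℝ) :
    1 / 8 ≤ ‖(3 - 2 ^ (1 / 2 + Complex.I * t) - 2 * 2 ^ (-(1 / 2 + Complex.I * t)) : ℂ)‖ := by
  set s : ℂ := 1 / 2 + Complex.I * t with hs
  set u : ℂ := 2 ^ s with hu
  have hsre : s.re = 1 / 2 := by simp [hs]
  have hun : ‖u‖ = √2 := by
    have := Complex.norm_cpow_eq_rpow_re_of_pos (show (0:ℝ) < 2 by norm_num) s
    rw [hsre, ← sqrt_eq_rpow] at this
    rw [hu, ← this]; norm_num
  have h2 : √2 * √2 = 2 := Real.mul_self_sqrt (by norm_num)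
  have h1 : 1.4 ≤ √2 := Real.le_sqrt_of_sq_le (by norm_num)
  have h3 : √2 ≤ 1.5 := Real.sqrt_le_iff.2 (by norm_num)
  have hu0 : u ≠ 0 := fun h => by rw [h, norm_zero] at hun; linarith
  have e : (3 - u - 2 * 2 ^ (-s) : ℂ) = -((u - 1) * (u - 2)) / u := by
    rw [Complex.cpow_neg, ← hu]
    field_simp
    ring
  rw [e, norm_div, norm_neg, norm_mul, hun]
  have h4 : √2 - 1 ≤ ‖u - 1‖ := by
    have := norm_sub_norm_le u 1
    rwa [hun, norm_one] at this
  have h5 : 2 - √2 ≤ ‖u - 2‖ := by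
    have := norm_sub_norm_le 2 u
    rw [hun, norm_sub_rev] at this
    simpa using this
  rw [le_div_iff₀ (by linarith)]
  have := mul_le_mul h4 h5 (by linarith) (norm_nonneg _)
  nlinarith

/-- On the ray of angle `π/2 - 1/X` the factor `w^{-s/2}` has modulus `exp((π/2 - 1/X) t / 2)`, which for
`t ≤ X` matches the decay `exp(-πt/4)` of the gamma factor up to a constant. -/
theorem exists_norm_riemannZeta_le_mellin : ∃ c : ℝ, 0 < c ∧ ∀ X t : ℝ, 1 ≤ X → 1 ≤ t → t ≤ X →
    ‖riemannZeta (1 / 2 + Complex.I * t)‖ * t ^ (-(1 / 4) : ℝ) ≤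
      c * ‖mellin (fun x : ℝ =>
        twistTheta (x * Complex.exp ((π / 2 - 1 / X : ℝ) * Complex.I)))
        ((1 / 2 + Complex.I * t) / 2)‖ := by
  obtain ⟨c, hc, hΓ⟩ := exists_le_norm_Gamma_quarter
  refine ⟨8 * exp (1 / 2) * π ^ (1 / 4 : ℝ) / c, by positivity, fun X t hX ht htX => ?_⟩
  have hX0 : 0 < X := by linarith
  have hiX : 1 / X ≤ 1 := by rw [div_le_one hX0]; exact hX
  have hiX0 : 0 < 1 / X := by positivity
  have hπ := Real.pi_gt_three
  set α : ℝ := π / 2 - 1 / X with hα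
  set w : ℂ := Complex.exp (α * Complex.I) with hw
  set s : ℂ := 1 / 2 + Complex.I * t with hs
  have hsre : s.re = 1 / 2 := by simp [hs]
  have hsim : s.im = t := by simp [hs]
  have hs0 : s ≠ 0 := fun h => by rw [h] at hsre; norm_num at hsre
  have hs1 : s ≠ 1 := fun h => by rw [h] at hsre; norm_num at hsre
  have hwre : 0 < w.re := by
    rw [hw, Complex.exp_ofReal_mul_I_re]
    exact Real.cos_pos_of_mem_Ioo ⟨by rw [hα]; linarith, by rw [hα]; linarith⟩
  have hw1 : ‖w‖ = 1 := Complex.norm_exp_ofReal_mul_I α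
  rw [mellin_twistTheta_ray hwre hw1 hs0 hs1, norm_mul, norm_mul]
  have e1 : ‖w⁻¹ ^ (s / 2)‖ = exp (α * t / 2) := by
    have hl : Complex.log w⁻¹ = (-α : ℝ) * Complex.I := by
      rw [hw, ← Complex.exp_neg, ← neg_mul, ← Complex.ofReal_neg,
        Complex.log_exp] <;> simp <;> rw [hα] <;> linarith
    rw [Complex.cpow_def_of_ne_zero (inv_ne_zero (Complex.exp_ne_zero _)), hl, Complex.norm_exp]
    congr 1
    rw [mul_assoc, Complex.re_ofReal_mul, Complex.I_mul_re, Complex.div_ofNat_im, hsim]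
    ring
  have e2 : ‖completedRiemannZeta s‖ =
    π ^ (-(1 / 4) : ℝ) * ‖Complex.Gamma (1 / 4 + (t / 2 : ℝ) * Complex.I)‖ * ‖riemannZeta s‖ := by
    have hG : Complex.Gammaℝ s ≠ 0 := Complex.Gammaℝ_ne_zero_of_re_pos (by rw [hsre]; norm_num)
    have h1 : completedRiemannZeta s = Complex.Gammaℝ s * riemannZeta s := by
      rw [riemannZeta_def_of_ne_zero hs0, mul_div_cancel₀ _ hG]
    have h2 : s / 2 = 1 / 4 + (t / 2 : ℝ) * Complex.I := by rw [hs]; push_cast; ring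
    rw [h1, norm_mul, Complex.Gammaℝ_def, norm_mul, h2, Complex.norm_cpow_eq_rpow_re_of_pos pi_pos]
    congr 3
    rw [Complex.div_ofNat_re, Complex.neg_re, hsre]; norm_num
  have h3 := hΓ (t / 2) (by linarith)
  have h4 : t ^ (-(1 / 4) : ℝ) ≤ (t / 2) ^ (-(1 / 4) : ℝ) :=
    Real.rpow_le_rpow_of_nonpos (by linarith) (by linarith) (by norm_num)
  have h5 : 1 ≤ exp (1 / 2) * (exp (α * t / 2) * exp (-(π * (t / 2) / 2))) := by
    rw [← Real.exp_add, ← Real.exp_add]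
    refine Real.one_le_exp ?_
    have : t * (1 / X) ≤ 1 := by rw [mul_one_div, div_le_one hX0]; exact htX
    rw [hα]
    linarith
  have h6 := one_eighth_le_norm_eulerFactor t
  rw [← hs] at h6
  rw [e1, e2]
  set Z := ‖riemannZeta s‖ with hZ
  have hZ0 : 0 ≤ Z := norm_nonneg _
  have e3 : π ^ (1 / 4 : ℝ) * π ^ (-(1 / 4) : ℝ) = 1 := by
    rw [← Real.rpow_add pi_pos]; norm_num
  calc Z * t ^ (-(1 / 4) : ℝ) ≤ Z * (t / 2) ^ (-(1 / 4) : ℝ) := mul_le_mul_of_nonneg_left h4 hZ0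
    _ ≤ (Z * (t / 2) ^ (-(1 / 4) : ℝ)) *
      (exp (1 / 2) * (exp (α * t / 2) * exp (-(π * (t / 2) / 2)))) :=
        le_mul_of_one_le_right (by positivity) h5
    _ = 8 * exp (1 / 2) * π ^ (1 / 4 : ℝ) / c * (exp (α * t / 2) * (1 / 8 * (π ^ (-(1 / 4) : ℝ) *
          (c * (t / 2) ^ (-(1 / 4) : ℝ) * exp (-(π * (t / 2) / 2))) * Z))) := by
        have : Z * (t / 2) ^ (-(1 / 4) : ℝ) *
          (exp (1 / 2) * (exp (α * t / 2) * exp (-(π * (t / 2) / 2)))) =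
          (π ^ (1 / 4 : ℝ) * π ^ (-(1 / 4) : ℝ)) *
            (Z * (t / 2) ^ (-(1 / 4) :
            ℝ) * (exp (1 / 2) * (exp (α * t / 2) * exp (-(π * (t / 2) / 2))))) := by
          rw [e3, one_mul]
        rw [this]
        field_simp
    _ ≤ _ := by
        refine mul_le_mul_of_nonneg_left (mul_le_mul_of_nonneg_left ?_ (Real.exp_pos _).le)
          (by positivity)
        refine mul_le_mul h6 (mul_le_mul_of_nonneg_right (mul_le_mul_of_nonneg_left h3
          (by positivity)) hZ0) (by positivity) (norm_nonneg _)

/-- The discrete fourth moment over `1`-spaced points of `[1, X]`. -/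
theorem exists_sum_norm_riemannZeta_pow_four_le {ε : ℝ} (hε : 0 < ε) (hε1 : ε ≤ 1 / 2) : ∃ C :
    ℝ, 0 < C ∧
    ∀ (X : ℝ) (R : ℕ) (t : ℕ → ℝ), 1 ≤ X → (∀ r ∈ Finset.Icc 1 R, 1 ≤ t r ∧ t r ≤ X) →
      (∀ r ∈ Finset.Icc 1 R, ∀ s ∈ Finset.Icc 1 R, |(r:ℝ) - s| ≤ |t r - t s|) →
      ∑ r ∈ Finset.Icc 1 R, ‖riemannZeta (1 / 2 + Complex.I * t r)‖ ^ 4 ≤ C * X ^ (1 + 4 * ε) := by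
  obtain ⟨D, hD1, hD⟩ := exists_card_divisors_le_rpow (ε := ε / 3 / 2) (by positivity)
  obtain ⟨C₁, hC₁, h₁⟩ := exists_lintegral_rayConv_sq_le (D := 4 * D) hε hε1 (by linarith) fun k =>
    (norm_twistDivisorCoeff_le k).trans (by linarith [hD k])
  obtain ⟨c, hc, hζ⟩ := exists_norm_riemannZeta_le_mellin
  refine ⟨4 * c ^ 4 * (C₁ * (π / 2) ^ (3 * ε)) *
    (6 / ε + 4), by positivity, fun X R t hX ht hts => ?_⟩
  rcases Nat.eq_zero_or_pos R with rfl | hR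
  · simp; positivity
  have hX0 : 0 < X := by linarith
  have hiX : 1 / X ≤ 1 := by rw [div_le_one hX0]; exact hX
  have hiX0 : 0 < 1 / X := by positivity
  have hπ := Real.pi_gt_three
  set w : ℂ := Complex.exp ((π / 2 - 1 / X : ℝ) * Complex.I) with hw
  have hw1 : ‖w‖ = 1 := Complex.norm_exp_ofReal_mul_I _
  have hre : w.re = sin (1 / X) := by rw [hw, Complex.exp_ofReal_mul_I_re, Real.cos_pi_div_two_sub]
  have him : w.im = cos (1 / X) := by rw [hw, Complex.exp_ofReal_mul_I_im, Real.sin_pi_div_two_sub]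
  have hre1 : 2 / π * (1 / X) ≤ w.re := by
    rw [hre]; exact Real.mul_le_sin hiX0.le (by linarith)
  have hwre : 0 < w.re := lt_of_lt_of_le (by positivity) hre1
  have him1 : 1 / 2 ≤ w.im := by
    rw [him, ← Real.cos_pi_div_three]
    exact Real.cos_le_cos_of_nonneg_of_le_pi hiX0.le (by linarith) (by linarith)
  have hG := h₁ w hwre (by rw [hre]; exact Real.sin_le_one _) him1
  set G := C₁ * w.re ^ (-(3 * ε)) with hGd
  have hG0 : 0 ≤ G := by positivity
  have hGX : G ≤ C₁ * (π / 2) ^ (3 * ε) * X ^ (3 * ε) := by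
    rw [hGd, mul_assoc, ← Real.mul_rpow (by positivity) hX0.le]
    refine mul_le_mul_of_nonneg_left ?_ hC₁.le
    rw [Real.rpow_neg hwre.le, ← Real.inv_rpow hwre.le]
    refine Real.rpow_le_rpow (by positivity) ?_ (by positivity)
    rw [inv_le_comm₀ hwre (by positivity)]
    refine le_trans (le_of_eq ?_) hre1
    field_simp
  have hdual := sum_norm_sq_integral_mul_cexp_le (integrable_rayConv hwre hw1).integrableOn hG0
    (show 0 < ε / 2 by positivity)
    (by simpa only [mul_div_right_comm] using hG) t R hts
  have hRX : (R:ℝ) ≤ X := by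
    have h1 : 1 ∈ Finset.Icc 1 R := Finset.mem_Icc.2 ⟨le_rfl, hR⟩
    have h2 : R ∈ Finset.Icc 1 R := Finset.mem_Icc.2 ⟨hR, le_rfl⟩
    have h3 := (le_abs_self _).trans (hts R h2 1 h1)
    have h4 : |t R - t 1| ≤ X - 1 := by
      rw [abs_le]
      constructor <;> linarith [(ht R h2).1, (ht R h2).2, (ht 1 h1).1, (ht 1 h1).2]
    push_cast at h3
    linarith
  -- The spacing forces `R ≤ X`, so the logarithmic loss of the large sieve is a small power of `X`.
  have hlog : log R ≤ X ^ ε / ε := by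
    have hR0 : (0:ℝ) < R := by exact_mod_cast hR
    exact (Real.log_le_log hR0 hRX).trans (Real.log_le_rpow_div hX0.le hε)
  have hX1 : 1 ≤ X ^ ε := Real.one_le_rpow hX hε.le
  have hK : 1 / (ε / 2) + 4 * (1 + log R) ≤ (6 / ε + 4) * X ^ ε := by
    have e : 1 / (ε / 2) + 4 * (1 + X ^ ε / ε) = 2 / ε + 4 + 4 / ε * X ^ ε := by field_simp; ring
    have h5 : 0 ≤ 2 / ε + 4 := by positivity
    have e2 : (6 / ε + 4) * X ^ ε = (2 / ε + 4) * X ^ ε + 4 / ε * X ^ ε := by field_simp; ring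
    rw [e2]
    nlinarith
  have hterm : ∀ r ∈ Finset.Icc 1 R, ‖riemannZeta (1 / 2 + Complex.I * t r)‖ ^ 4 ≤
      4 * c ^ 4 * X * ‖∫ x in Ioi (0:ℝ), rayConv w x *
        Complex.exp (Complex.I * t r * x / 2)‖ ^ 2 := by
    intro r hr
    have hr1 := ht r hr
    have ht0 : 0 < t r := by linarith
    have h5 := hζ X (t r) hX hr1.1 hr1.2
    have h6 := norm_mellin_sq_le hwre hw1 (t r)
    set Z := ‖riemannZeta (1 / 2 + Complex.I * t r)‖
    set Q := ‖∫ x in Ioi (0:ℝ), rayConv w x * Complex.exp (Complex.I * t r * x / 2)‖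
    have h7 : Z ^ 4 * (t r)⁻¹ ≤ c ^ 4 * (2 * Q) ^ 2 := by
      have h8 := pow_le_pow_left₀ (by positivity) h5 4
      rw [mul_pow, mul_pow, ← Real.rpow_mul_natCast ht0.le] at h8
      rw [show (-(1 / 4) : ℝ) * (4:ℕ) = -1 by norm_num, Real.rpow_neg_one] at h8
      refine h8.trans (mul_le_mul_of_nonneg_left ?_ (by positivity))
      have h9 := pow_le_pow_left₀ (by positivity) h6 2
      rw [← pow_mul] at h9
      exact h9
    rw [← div_eq_mul_inv, div_le_iff₀ ht0] at h7
    refine h7.trans ?_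
    have : c ^ 4 * (2 * Q) ^ 2 * t r ≤ c ^ 4 * (2 * Q) ^ 2 * X :=
      mul_le_mul_of_nonneg_left hr1.2 (by positivity)
    linarith
  refine (Finset.sum_le_sum hterm).trans ?_
  rw [← Finset.mul_sum]
  have hlog0 := log_natCast_nonneg R
  calc 4 * c ^ 4 * X * ∑ r ∈ Finset.Icc 1 R, ‖∫ x in Ioi (0:ℝ), rayConv w x *
    Complex.exp (Complex.I * t r * x / 2)‖ ^ 2
      ≤ 4 * c ^ 4 * X * ((C₁ * (π / 2) ^ (3 * ε) * X ^ (3 * ε)) * ((6 / ε + 4) * X ^ ε)) := by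
        refine mul_le_mul_of_nonneg_left (hdual.trans ?_) (by positivity)
        exact mul_le_mul hGX hK (by positivity) (by positivity)
    _ = _ := by
        have : X ^ (1 + 4 * ε) = X * (X ^ (3 * ε) * X ^ ε) := by
          rw [← Real.rpow_add hX0, ← Real.rpow_one_add' hX0.le (by positivity)]; ring_nf
        rw [this]
        ring

/-! ### Large values and the fourth moment -/

theorem abs_sub_le_of_one_le_sub {R : ℕ} {t : ℕ → ℝ}
    (h : ∀ r ∈ Finset.Ico 1 R, 1 ≤ t (r + 1) - t r) :
    ∀ r ∈ Finset.Icc 1 R, ∀ s ∈ Finset.Icc 1 R, |(r:ℝ) - s| ≤ |t r - t s| := by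
  have key : ∀ r j : ℕ, 1 ≤ r → r + j ≤ R → (j:ℝ) ≤ t (r + j) - t r := by
    intro r j hr
    induction j with
    | zero => simp
    | succ j ih =>
      intro hj
      have h1 := ih (by omega)
      have h2 := h (r + j) (Finset.mem_Ico.2 ⟨by omega, by omega⟩)
      rw [← add_assoc]
      push_cast
      linarith
  have key2 : ∀ r s : ℕ, 1 ≤ r → r ≤ s → s ≤ R → (s:ℝ) - r ≤ t s - t r := by
    intro r s hr hrs hs
    obtain ⟨j, rfl⟩ := Nat.exists_eq_add_of_le hrs
    have := key r j hr hs
    push_cast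
    linarith
  intro r hr s hs
  rw [Finset.mem_Icc] at hr hs
  rcases le_total r s with hrs | hrs
  · rw [abs_sub_comm, abs_sub_comm (t r), abs_of_nonneg (by rw [sub_nonneg]; exact_mod_cast hrs)]
    exact (key2 r s hr.1 hrs hs.2).trans (le_abs_self _)
  · rw [abs_of_nonneg (by rw [sub_nonneg]; exact_mod_cast hrs)]
    exact (key2 s r hs.1 hrs hr.2).trans (le_abs_self _)

/-- The number of `1`-spaced points of `[T, 2T]` at which the zeta function is large. -/
theorem exists_large_values_bound {ε : ℝ} (hε : 0 < ε) :
    ∃ C : ℝ, ∀ (T V : ℝ) (R : ℕ) (τ : ℕ → ℝ),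
        1 ≤ T → 0 < V → WellSpacedPoints T 1 R τ →
        (∀ r ∈ Finset.Icc 1 R, V ≤ ‖riemannZeta (1 / 2 + Complex.I * (τ r : ℂ))‖) →
        (R : ℝ) ≤ C * T ^ (1 + ε) * V ^ (-4 : ℝ) := by
  set κ := min (ε / 4) (1 / 2) with hκ
  have hκ0 : 0 < κ := by positivity
  obtain ⟨C, hC, h⟩ := exists_sum_norm_riemannZeta_pow_four_le hκ0 (min_le_right _ _)
  refine ⟨C * 2 ^ (1 + ε), fun T V R τ hT hV hτ hζ => ?_⟩
  have h1 := h (2 * T) R τ (by linarith) (fun r hr =>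
    ⟨hT.trans (hτ.1 r hr).1, (hτ.1 r hr).2⟩) (abs_sub_le_of_one_le_sub hτ.2)
  have h2 : (R:ℝ) * V ^ 4 ≤ ∑ r ∈ Finset.Icc 1 R, ‖riemannZeta (1 / 2 + Complex.I * τ r)‖ ^ 4 := by
    have := Finset.sum_le_sum fun r hr => pow_le_pow_left₀ hV.le (hζ r hr) 4
    simpa using this
  have h3 : (2 * T) ^ (1 + 4 * κ) ≤ 2 ^ (1 + ε) * T ^ (1 + ε) := by
    rw [← Real.mul_rpow (by norm_num) (by linarith)]
    refine Real.rpow_le_rpow_of_exponent_le (by linarith) ?_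
    have : κ ≤ ε / 4 := min_le_left _ _
    linarith
  have h4 := h2.trans (h1.trans (mul_le_mul_of_nonneg_left h3 hC.le))
  rw [Real.rpow_neg hV.le, show (4:ℝ) =
    ((4:ℕ):ℝ) by norm_num, Real.rpow_natCast, ← div_eq_mul_inv, le_div_iff₀ (by positivity)]
  linarith

/-- The fourth moment, as an average of discrete fourth moments over the points `r + x` with
`1 ≤ r ≤ ⌈T⌉` and `x ∈ [0, 1]`. -/
theorem exists_fourth_moment_bound {ε : ℝ} (hε : 0 < ε) :
    ∃ C : ℝ, ∀ T : ℝ, 1 ≤ T →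
        ∫ t in (0 : ℝ)..T, ‖riemannZeta (1 / 2 + Complex.I * (t : ℂ))‖ ^ 4 ≤ C * T ^ (1 + ε) := by
  set κ := min (ε / 4) (1 / 2) with hκ
  have hκ0 : 0 < κ := by positivity
  obtain ⟨C, hC, h⟩ := exists_sum_norm_riemannZeta_pow_four_le hκ0 (min_le_right _ _)
  set f : ℝ → ℝ := fun t => ‖riemannZeta (1 / 2 + Complex.I * (t : ℂ))‖ ^ 4 with hf
  have hfc : Continuous f := by
    have : Continuous fun t : ℝ => riemannZeta (1 / 2 + Complex.I * (t : ℂ)) := by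
      rw [continuous_iff_continuousAt]
      intro t
      have hd : ContinuousAt riemannZeta (1 / 2 + Complex.I * (t : ℂ)) := by
        refine (differentiableAt_riemannZeta fun h => ?_).continuousAt
        have := congrArg Complex.re h
        norm_num at this
      exact ContinuousAt.comp (f := fun t : ℝ => 1 / 2 + Complex.I * (t : ℂ)) hd (by fun_prop)
    exact this.norm.pow 4
  have hf0 : ∀ t, 0 ≤ f t := fun t => by positivity
  refine ⟨(∫ t in (0:ℝ)..1, f t) + C * 3 ^ (1 + ε), fun T hT => ?_⟩
  have hA0 : 0 ≤ ∫ t in (0:ℝ)..1, f t := intervalIntegral.integral_nonneg zero_le_one fun t _ =>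
    hf0 t
  have hTε : 1 ≤ T ^ (1 + ε) := Real.one_le_rpow hT (by linarith)
  set N := ⌈T⌉₊ with hN
  have hNT : T ≤ N := Nat.le_ceil T
  have hNT' : (N:ℝ) < T + 1 := Nat.ceil_lt_add_one (by linarith)
  have h1 : ∫ t in (1:ℝ)..(N + 1 : ℕ), f t ≤ C * (3 * T) ^ (1 + 4 * κ) := by
    have hsum := intervalIntegral.sum_integral_adjacent_intervals_Ico (f := f) (μ := volume)
      (a := fun k : ℕ => (k:ℝ)) (m := 1) (n := N + 1) (by omega)
      fun k _ => hfc.intervalIntegrable _ _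
    rw [Nat.cast_one] at hsum
    rw [← hsum, Finset.Ico_add_one_right_eq_Icc]
    have hsh : ∀ k : ℕ, ∫ x in (k:ℝ)..((k + 1 : ℕ) : ℝ), f x = ∫ x in (0:ℝ)..1, f (k + x) := by
      intro k
      rw [intervalIntegral.integral_comp_add_left]
      push_cast
      rw [add_zero]
    simp_rw [hsh]
    rw [← intervalIntegral.integral_finsetSum fun k _ =>
      Continuous.intervalIntegrable (by fun_prop) _ _]
    have hc : C * (3 * T) ^ (1 + 4 * κ) = ∫ _ in (0:ℝ)..1, C * (3 * T) ^ (1 + 4 * κ) := by simp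
    rw [hc]
    refine intervalIntegral.integral_mono_on zero_le_one (Continuous.intervalIntegrable
      (by fun_prop) _ _) intervalIntegrable_const fun x hx => ?_
    refine h (3 * T) N (fun k => k + x) (by linarith) (fun r hr => ?_) fun r _ s _ => ?_
    · have hr1 : (1:ℝ) ≤ r := by exact_mod_cast (Finset.mem_Icc.1 hr).1
      have hr2 : (r:ℝ) ≤ N := by exact_mod_cast (Finset.mem_Icc.1 hr).2
      constructor <;> linarith [hx.1, hx.2]
    · rw [add_sub_add_right_eq_sub]
  have h2 : ∫ t in (1:ℝ)..T, f t ≤ ∫ t in (1:ℝ)..(N + 1 : ℕ), f t := by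
    refine intervalIntegral.integral_mono_interval le_rfl hT ?_ (ae_of_all _ hf0)
      (hfc.intervalIntegrable _ _)
    push_cast; linarith
  have h3 : (3 * T) ^ (1 + 4 * κ) ≤ 3 ^ (1 + ε) * T ^ (1 + ε) := by
    rw [← Real.mul_rpow (by norm_num) (by linarith)]
    refine Real.rpow_le_rpow_of_exponent_le (by linarith) ?_
    have : κ ≤ ε / 4 := min_le_left _ _
    linarith
  have h4 := intervalIntegral.integral_add_adjacent_intervals (hfc.intervalIntegrable
    (μ := volume) 0 1) (hfc.intervalIntegrable 1 T)
  rw [← h4]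
  have h5 := mul_le_mul_of_nonneg_left h3 hC.le
  nlinarith

end

theorem mainTheorem2 :
    (∀ ε η θ B : ℝ, 0 < η → η ≤ ε → 0 < θ →
      ∃ C : ℝ, ∀ (T G : ℝ) (R : ℕ) (τ : ℕ → ℝ) (φ : ℕ → ℝ → ℝ),
        8 ≤ T → T ^ θ ≤ G → G ≤ T ^ (1 / 3 : ℝ) →
        WellSpacedPoints T (5 * G) R τ →
        (∀ r ∈ Finset.Icc 1 R, IsSmoothWeight B (τ r) G (φ r)) →
        |weightedAtkinsonSum (T ^ (1 + η) / G ^ 2) G R τ φ|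
          ≤ C * (R : ℝ) ^ (1 / 2 : ℝ) * T ^ (1 / 2 + ε)) ∧
    (∀ ε : ℝ, 0 < ε →
      ∃ C : ℝ, ∀ (T V : ℝ) (R : ℕ) (τ : ℕ → ℝ),
        1 ≤ T → 0 < V → WellSpacedPoints T 1 R τ →
        (∀ r ∈ Finset.Icc 1 R, V ≤ ‖riemannZeta (1 / 2 + Complex.I * (τ r : ℂ))‖) →
        (R : ℝ) ≤ C * T ^ (1 + ε) * V ^ (-4 : ℝ)) ∧
    (∀ ε : ℝ, 0 < ε →
      ∃ C : ℝ, ∀ T : ℝ, 1 ≤ T →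
        ∫ t in (0 : ℝ)..T, ‖riemannZeta (1 / 2 + Complex.I * (t : ℂ))‖ ^ 4
          ≤ C * T ^ (1 + ε)) :=
  ⟨exists_weightedAtkinsonSum_bound, fun _ => exists_large_values_bound, fun _ =>
    exists_fourth_moment_bound⟩
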